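/- Let $E$ be a complex Banach space, $p,q\ge 1$ integers, $k>0$, $0<s<1$, $s_1\ge 0$, $R_0>0$, $0<2\epsilon<\pi/k$ and $d\in\mathbb R$. \emph{Notation.} For $a<b$ and $0<r\le+\infty$ put $\Pi_{p,q}(a,b,r)=\{(x_1,x_2)\in\mathbb C^2 : 0<|x_1|^p,|x_2|^q<r,\ a<\arg(x_1^px_2^q)<b\}$, and $S_{p,q}(d,\omega,r)=\Pi_{p,q}(d-\omega/2,d+\omega/2,r)$; $r$ is omitted when $r=+\infty$. A point of the sector carries the value of $\arg(x_1^px_2^q)$ in $(a,b)$; if $b-a>2\pi$ the sector is understood as spread over $(\mathbb C\setminus\{0\})^2$, its points being the pairs $(x_1,x_2)$ together with a value of $\arg(x_1^px_2^q)$ in $(a,b)$. The function $x_1^{pk}x_2^{qk}=(x_1^px_2^q)^k$ is taken with this argument. Let $\mathcal C$ be the set of series $\hat f=\sum a_{n,m}x_1^nx_2^m\in E[[x_1,x_2]]$ for which there is $r>0$ such that all the series $\sum_m a_{n,m}z^m$ and $\sum_n a_{n,m}z^n$ define bounded holomorphic maps on $|z|<r$. Write $\hat f=\sum_{n\ge0}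 f_n(x_1,x_2)(x_1^px_2^q)^n$ with $f_n=\sum_{m<p\text{ or }j<q}a_{np+m,nq+j}x_1^mx_2^j$. For $f$ holomorphic on $\Pi_{p,q}(a,b,r)$ with values in $E$, $\hat f\in\mathcal C$ and $\sigma\ge0$, $f\sim^{(p,q)}_{\sigma}\hat f$ on $\Pi_{p,q}(a,b,r)$ means: there is a real $r'$ with $0<r'\le r$ such that all $f_n$ are bounded and holomorphic on $\{|x_1|^p<r',|x_2|^q<r'\}$ and for all $a<a'<b'<b$ and $0<\rho<r'$ there are $C,A>0$ with $$\Big\|f(x_1,x_2)-\sum_{n=0}^{N-1}f_n(x_1,x_2)(x_1^px_2^q)^n\Big\|\le CA^N N!^{\sigma}|x_1^px_2^q|^N\quad\text{on }\Pi_{p,q}(a',b',\rho),\ N\in\mathbb N.$$ The Borel transform with weight $(s,1-s)$ of a map $h$ on $S_{p,q}(d,\pi/k+2\epsilon,R_0)$ is $$\mathcal B(h)(\xi_1,\xi_2)=\frac{(\xi_1^{pk}\xi_2^{qk})^{-1}}{2\pi i}\int_\gamma h\big(\xi_1u^{-\frac{s}{pk}},\xi_2u^{-\frac{1-s}{qk}}\big)e^u\,du,\qquad(\xi_1,\xi_2)\in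 S_{p,q}(d,2\epsilon),$$ with principal powers of $u$, the argument of the monomial at the point where $h$ is evaluated being $\arg(\xi_1^p\xi_2^q)-\arg(u)/k$. Here, for $(\xi_1,\xi_2)\in S_{p,q}(d,2\epsilon')$ with $0<\epsilon'<\epsilon$, the path $\gamma$ is positively oriented and consists of the arc $|u|=R$, $|\arg u|\le\pi/2+k(\epsilon-\epsilon')$, with $R>\max\{(|\xi_1|^p/R_0)^{k/s},(|\xi_2|^q/R_0)^{k/(1-s)}\}$, and of the half-lines from its end points to $\infty$ in the directions $\pm(\pi/2+k(\epsilon-\epsilon'))$. For $\hat f=\sum a_{n,m}x_1^nx_2^m$ the formal Borel transform of $x_1^{pk}x_2^{qk}\hat f$ is $$\hat{\mathcal B}(x_1^{pk}x_2^{qk}\hat f)=\sum_{n,m}\frac{a_{n,m}}{\Gamma\left(1+\frac{ns}{pk}+\frac{m(1-s)}{qk}\right)}\xi_1^n\xi_2^m .$$ \emph{Statement.} Let $f$ be an $E$-valued holomorphic map on $S_{p,q}(d,\pi/k+2\epsilon,R_0)$ and $\hat f\in\mathcal C$ with $f\sim^{(p,q)}_{s_1}\hat f$ there. Let $g=\mathcal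 B(x_1^{pk}x_2^{qk}f)$, $\hat g=\hat{\mathcal B}(x_1^{pk}x_2^{qk}\hat f)$, $\hat g=\sum_n g_n\cdot(\xi_1^p\xi_2^q)^n$ its decomposition as above, and $s_2=\max\{s_1-1/k,0\}$. Then $g$ is well defined on $S_{p,q}(d,2\epsilon)$ (the integrals converge absolutely and do not depend on $\epsilon'$ and $R$), $g$ is holomorphic there, $\hat g\in\mathcal C$, every $g_n$ is entire, and $$g\sim^{(p,q)}_{s_2}\hat g\quad\text{on }S_{p,q}(d,2\epsilon).$$ Furthermore, for all $d-\epsilon<a<b<d+\epsilon$ there are constants $B,D,M>0$ such that for all $N\in\mathbb N$ $$\Big\|g(\xi_1,\xi_2)-\sum_{n=0}^{N-1}g_n(\xi_1,\xi_2)(\xi_1^p\xi_2^q)^n\Big\|\le DB^N\Gamma(1+Ns_2)|\xi_1^p\xi_2^q|^Ne^{M\left(|\xi_1|^{\frac{pk}{s}}+|\xi_2|^{\frac{qk}{1-s}}\right)}\quad\text{on }\Pi_{p,q}(a,b).$$ In particular (case $N=0$) $g$ is of exponential growth at most $\left(\frac{pk}{s},\frac{qk}{1-s}\right)$ on $S_{p,q}(d,2\epsilon)$: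 for all such $a,b$ there are $C,M>0$ with $\|g(\xi_1,\xi_2)\|\le Ce^{M(|\xi_1|^{pk/s}+|\xi_2|^{qk/(1-s)})}$ on $\Pi_{p,q}(a,b)$. -/

import Mathlib

noncomputable section

/-!
## Monomial sectors

A point of a sector in the monomial `x₁ ^ p * x₂ ^ q` is a triple `(x₁, x₂, θ)`, where `θ` is the
value of the argument of `x₁ ^ p * x₂ ^ q` that is being used.  If the opening `b - a` is at most
`2 * π` then `θ` is determined by `(x₁, x₂)` (see `monomialSector_injOn`) and the sector is a subset
of `ℂ²`; a larger opening gives a sector spread over `(ℂ \ {0})²`, on which a branch of the argument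
of the monomial exists.  A map on a sector is a function `f x₁ x₂ θ`.
-/

/-- The sector `Π_{p,q}(a, b, r)`; `r = ⊤` gives the unbounded sector `Π_{p,q}(a, b)`. -/
def monomialSector (p q : ℕ) (a b : ℝ) (r : EReal) : Set (ℂ × ℂ × ℝ) :=
  {x | x.1 ≠ 0 ∧ x.2.1 ≠ 0 ∧
    ((‖x.1‖ ^ p : ℝ) : EReal) < r ∧ ((‖x.2.1‖ ^ q : ℝ) : EReal) < r ∧
    x.1 ^ p * x.2.1 ^ q = (‖x.1 ^ p * x.2.1 ^ q‖ : ℂ) * Complex.exp (x.2.2 * Complex.I) ∧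
    a < x.2.2 ∧ x.2.2 < b}

theorem monomialSector_injOn (p q : ℕ) (a b : ℝ) (r : EReal) (hab : b - a ≤ 2 * Real.pi) :
    Set.InjOn (fun x : ℂ × ℂ × ℝ => (x.1, x.2.1)) (monomialSector p q a b r) := by
  rintro ⟨x₁, x₂, θ⟩ ⟨h₁, h₂, -, -, h, ha, hb⟩ ⟨y₁, y₂, η⟩ ⟨-, -, -, -, h', ha', hb'⟩ hxy
  simp only [Prod.mk.injEq] at hxy h h' ha hb ha' hb' h₁ h₂
  obtain ⟨rfl, rfl⟩ := hxy
  have hne : (‖x₁ ^ p * x₂ ^ q‖ : ℂ) ≠ 0 := by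
    have : x₁ ^ p * x₂ ^ q ≠ 0 := mul_ne_zero (pow_ne_zero _ h₁) (pow_ne_zero _ h₂)
    exact_mod_cast norm_ne_zero_iff.mpr this
  have he := mul_left_cancel₀ hne (h.symm.trans h')
  obtain ⟨n, hn⟩ := Complex.exp_eq_exp_iff_exists_int.mp he
  have hn' : θ = η + n * (2 * Real.pi) := by
    have := congrArg Complex.im hn
    simpa using this
  have hpi := Real.pi_pos
  have h1 : (n : ℝ) < 1 := by nlinarith
  have h2 : (-1 : ℝ) < n := by nlinarith
  have h0 : n = 0 := by
    have h1' : n < 1 := by exact_mod_cast h1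
    have h2' : -1 < n := by exact_mod_cast h2
    omega
  simp [hn', h0]

/-- The argument of `y₁ ^ p * y₂ ^ q` that continues the value `θ` at `(x₁, x₂)`, for `(y₁, y₂)`
close to `(x₁, x₂)`. -/
def continuedArg (p q : ℕ) (x₁ x₂ : ℂ) (θ : ℝ) (y₁ y₂ : ℂ) : ℝ :=
  θ + Complex.arg ((y₁ ^ p * y₂ ^ q) / (x₁ ^ p * x₂ ^ q))

/-- `f` is holomorphic on the (open) set `S` of points `(x₁, x₂, θ)`, with `(x₁, x₂)` as local
coordinates. -/
def MonomialHolomorphicOn {E : Type*} [NormedAddCommGroup E] [NormedSpace ℂ E] (p q : ℕ)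
    (f : ℂ → ℂ → ℝ → E) (S : Set (ℂ × ℂ × ℝ)) : Prop :=
  ∀ x₁ x₂ : ℂ, ∀ θ : ℝ, (x₁, x₂, θ) ∈ S →
    DifferentiableAt ℂ (fun y : ℂ × ℂ => f y.1 y.2 (continuedArg p q x₁ x₂ θ y.1 y.2)) (x₁, x₂)

/-!
## Formal power series in two variables

The series `∑ c n m * x₁ ^ n * x₂ ^ m` in `E[[x₁, x₂]]` is given by its coefficients `c : ℕ → ℕ → E`.
-/

/-- The set `𝒞`: for some `r > 0`, the series is in `O_b(D_r, E)[[x₁]]` and in `O_b(D_r, E)[[x₂]]`. -/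
def MemC {E : Type*} [NormedAddCommGroup E] [NormedSpace ℂ E] (c : ℕ → ℕ → E) : Prop :=
  ∃ r : ℝ, 0 < r ∧
    (∀ n, ∃ h : ℂ → E, DifferentiableOn ℂ h (Metric.ball 0 r) ∧
      (∃ K : ℝ, ∀ z ∈ Metric.ball (0 : ℂ) r, ‖h z‖ ≤ K) ∧
      ∀ z ∈ Metric.ball (0 : ℂ) r, HasSum (fun m => z ^ m • c n m) (h z)) ∧
    (∀ m, ∃ h : ℂ → E, DifferentiableOn ℂ h (Metric.ball 0 r) ∧
      (∃ K : ℝ, ∀ z ∈ Metric.ball (0 : ℂ) r, ‖h z‖ ≤ K) ∧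
      ∀ z ∈ Metric.ball (0 : ℂ) r, HasSum (fun n => z ^ n • c n m) (h z))

/-- The coefficient of `x₁ ^ m * x₂ ^ j` in the `n`-th coefficient `f_n` of `T̂_{p,q}(f̂) = ∑ f_n t ^ n`,
where `f̂ = ∑ f_n(x₁, x₂) * (x₁ ^ p * x₂ ^ q) ^ n`. -/
def monomialCoeff {E : Type*} [NormedAddCommGroup E] (p q : ℕ) (c : ℕ → ℕ → E) (n m j : ℕ) : E :=
  if m < p ∨ j < q then c (n * p + m) (n * q + j) else 0

/-- The terms of the power series `f_n` at `(x₁, x₂)`. -/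
def monomialTerm {E : Type*} [NormedAddCommGroup E] [NormedSpace ℂ E] (p q : ℕ) (c : ℕ → ℕ → E)
    (n : ℕ) (x₁ x₂ : ℂ) (mj : ℕ × ℕ) : E :=
  (x₁ ^ mj.1 * x₂ ^ mj.2) • monomialCoeff p q c n mj.1 mj.2

/-- The map `f_n`. -/
def monomialPart {E : Type*} [NormedAddCommGroup E] [NormedSpace ℂ E] (p q : ℕ) (c : ℕ → ℕ → E)
    (n : ℕ) (x₁ x₂ : ℂ) : E :=
  ∑' mj : ℕ × ℕ, monomialTerm p q c n x₁ x₂ mj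

/-- The polydisc `|x₁| ^ p < r`, `|x₂| ^ q < r`, which contains the sectors of radius `r`. -/
def monomialPolydisc (p q : ℕ) (r : ℝ) : Set (ℂ × ℂ) :=
  {x | ‖x.1‖ ^ p < r ∧ ‖x.2‖ ^ q < r}

/-- Every `f_n` is (the Taylor series at the origin of) a bounded holomorphic map on the polydisc
`|x₁| ^ p < r`, `|x₂| ^ q < r`. -/
def MonomialPartsOn {E : Type*} [NormedAddCommGroup E] [NormedSpace ℂ E] (p q : ℕ)
    (c : ℕ → ℕ → E) (r : ℝ) : Prop :=
  ∀ n, (∀ x ∈ monomialPolydisc p q r, Summable (monomialTerm p q c n x.1 x.2)) ∧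
    DifferentiableOn ℂ (fun x : ℂ × ℂ => monomialPart p q c n x.1 x.2) (monomialPolydisc p q r) ∧
    ∃ K : ℝ, ∀ x ∈ monomialPolydisc p q r, ‖monomialPart p q c n x.1 x.2‖ ≤ K

/-- The remainder `f(x₁, x₂) - ∑_{n < N} f_n(x₁, x₂) * (x₁ ^ p * x₂ ^ q) ^ n`. -/
def monomialRemainder {E : Type*} [NormedAddCommGroup E] [NormedSpace ℂ E] (p q : ℕ)
    (f : ℂ → ℂ → ℝ → E) (c : ℕ → ℕ → E) (N : ℕ) (x₁ x₂ : ℂ) (θ : ℝ) : E :=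
  f x₁ x₂ θ - ∑ n ∈ Finset.range N, ((x₁ ^ p * x₂ ^ q) ^ n) • monomialPart p q c n x₁ x₂

/-- `f ∼_s^{(p,q)} f̂` on `Π_{p,q}(a, b, r)`: `f` is holomorphic there, `f̂` (with coefficients `c`)
is in `𝒞`, and `f` has `f̂` as asymptotic expansion of `s`-Gevrey type in `x₁ ^ p * x₂ ^ q`. -/
def HasMonomialGevreyExpansion {E : Type*} [NormedAddCommGroup E] [NormedSpace ℂ E] (p q : ℕ)
    (s a b : ℝ) (r : EReal) (f : ℂ → ℂ → ℝ → E) (c : ℕ → ℕ → E) : Prop :=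
  MonomialHolomorphicOn p q f (monomialSector p q a b r) ∧ MemC c ∧
  ∃ r' : ℝ, 0 < r' ∧ (r' : EReal) ≤ r ∧ MonomialPartsOn p q c r' ∧
    ∀ a' b' ρ : ℝ, a < a' → a' < b' → b' < b → 0 < ρ → ρ < r' →
      ∃ C A : ℝ, 0 < C ∧ 0 < A ∧ ∀ N : ℕ, ∀ x₁ x₂ : ℂ, ∀ θ : ℝ,
        (x₁, x₂, θ) ∈ monomialSector p q a' b' (ρ : EReal) →
          ‖monomialRemainder p q f c N x₁ x₂ θ‖ ≤
            C * A ^ N * (N.factorial : ℝ) ^ s * ‖x₁ ^ p * x₂ ^ q‖ ^ N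

/-- `f` is of exponential growth at most `(α₁, α₂)` on the unbounded sector `Π_{p,q}(a, b)`. -/
def HasExponentialGrowth {E : Type*} [NormedAddCommGroup E] (p q : ℕ) (α₁ α₂ a b : ℝ)
    (f : ℂ → ℂ → ℝ → E) : Prop :=
  ∀ a' b' : ℝ, a < a' → a' < b' → b' < b →
    ∃ C M : ℝ, 0 < C ∧ 0 < M ∧ ∀ x₁ x₂ : ℂ, ∀ θ : ℝ, (x₁, x₂, θ) ∈ monomialSector p q a' b' ⊤ →
      ‖f x₁ x₂ θ‖ ≤ C * Real.exp (M * (‖x₁‖ ^ α₁ + ‖x₂‖ ^ α₂))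

/-!
## The Borel transforms
-/

/-- The function `x₁ ^ (p k) * x₂ ^ (q k) = (x₁ ^ p * x₂ ^ q) ^ k` for real `k`, with the branch
given by the argument `θ` of `x₁ ^ p * x₂ ^ q`. -/
def monomialPower (p q : ℕ) (k : ℝ) (x₁ x₂ : ℂ) (θ : ℝ) : ℂ :=
  ((‖x₁‖ ^ (p * k) * ‖x₂‖ ^ (q * k) : ℝ) : ℂ) * Complex.exp ((k * θ : ℝ) * Complex.I)

/-- The integral of `F` along the positively oriented Hankel path which consists of the arc
`R * exp (i φ)`, `|φ| ≤ Φ`, and of the half-lines from its end points to infinity in the directions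
`-Φ` (run through towards the arc) and `Φ` (run through away from it). -/
def hankelIntegral {E : Type*} [NormedAddCommGroup E] [NormedSpace ℂ E] (R Φ : ℝ) (F : ℂ → E) : E :=
  -(∫ t in Set.Ioi R, Complex.exp (-Φ * Complex.I) • F (t * Complex.exp (-Φ * Complex.I)))
    + (∫ φ in (-Φ)..Φ, (Complex.I * R * Complex.exp (φ * Complex.I)) •
        F (R * Complex.exp (φ * Complex.I)))
    + ∫ t in Set.Ioi R, Complex.exp (Φ * Complex.I) • F (t * Complex.exp (Φ * Complex.I))

/-- The integral of `F` along the Hankel path converges absolutely. -/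
def HankelIntegrable {E : Type*} [NormedAddCommGroup E] (R Φ : ℝ) (F : ℂ → E) : Prop :=
  MeasureTheory.IntegrableOn (fun t : ℝ => F (t * Complex.exp (-Φ * Complex.I))) (Set.Ioi R) ∧
  IntervalIntegrable (fun φ : ℝ => F (R * Complex.exp (φ * Complex.I)))
    MeasureTheory.volume (-Φ) Φ ∧
  MeasureTheory.IntegrableOn (fun t : ℝ => F (t * Complex.exp (Φ * Complex.I))) (Set.Ioi R)

/-- The integrand `f (ξ₁ u ^ (-s/(pk)), ξ₂ u ^ (-(1-s)/(qk))) * exp u`, with principal powers of `u`;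
the argument `θ` of `ξ₁ ^ p * ξ₂ ^ q` becomes `θ - arg u / k`. -/
def borelIntegrand {E : Type*} [NormedAddCommGroup E] [NormedSpace ℂ E] (p q : ℕ) (k s : ℝ)
    (f : ℂ → ℂ → ℝ → E) (ξ₁ ξ₂ : ℂ) (θ : ℝ) (u : ℂ) : E :=
  Complex.exp u • f (ξ₁ * u ^ ((-(s / (p * k)) : ℝ) : ℂ))
    (ξ₂ * u ^ ((-((1 - s) / (q * k)) : ℝ) : ℂ)) (θ - Complex.arg u / k)

/-- The Borel integral of `f` along the Hankel path with parameters `R`, `Φ`. -/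
def borelAlong {E : Type*} [NormedAddCommGroup E] [NormedSpace ℂ E] (p q : ℕ) (k s R Φ : ℝ)
    (f : ℂ → ℂ → ℝ → E) (ξ₁ ξ₂ : ℂ) (θ : ℝ) : E :=
  ((monomialPower p q k ξ₁ ξ₂ θ)⁻¹ / (2 * Real.pi * Complex.I)) •
    hankelIntegral R Φ (borelIntegrand p q k s f ξ₁ ξ₂ θ)

/-- The number that the radius of the arc of the Hankel path has to exceed at `(ξ₁, ξ₂)`. -/
def hankelBound (p q : ℕ) (k s R₀ : ℝ) (ξ₁ ξ₂ : ℂ) : ℝ :=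
  max ((‖ξ₁‖ ^ p / R₀) ^ (k / s)) ((‖ξ₂‖ ^ q / R₀) ^ (k / (1 - s)))

/-- The angle of the half-lines of the Hankel path for points of `S_{p,q}(d, 2 ε')`, `ε' < ε`. -/
def hankelAngle (k ε ε' : ℝ) : ℝ := Real.pi / 2 + k * (ε - ε')

/-- The `k`-Borel transform of `f` with respect to `x₁ ^ p * x₂ ^ q` and weight `(s, 1 - s)`, for `f`
on `S_{p,q}(d, π / k + 2 ε, R₀)`, at the points of `S_{p,q}(d, 2 ε)`.  It is computed along one
admissible Hankel path: `ε' = (ε + |θ - d|) / 2` is between `|θ - d|` and `ε`. -/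
def monomialBorel {E : Type*} [NormedAddCommGroup E] [NormedSpace ℂ E] (p q : ℕ)
    (k s d ε R₀ : ℝ) (f : ℂ → ℂ → ℝ → E) (ξ₁ ξ₂ : ℂ) (θ : ℝ) : E :=
  borelAlong p q k s (hankelBound p q k s R₀ ξ₁ ξ₂ + 1) (hankelAngle k ε ((ε + |θ - d|) / 2))
    f ξ₁ ξ₂ θ

/-- The coefficients of the formal Borel transform of `x₁ ^ (p k) * x₂ ^ (q k) * f̂`, where `f̂` has
the coefficients `c`: term by term, `x₁ ^ μ₁ * x₂ ^ μ₂` is sent to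
`ξ₁ ^ (μ₁ - p k) * ξ₂ ^ (μ₂ - q k) / Γ (μ₁ * s / (p k) + μ₂ * (1 - s) / (q k))`, here with
`μ₁ = p k + n` and `μ₂ = q k + m`. -/
def formalMonomialBorel {E : Type*} [NormedAddCommGroup E] [NormedSpace ℂ E] (p q : ℕ) (k s : ℝ)
    (c : ℕ → ℕ → E) (n m : ℕ) : E :=
  ((Real.Gamma ((p * k + n) * s / (p * k) + (q * k + m) * (1 - s) / (q * k)) : ℂ))⁻¹ • c n m

end

/-! In logarithmic coordinates `ξ₁ = exp ζ₁`, `ξ₂ = exp ζ₂`, `u = exp w` the Borel integral becomes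
linear. Passing from `ξ` to the point where `f` is evaluated is the translation of `ζ` by `-w *
(s/(pk), (1-s)/(qk))`. The factor `(x₁^p x₂^q)^k` contributes `u⁻¹` times its value at `ξ`, which
cancels both the prefactor of the transform and `du = exp w dw` (`exp_smul_borelIntegrand`). What
remains is the integral of `exp (exp w) • f` over the boundary of a half-strip `Re w ≥ L`, `|Im w| ≤
Φ` with `π/2 < Φ < π`. The weight decays doubly exponentially on the two rays, so Cauchy's theorem
on rectangles gives independence of `L = log R` and of `Φ` (`stripIntegral_eq_stripIntegral`).

Hankel's formula for `1/Γ` (`stripIntegral_hankelFunction`), applied term by term to the power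
series of `f_n`, shows that the same integral sends `f_n (x₁^p x₂^q)^n` to `g_n (ξ₁^p ξ₂^q)^n`
(`hankelPathIntegral_monomialPart`). Hence the remainder of `g` is the Borel integral of the
remainder of `f` (`monomialRemainder_monomialBorel`). The divisors `Γ(1 + λ)` outgrow every
geometric sequence, so every `g_n` is entire.

For the estimate the radius `R` of the arc may depend on `N` and `ξ`. The monomial at the shifted
point has modulus at most `|ξ₁^p ξ₂^q| R^(-1/k)`, so the remainder of order `N` gains `R^(-N/k)`
while the kernel costs a constant times `e^R`. With `R` equal to `1 + N/k` plus multiples of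
`|ξ₁|^(pk/s)` and `|ξ₂|^(qk/(1-s))`, the gain absorbs `N!^(1/k)` up to a geometric factor, lowering
the Gevrey order by `1/k`, and `e^R` is geometric in `N` times the allowed exponential growth
(`exists_norm_monomialRemainder_monomialBorel_le`). On bounded sectors this growth is a constant,
which gives the asymptotic expansion; the case `N = 0` is the growth of `g`.

Holomorphy follows because near a given point one fixed path can be used, and `g` is then an
integral of translates of a bounded holomorphic map (`differentiableAt_integral_translate`). -/

section

open Complex Set Filter Topology MeasureTheory

noncomputable section

/-! ## Integrals along the boundary of a half-strip -/

/-- The closed half-strip `Re w ≥ L`, `|Im w| ≤ Φ`. -/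
def halfStrip (L Φ : ℝ) : Set ℂ := {w | L ≤ w.re ∧ |w.im| ≤ Φ}

/-- The integral of `H` along the positively oriented boundary of `halfStrip L Φ`. -/
def stripIntegral {E : Type*} [NormedAddCommGroup E] [NormedSpace ℂ E] (L Φ : ℝ) (H : ℂ → E) : E :=
  -(∫ x : ℝ in Ioi L, H (x + (-Φ : ℝ) * I)) + I • (∫ y : ℝ in (-Φ)..Φ, H (L + y * I))
    + ∫ x : ℝ in Ioi L, H (x + Φ * I)

theorem halfStrip_mono {L L' Φ Φ' : ℝ} (hL : L' ≤ L) (hΦ : Φ ≤ Φ') :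
    halfStrip L Φ ⊆ halfStrip L' Φ' := fun _ hw => ⟨hL.trans hw.1, hw.2.trans hΦ⟩

theorem integrableOn_ray {E : Type*} [NormedAddCommGroup E] {H : ℂ → E} {L C a y : ℝ}
    (hc : ContinuousOn (fun x : ℝ => H (x + y * I)) (Ioi L))
    (ha : 0 < a) (hb : ∀ x : ℝ, L < x → ‖H (x + y * I)‖ ≤ C * Real.exp (-a * x)) :
    IntegrableOn (fun x : ℝ => H (x + y * I)) (Ioi L) := by
  refine Integrable.mono' ((integrableOn_exp_mul_Ioi (neg_lt_zero.mpr ha) L).const_mul C)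
    (hc.aestronglyMeasurable measurableSet_Ioi) ?_
  exact (ae_restrict_iff' measurableSet_Ioi).mpr (Eventually.of_forall hb)

section StripIntegral

variable {E : Type*} [NormedAddCommGroup E] [NormedSpace ℂ E] {H : ℂ → E} {L Φ Φ' C a : ℝ}

/-- Cauchy's theorem on the rectangle with real parts in `[L, T]`, with `T → ∞`: the far vertical
side is `O(exp (-a T))` and disappears. -/
theorem integral_ray_sub_integral_ray {y₁ y₂ : ℝ} (hy : y₁ ≤ y₂) (ha : 0 < a)
    (hd : ∀ w : ℂ, L ≤ w.re → w.im ∈ Icc y₁ y₂ → DifferentiableAt ℂ H w)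
    (hb : ∀ w : ℂ, L ≤ w.re → w.im ∈ Icc y₁ y₂ → ‖H w‖ ≤ C * Real.exp (-a * w.re)) :
    (∫ x : ℝ in Ioi L, H (x + y₁ * I)) - (∫ x : ℝ in Ioi L, H (x + y₂ * I)) =
      I • ∫ y : ℝ in y₁..y₂, H (L + y * I) := by
  have hcont : ∀ y ∈ Icc y₁ y₂, ContinuousOn (fun x : ℝ => H (x + y * I)) (Ioi L) := by
    intro y hy x hx
    refine ContinuousAt.continuousWithinAt ?_
    refine ContinuousAt.comp (f := fun x : ℝ => (x : ℂ) + y * I) (g := H) ?_ (by fun_prop)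
    exact (hd _ (by simpa using (le_of_lt hx)) (by simpa using hy)).continuousAt
  have hint : ∀ y ∈ Icc y₁ y₂, IntegrableOn (fun x : ℝ => H (x + y * I)) (Ioi L) := by
    intro y hy
    refine integrableOn_ray (C := C) (hcont y hy) ha fun x hx => ?_
    simpa using hb (x + y * I) (by simpa using hx.le) (by simpa using hy)
  have h1 := intervalIntegral_tendsto_integral_Ioi L (hint y₁ ⟨le_rfl, hy⟩) tendsto_id
  have h2 := intervalIntegral_tendsto_integral_Ioi L (hint y₂ ⟨hy, le_rfl⟩) tendsto_id
  have h3 : Tendsto (fun T : ℝ => I • ∫ y : ℝ in y₁..y₂, H (T + y * I)) atTop (𝓝 0) := by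
    have hlim : Tendsto (fun T : ℝ => (C * Real.exp (-a * T)) * |y₂ - y₁|) atTop (𝓝 0) := by
      have : Tendsto (fun T : ℝ => Real.exp (-a * T)) atTop (𝓝 0) := by
        refine Real.tendsto_exp_atBot.comp ?_
        exact tendsto_id.const_mul_atTop_of_neg (neg_lt_zero.mpr ha)
      simpa using (this.const_mul C).mul_const (|y₂ - y₁|)
    refine squeeze_zero_norm' ?_ hlim
    filter_upwards [eventually_ge_atTop L] with T hT
    rw [norm_smul, norm_I, one_mul]
    refine intervalIntegral.norm_integral_le_of_norm_le_const fun y hy' => ?_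
    rw [uIoc_of_le hy] at hy'
    simpa using hb (T + y * I) (by simpa using hT) (by simpa using ⟨hy'.1.le, hy'.2⟩)
  have h4 := ((h1.sub h2).add h3).sub_const (I • ∫ y : ℝ in y₁..y₂, H (L + y * I))
  have h5 : ∀ᶠ T : ℝ in atTop, ((∫ x : ℝ in L..id T, H (x + y₁ * I)) -
      (∫ x : ℝ in L..id T, H (x + y₂ * I)) + I • ∫ y : ℝ in y₁..y₂, H (T + y * I)) -
        (I • ∫ y : ℝ in y₁..y₂, H (L + y * I)) = 0 := by
    filter_upwards [eventually_ge_atTop L] with T hT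
    have := Complex.integral_boundary_rect_eq_zero_of_differentiableOn H ⟨L, y₁⟩ ⟨T, y₂⟩ ?_
    · simpa using this
    · rintro w ⟨hw1, hw2⟩
      simp only [mem_preimage, uIcc_of_le hT, uIcc_of_le hy] at hw1 hw2
      exact (hd w hw1.1 hw2).differentiableWithinAt
  have h6 := tendsto_nhds_unique (h4.congr' h5) tendsto_const_nhds
  rw [add_zero] at h6
  exact sub_eq_zero.mp h6

/-- Only the two strips between the old and the new rays are swept out to infinity, so decay is
asked for only where `Φ ≤ |w.im|`. It could not be asked for near the real axis, where `exp (exp w)`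
explodes. -/
theorem stripIntegral_eq_of_angle_le (hΦ : 0 ≤ Φ) (h : Φ ≤ Φ') (ha : 0 < a)
    (hd : ∀ w ∈ halfStrip L Φ', DifferentiableAt ℂ H w)
    (hb : ∀ w ∈ halfStrip L Φ', Φ ≤ |w.im| → ‖H w‖ ≤ C * Real.exp (-a * w.re)) :
    stripIntegral L Φ H = stripIntegral L Φ' H := by
  have hup := integral_ray_sub_integral_ray (H := H) (C := C) (L := L) h ha
    (fun w hw hw' => hd w ⟨hw, abs_le.mpr ⟨by linarith [hw'.1], hw'.2⟩⟩)
    (fun w hw hw' => hb w ⟨hw, abs_le.mpr ⟨by linarith [hw'.1], hw'.2⟩⟩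
      (hw'.1.trans (le_abs_self _)))
  have hlow := integral_ray_sub_integral_ray (H := H) (C := C) (L := L) (neg_le_neg h) ha
    (fun w hw hw' => hd w ⟨hw, abs_le.mpr ⟨hw'.1, by linarith [hw'.2]⟩⟩)
    (fun w hw hw' => hb w ⟨hw, abs_le.mpr ⟨hw'.1, by linarith [hw'.2]⟩⟩
      (by linarith [neg_abs_le w.im, hw'.2]))
  have hii : ∀ y₁ ∈ Icc (-Φ') Φ', ∀ y₂ ∈ Icc (-Φ') Φ',
      IntervalIntegrable (fun y : ℝ => H (L + y * I)) volume y₁ y₂ := by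
    intro y₁ h₁ y₂ h₂
    refine ContinuousOn.intervalIntegrable fun y hy => ContinuousAt.continuousWithinAt ?_
    have hy' := uIcc_subset_Icc h₁ h₂ hy
    refine ContinuousAt.comp (f := fun y : ℝ => (L : ℂ) + y * I) (g := H) ?_ (by fun_prop)
    exact (hd _ ⟨by simp, by simpa using abs_le.mpr hy'⟩).continuousAt
  have m1 : -Φ' ∈ Icc (-Φ') Φ' := ⟨le_rfl, by linarith⟩
  have m2 : -Φ ∈ Icc (-Φ') Φ' := ⟨by linarith, by linarith⟩
  have m3 : Φ ∈ Icc (-Φ') Φ' := ⟨by linarith, by linarith⟩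
  have m4 : Φ' ∈ Icc (-Φ') Φ' := ⟨by linarith, by linarith⟩
  have hsplit := intervalIntegral.integral_add_adjacent_intervals (hii _ m1 _ m2) (hii _ m2 _ m4)
  have hsplit' := intervalIntegral.integral_add_adjacent_intervals (hii _ m2 _ m3) (hii _ m3 _ m4)
  unfold stripIntegral
  rw [← hsplit, ← hsplit', smul_add, smul_add, ← hup, ← hlow]
  abel

/-- Moving the vertical side is Cauchy's theorem on a bounded rectangle; the decay serves only to
make the integrals over the rays converge. -/
theorem stripIntegral_eq_of_le {L' : ℝ} (hΦ : 0 ≤ Φ) (hL : L ≤ L') (ha : 0 < a)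
    (hd : ∀ w ∈ halfStrip L Φ, DifferentiableAt ℂ H w)
    (hb : ∀ w ∈ halfStrip L Φ, Φ ≤ |w.im| → ‖H w‖ ≤ C * Real.exp (-a * w.re)) :
    stripIntegral L Φ H = stripIntegral L' Φ H := by
  have hrect := Complex.integral_boundary_rect_eq_zero_of_differentiableOn H ⟨L, -Φ⟩ ⟨L', Φ⟩ (by
    rintro w ⟨hw1, hw2⟩
    simp only [mem_preimage, uIcc_of_le hL, uIcc_of_le (by linarith : -Φ ≤ Φ)] at hw1 hw2
    exact (hd w ⟨hw1.1, abs_le.mpr hw2⟩).differentiableWithinAt)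
  have hint : ∀ y : ℝ, |y| = Φ → IntegrableOn (fun x : ℝ => H (x + y * I)) (Ioi L) := by
    intro y hy
    refine integrableOn_ray (C := C) (fun x hx => ContinuousAt.continuousWithinAt ?_) ha
      fun x hx => ?_
    · refine ContinuousAt.comp (f := fun x : ℝ => (x : ℂ) + y * I) (g := H) ?_ (by fun_prop)
      exact (hd _ ⟨by simpa using (le_of_lt hx), by simp [hy]⟩).continuousAt
    · simpa using hb (x + y * I) ⟨by simpa using hx.le, by simp [hy]⟩ (by simp [hy])
  have hsplit : ∀ y : ℝ, |y| = Φ → (∫ x : ℝ in L..L', H (x + y * I)) =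
      (∫ x : ℝ in Ioi L, H (x + y * I)) - ∫ x : ℝ in Ioi L', H (x + y * I) := by
    intro y hy
    have := intervalIntegral.integral_Ioi_sub_Ioi (hint y hy) hL
    exact this.symm
  simp only at hrect
  rw [hsplit (-Φ) (by rw [abs_neg, abs_of_nonneg hΦ]), hsplit Φ (abs_of_nonneg hΦ)] at hrect
  unfold stripIntegral
  rw [← sub_eq_zero, ← neg_eq_zero, ← hrect]
  abel

theorem stripIntegral_eq_stripIntegral {L₁ L₂ Φ₁ Φ₂ : ℝ} (h₁ : 0 ≤ Φ₁) (h₂ : 0 ≤ Φ₂) (ha : 0 < a)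
    (hd : ∀ w ∈ halfStrip (min L₁ L₂) (max Φ₁ Φ₂), DifferentiableAt ℂ H w)
    (hb : ∀ w ∈ halfStrip (min L₁ L₂) (max Φ₁ Φ₂), min Φ₁ Φ₂ ≤ |w.im| →
      ‖H w‖ ≤ C * Real.exp (-a * w.re)) :
    stripIntegral L₁ Φ₁ H = stripIntegral L₂ Φ₂ H := by
  -- Both paths are compared with the boundary of the smallest half-strip containing the two.
  have key : ∀ L Φ : ℝ, min L₁ L₂ ≤ L → min Φ₁ Φ₂ ≤ Φ → Φ ≤ max Φ₁ Φ₂ → 0 ≤ Φ →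
      stripIntegral L Φ H = stripIntegral (min L₁ L₂) (max Φ₁ Φ₂) H := by
    intro L Φ hL hΦ hΦ' h0
    rw [← stripIntegral_eq_of_angle_le (C := C) h0 hΦ' ha hd
      (fun w hw hw' => hb w hw (hΦ.trans hw'))]
    exact (stripIntegral_eq_of_le (C := C) h0 hL ha
      (fun w hw => hd w (halfStrip_mono le_rfl hΦ' hw))
      (fun w hw hw' => hb w (halfStrip_mono le_rfl hΦ' hw) (hΦ.trans hw'))).symm
  rw [key L₁ Φ₁ (min_le_left _ _) (min_le_left _ _) (le_max_left _ _) h₁,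
    key L₂ Φ₂ (min_le_right _ _) (min_le_right _ _) (le_max_right _ _) h₂]

end StripIntegral

/-! ## Hankel's formula for the reciprocal of the Gamma function -/

theorem norm_exp_exp (w : ℂ) :
    ‖exp (exp w)‖ = Real.exp (Real.exp w.re * Real.cos w.im) := by
  rw [norm_exp, exp_re]

theorem norm_exp_exp_le (w : ℂ) : ‖exp (exp w)‖ ≤ Real.exp (Real.exp w.re) := by
  rw [norm_exp_exp]
  exact Real.exp_le_exp.mpr (mul_le_of_le_one_right (Real.exp_pos _).le (Real.cos_le_one _))

theorem norm_exp_exp_le_of_angle {Φ : ℝ} {w : ℂ} (h0 : 0 ≤ Φ) (h : Φ ≤ |w.im|)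
    (h' : |w.im| ≤ Real.pi) : ‖exp (exp w)‖ ≤ Real.exp (Real.cos Φ * Real.exp w.re) := by
  rw [norm_exp_exp, mul_comm]
  gcongr
  rw [← Real.cos_abs]
  exact Real.cos_le_cos_of_nonneg_of_le_pi h0 h' h

theorem cos_neg_of_angle {Φ : ℝ} (h : Real.pi / 2 < Φ) (h' : Φ ≤ Real.pi) : Real.cos Φ < 0 :=
  Real.cos_neg_of_pi_div_two_lt_of_lt h (by linarith [Real.pi_pos])

/-- Beyond the angle `π/2` the modulus is at most `exp (-c * exp (Re w))` with `c = -cos Φ > 0`,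
which beats every exponential rate `m`. -/
theorem exists_norm_exp_exp_le {Φ m : ℝ} (hΦ : Real.pi / 2 < Φ) (hΦ' : Φ ≤ Real.pi) (hm : 0 < m) :
    ∃ C : ℝ, 0 < C ∧ ∀ w : ℂ, Φ ≤ |w.im| → |w.im| ≤ Real.pi →
      ‖exp (exp w)‖ ≤ C * Real.exp (-m * w.re) := by
  have hc := cos_neg_of_angle hΦ hΦ'
  set c := -Real.cos Φ with hcdef
  have hc0 : 0 < c := by linarith
  -- The exponent is the maximum of `m * x - c * exp x`, attained at `x = log (m / c)`; the bound is
  -- the tangent line inequality for `exp` at that point.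
  refine ⟨Real.exp (m * (Real.log (m / c) - 1)), Real.exp_pos _, fun w h h' => ?_⟩
  refine (norm_exp_exp_le_of_angle (by linarith [Real.pi_pos]) h h').trans ?_
  rw [← Real.exp_add]
  refine Real.exp_le_exp.mpr ?_
  have h1 := Real.add_one_le_exp (w.re - Real.log (m / c))
  rw [Real.exp_sub, Real.exp_log (by positivity)] at h1
  have h2 : m * (w.re - Real.log (m / c) + 1) ≤ c * Real.exp w.re := by
    calc _ ≤ m * (Real.exp w.re / (m / c)) := by gcongr
      _ = c * Real.exp w.re := by field_simp
  have : Real.cos Φ = -c := by simp [hcdef]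
  rw [this]
  nlinarith

/-- The integrand of Hankel's formula, in the variable `w = log u`. -/
def hankelFunction (l : ℝ) (w : ℂ) : ℂ := exp (exp w) * exp (-(l * w))

theorem differentiable_hankelFunction (l : ℝ) : Differentiable ℂ (hankelFunction l) := by
  unfold hankelFunction; fun_prop

theorem norm_hankelFunction (l : ℝ) (w : ℂ) :
    ‖hankelFunction l w‖ = ‖exp (exp w)‖ * Real.exp (-(l * w.re)) := by
  rw [hankelFunction, norm_mul, norm_exp (-(l * w))]
  simp

theorem exists_norm_hankelFunction_le (l : ℝ) {Φ : ℝ} (hΦ : Real.pi / 2 < Φ) (hΦ' : Φ ≤ Real.pi) :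
    ∃ C a : ℝ, 0 < a ∧ ∀ w : ℂ, Φ ≤ |w.im| → |w.im| ≤ Real.pi →
      ‖hankelFunction l w‖ ≤ C * Real.exp (-a * w.re) := by
  -- The rate `|l| + 1` leaves a positive rate once the factor `exp (-(l * w.re))` has been
  -- absorbed, whatever the sign of `l`.
  obtain ⟨C, -, hC⟩ := exists_norm_exp_exp_le hΦ hΦ' (by positivity : 0 < |l| + 1)
  refine ⟨C, |l| + 1 + l, by linarith [neg_abs_le l], fun w h h' => ?_⟩
  rw [norm_hankelFunction]
  calc _ ≤ C * Real.exp (-(|l| + 1) * w.re) * Real.exp (-(l * w.re)) := by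
        gcongr; exact hC w h h'
    _ = _ := by rw [mul_assoc, ← Real.exp_add]; ring_nf

theorem stripIntegral_hankelFunction_eq (l : ℝ) {L L' Φ Φ' : ℝ} (hΦ : Real.pi / 2 < Φ)
    (hΦ' : Φ ≤ Real.pi) (h : Real.pi / 2 < Φ') (h' : Φ' ≤ Real.pi) :
    stripIntegral L Φ (hankelFunction l) = stripIntegral L' Φ' (hankelFunction l) := by
  obtain ⟨C, a, ha, hC⟩ := exists_norm_hankelFunction_le l (lt_min hΦ h)
    ((min_le_left _ _).trans hΦ')
  have := Real.pi_pos
  exact stripIntegral_eq_stripIntegral (C := C) (by linarith) (by linarith) ha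
    (fun w _ => (differentiable_hankelFunction l) w)
    (fun w hw hw' => hC w hw' (hw.2.trans (max_le hΦ' h')))

theorem integrableOn_hankelFunction_ray (l : ℝ) {L y : ℝ} (hy : Real.pi / 2 < |y|)
    (hy' : |y| ≤ Real.pi) : IntegrableOn (fun x : ℝ => hankelFunction l (x + y * I)) (Ioi L) := by
  obtain ⟨C, a, ha, hC⟩ := exists_norm_hankelFunction_le l hy hy'
  refine integrableOn_ray (C := C) (Continuous.continuousOn ?_) ha fun x _ => ?_
  · exact (differentiable_hankelFunction l).continuous.comp (by fun_prop)
  · simpa using hC (x + y * I) (by simp) (by simpa using hy')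

theorem hasDerivAt_hankelFunction (l : ℝ) (w : ℂ) :
    HasDerivAt (hankelFunction l) (hankelFunction (l - 1) w - l * hankelFunction l w) w := by
  have h1 : HasDerivAt (fun w : ℂ => exp (exp w)) (exp (exp w) * exp w) w :=
    (hasDerivAt_exp w).cexp
  have h2 : HasDerivAt (fun w : ℂ => exp (-(l * w))) (exp (-(l * w)) * -(l * 1)) w :=
    (((hasDerivAt_id w).const_mul (l : ℂ)).neg).cexp
  convert! h1.mul h2 using 1
  have : exp (-(((l - 1 : ℝ) : ℂ) * w)) = exp w * exp (-(l * w)) := by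
    rw [← Complex.exp_add]; push_cast; ring_nf
  simp only [hankelFunction, this]
  ring

/-- The difference of the two integrands is the derivative of `hankelFunction l`, which vanishes at
both ends of the path, and the boundary values at the two corners cancel. This is the contour form
of `Γ (1 + l) = l * Γ l`. -/
theorem stripIntegral_hankelFunction_sub_one (l : ℝ) (L : ℝ) {Φ : ℝ} (hΦ : Real.pi / 2 < Φ)
    (hΦ' : Φ ≤ Real.pi) :
    stripIntegral L Φ (hankelFunction (l - 1)) = l * stripIntegral L Φ (hankelFunction l) := by
  have hpi := Real.pi_pos
  have hΦ0 : 0 < Φ := by linarith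
  have ray : ∀ y : ℝ, Real.pi / 2 < |y| → |y| ≤ Real.pi →
      (∫ x : ℝ in Ioi L, hankelFunction (l - 1) (x + y * I)) -
        l * (∫ x : ℝ in Ioi L, hankelFunction l (x + y * I)) = - hankelFunction l (L + y * I) := by
    intro y hy hy'
    have hi1 := integrableOn_hankelFunction_ray (l - 1) (L := L) hy hy'
    have hi2 := integrableOn_hankelFunction_ray l (L := L) hy hy'
    rw [← integral_const_mul, ← integral_sub hi1 (hi2.const_mul _)]
    have hder : ∀ x : ℝ, HasDerivAt (fun x : ℝ => hankelFunction l (x + y * I))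
        (hankelFunction (l - 1) (x + y * I) - l * hankelFunction l (x + y * I)) x := by
      intro x
      have h1 : HasDerivAt (fun x : ℝ => (x : ℂ) + y * I) 1 x :=
        (ofRealCLM.hasDerivAt (x := x)).add_const _
      have h2 := (hasDerivAt_hankelFunction l (x + y * I)).comp x h1
      rw [mul_one] at h2
      exact h2
    have := integral_Ioi_of_hasDerivAt_of_tendsto (m := 0) (a := L)
      (hder L).continuousAt.continuousWithinAt (fun x _ => hder x) (hi1.sub (hi2.const_mul _)) ?_
    · simpa using this
    · obtain ⟨C, a, ha, hC⟩ := exists_norm_hankelFunction_le l hy hy'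
      refine squeeze_zero_norm (a := fun x : ℝ => C * Real.exp (-a * x)) (fun x => ?_) ?_
      · simpa using hC (x + y * I) (by simp) (by simpa using hy')
      · have : Tendsto (fun T : ℝ => Real.exp (-a * T)) atTop (𝓝 0) := by
          refine Real.tendsto_exp_atBot.comp ?_
          exact tendsto_id.const_mul_atTop_of_neg (neg_lt_zero.mpr ha)
        simpa using this.const_mul C
  have seg : I * (∫ y : ℝ in (-Φ)..Φ, hankelFunction (l - 1) (L + y * I)) -
      l * (I * (∫ y : ℝ in (-Φ)..Φ, hankelFunction l (L + y * I))) =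
        hankelFunction l (L + Φ * I) - hankelFunction l (L + (-Φ : ℝ) * I) := by
    have hcont : ∀ m : ℝ, Continuous fun y : ℝ => hankelFunction m (L + y * I) := fun m =>
      (differentiable_hankelFunction m).continuous.comp (by fun_prop)
    have hi : ∀ m : ℝ, IntervalIntegrable (fun y : ℝ => hankelFunction m (L + y * I)) volume
        (-Φ) Φ := fun m => (hcont m).intervalIntegrable _ _
    rw [mul_left_comm, ← mul_sub, ← intervalIntegral.integral_const_mul,
      ← intervalIntegral.integral_sub (hi _) ((hi _).const_mul _),
      ← intervalIntegral.integral_const_mul]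
    have hder : ∀ y : ℝ, HasDerivAt (fun y : ℝ => hankelFunction l (L + y * I))
        (I * (hankelFunction (l - 1) (L + y * I) - l * hankelFunction l (L + y * I))) y := by
      intro y
      have h1 : HasDerivAt (fun y : ℝ => (L : ℂ) + y * I) (1 * I) y :=
        ((ofRealCLM.hasDerivAt (x := y)).mul_const I).const_add _
      have h2 := (hasDerivAt_hankelFunction l (L + y * I)).comp y h1
      rw [one_mul, mul_comm] at h2
      exact h2
    exact intervalIntegral.integral_eq_sub_of_hasDerivAt (fun y _ => hder y)
      ((((hi _).sub ((hi _).const_mul _))).const_mul I)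
  have r1 := ray Φ (by rwa [abs_of_pos hΦ0]) (by rwa [abs_of_pos hΦ0])
  have r2 := ray (-Φ) (by rwa [abs_neg, abs_of_pos hΦ0]) (by rwa [abs_neg, abs_of_pos hΦ0])
  unfold stripIntegral
  simp only [smul_eq_mul]
  linear_combination r1 - r2 + seg

theorem hankelFunction_real_add_pi (l x : ℝ) :
    hankelFunction l (x + Real.pi * I) =
      (Real.exp (-Real.exp x) * Real.exp (-(l * x)) : ℝ) * exp (-(l * Real.pi) * I) := by
  have : exp ((x : ℂ) + Real.pi * I) = -exp x := by rw [exp_add, exp_pi_mul_I]; ring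
  rw [hankelFunction, this]
  push_cast
  rw [mul_assoc, ← Complex.exp_add (-(l * x : ℂ))]
  ring_nf

theorem hankelFunction_real_sub_pi (l x : ℝ) :
    hankelFunction l (x + (-Real.pi : ℝ) * I) =
      (Real.exp (-Real.exp x) * Real.exp (-(l * x)) : ℝ) * exp ((l * Real.pi) * I) := by
  have : exp ((x : ℂ) + (-Real.pi : ℝ) * I) = -exp x := by
    rw [exp_add]; push_cast; rw [neg_mul, exp_neg_pi_mul_I]; ring
  rw [hankelFunction, this]
  push_cast
  rw [mul_assoc, ← Complex.exp_add (-(l * x : ℂ))]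
  ring_nf

/-- For `Φ = π` both rays lie over the negative `u`-axis, so their integrands differ only by the
phases `exp (± i l π)`, which combine to a sine. -/
theorem stripIntegral_pi_hankelFunction (l L : ℝ) :
    stripIntegral L Real.pi (hankelFunction l) =
      -(2 * I * Real.sin (l * Real.pi) *
        (∫ x : ℝ in Ioi L, Real.exp (-Real.exp x) * Real.exp (-(l * x)) : ℝ)) +
      I * ∫ y : ℝ in (-Real.pi)..Real.pi, hankelFunction l (L + y * I) := by
  unfold stripIntegral
  simp only [hankelFunction_real_add_pi, hankelFunction_real_sub_pi, smul_eq_mul]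
  rw [integral_mul_const, integral_mul_const, integral_complex_ofReal]
  push_cast
  rw [show -((l : ℂ) * Real.pi) * I = -((l * Real.pi : ℂ) * I) by ring, Complex.sin]
  ring_nf
  simp only [I_sq]
  ring_nf

/-- For `l = 0` the sine vanishes and only the circle of radius `exp M` is left. As `M → -∞` its
integrand tends to `1`. -/
theorem stripIntegral_hankelFunction_zero (L : ℝ) {Φ : ℝ} (hΦ : Real.pi / 2 < Φ)
    (hΦ' : Φ ≤ Real.pi) :
    stripIntegral L Φ (hankelFunction 0) = 2 * Real.pi * I := by
  have hpi := Real.pi_pos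
  have h1 : ∀ M : ℝ, stripIntegral L Φ (hankelFunction 0) =
      I * ∫ y : ℝ in (-Real.pi)..Real.pi, exp (exp (M + y * I)) := by
    intro M
    rw [stripIntegral_hankelFunction_eq 0 (L' := M) (Φ' := Real.pi) hΦ hΦ' (by linarith) le_rfl,
      stripIntegral_pi_hankelFunction]
    simp [hankelFunction]
  have h2 : Tendsto (fun M : ℝ => (I * ∫ y : ℝ in (-Real.pi)..Real.pi, exp (exp (M + y * I))) -
      2 * Real.pi * I) atBot (𝓝 0) := by
    refine squeeze_zero_norm' (a := fun M : ℝ => 2 * Real.exp M * |Real.pi - -Real.pi|) ?_ ?_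
    · filter_upwards [eventually_le_atBot 0] with M hM
      have hint : IntervalIntegrable (fun y : ℝ => exp (exp (M + y * I))) volume
          (-Real.pi) Real.pi := by
        refine Continuous.intervalIntegrable (by fun_prop) _ _
      have e : (I * ∫ y : ℝ in (-Real.pi)..Real.pi, exp (exp (M + y * I))) - 2 * Real.pi * I =
          I * ∫ y : ℝ in (-Real.pi)..Real.pi, (exp (exp (M + y * I)) - 1) := by
        rw [intervalIntegral.integral_sub hint (by simp)]
        simp
        ring
      rw [e, norm_mul, norm_I, one_mul]
      refine intervalIntegral.norm_integral_le_of_norm_le_const fun y _ => ?_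
      have hn : ‖exp ((M : ℂ) + y * I)‖ = Real.exp M := by simp [norm_exp]
      rw [← hn]
      exact norm_exp_sub_one_le (by rw [hn]; simpa using hM)
    · simpa using (Real.tendsto_exp_atBot.const_mul 2).mul_const (|Real.pi - -Real.pi|)
  have h3 : Tendsto (fun _ : ℝ => stripIntegral L Φ (hankelFunction 0) - 2 * Real.pi * I) atBot
      (𝓝 0) := h2.congr fun M => by rw [← h1 M]
  exact sub_eq_zero.mp (tendsto_nhds_unique tendsto_const_nhds h3)

/-- For `-1 < l < 0` the path may be collapsed onto the negative axis: the circle of radius `exp M`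
contributes `O(exp (-l M))`, which tends to `0`, and the rays tend to Euler's integral for `Γ (-l)`.
The reflection formula turns the sine times `Γ (-l)` into `1 / Γ (1 + l)`. -/
theorem stripIntegral_hankelFunction_of_neg {l : ℝ} (hl : -1 < l) (hl' : l < 0) (L : ℝ) {Φ : ℝ}
    (hΦ : Real.pi / 2 < Φ) (hΦ' : Φ ≤ Real.pi) :
    stripIntegral L Φ (hankelFunction l) = 2 * Real.pi * I / Real.Gamma (1 + l) := by
  have hpi := Real.pi_pos
  have hconv := Real.GammaIntegral_convergent (s := -l) (by linarith)
  have h1 : ∀ M : ℝ, (∫ x : ℝ in Ioi M, Real.exp (-Real.exp x) * Real.exp (-(l * x))) =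
      ∫ t in Ioi (Real.exp M), Real.exp (-t) * t ^ (-l - 1) := by
    intro M
    rw [← integral_comp_exp_Ioi]
    refine setIntegral_congr_fun measurableSet_Ioi fun x _ => ?_
    simp only [smul_eq_mul]
    rw [← Real.exp_mul, mul_left_comm, ← Real.exp_add x]
    ring_nf
  have h2 : Tendsto (fun M : ℝ => ∫ t in Ioi (Real.exp M), Real.exp (-t) * t ^ (-l - 1)) atBot
      (𝓝 (Real.Gamma (-l))) := by
    rw [Real.Gamma_eq_integral (by linarith)]
    have := (aecover_Ioi_of_Ioi (μ := volume) Real.tendsto_exp_atBot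
      ).integral_tendsto_of_countably_generated hconv
    refine this.congr fun M => ?_
    rw [Measure.restrict_restrict measurableSet_Ioi,
      inter_eq_left.mpr (Ioi_subset_Ioi (Real.exp_pos M).le)]
  have h3 : Tendsto (fun M : ℝ => I * ∫ y : ℝ in (-Real.pi)..Real.pi, hankelFunction l (M + y * I))
      atBot (𝓝 0) := by
    refine squeeze_zero_norm' (a := fun M : ℝ => Real.exp 1 * Real.exp (-l * M) *
      |Real.pi - -Real.pi|) ?_ ?_
    · filter_upwards [eventually_le_atBot 0] with M hM
      rw [norm_mul, norm_I, one_mul]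
      refine intervalIntegral.norm_integral_le_of_norm_le_const fun y _ => ?_
      rw [norm_hankelFunction]
      have := norm_exp_exp_le ((M : ℂ) + y * I)
      simp only [add_re, ofReal_re, mul_re, I_re, mul_zero, ofReal_im, I_im, mul_one, sub_self,
        add_zero] at this ⊢
      rw [← neg_mul]
      gcongr
      refine this.trans (Real.exp_le_exp.mpr ?_)
      simpa using hM
    · have : Tendsto (fun M : ℝ => Real.exp (-l * M)) atBot (𝓝 0) :=
        Real.tendsto_exp_atBot.comp (tendsto_id.const_mul_atBot (by linarith))
      simpa using (this.const_mul (Real.exp 1)).mul_const (|Real.pi - -Real.pi|)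
  have h4 : Tendsto (fun _ : ℝ => stripIntegral L Φ (hankelFunction l)) atBot
      (𝓝 (-(2 * I * Real.sin (l * Real.pi) * Real.Gamma (-l)) + 0)) := by
    have h5 : Tendsto (fun M : ℝ => ((∫ t in Ioi (Real.exp M), Real.exp (-t) * t ^ (-l - 1) : ℝ) :
      ℂ)) atBot (𝓝 (Real.Gamma (-l) : ℂ)) := (continuous_ofReal.tendsto _).comp h2
    refine (((h5.const_mul (2 * I * Real.sin (l * Real.pi))).neg).add h3).congr fun M => ?_
    rw [stripIntegral_hankelFunction_eq l (L' := M) (Φ' := Real.pi) hΦ hΦ' (by linarith) le_rfl,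
      stripIntegral_pi_hankelFunction, h1]
  rw [tendsto_nhds_unique tendsto_const_nhds h4, add_zero]
  have hrefl := Real.Gamma_mul_Gamma_one_sub (-l)
  have hsin : Real.sin (Real.pi * -l) ≠ 0 := by
    refine (Real.sin_pos_of_pos_of_lt_pi ?_ ?_).ne' <;> nlinarith
  have hG : Real.Gamma (1 + l) ≠ 0 := (Real.Gamma_pos_of_pos (by linarith)).ne'
  have key : -(Real.sin (l * Real.pi) * Real.Gamma (-l)) * Real.Gamma (1 + l) = Real.pi := by
    rw [show (1 : ℝ) - -l = 1 + l by ring, eq_div_iff hsin,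
      show Real.pi * -l = -(l * Real.pi) by ring, Real.sin_neg] at hrefl
    linarith
  rw [eq_div_iff (by exact_mod_cast hG)]
  have key' : -((Real.sin (l * Real.pi) : ℂ) * Real.Gamma (-l)) * Real.Gamma (1 + l) = Real.pi := by
    exact_mod_cast key
  linear_combination 2 * I * key'

/-- The cases `-1 < l < 0` and `l = 0` are propagated upwards in unit steps by the functional
equation. -/
theorem stripIntegral_hankelFunction {l : ℝ} (hl : -1 < l) (L : ℝ) {Φ : ℝ}
    (hΦ : Real.pi / 2 < Φ) (hΦ' : Φ ≤ Real.pi) :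
    stripIntegral L Φ (hankelFunction l) = 2 * Real.pi * I / Real.Gamma (1 + l) := by
  have main : ∀ n : ℕ, ∀ l : ℝ, -1 < l → l ≤ n →
      stripIntegral L Φ (hankelFunction l) = 2 * Real.pi * I / Real.Gamma (1 + l) := by
    intro n
    induction n with
    | zero =>
      intro l hl hl'
      rcases lt_or_eq_of_le hl' with h | h
      · exact stripIntegral_hankelFunction_of_neg hl (by simpa using h) L hΦ hΦ'
      · obtain rfl : l = 0 := by simpa using h
        simp [stripIntegral_hankelFunction_zero L hΦ hΦ']
    | succ n ih =>
      intro l hl hl'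
      rcases le_or_gt l 0 with h | h
      · exact ih l hl (h.trans (by positivity))
      · have h1 := ih (l - 1) (by linarith) (by push_cast at hl'; linarith)
        rw [stripIntegral_hankelFunction_sub_one l L hΦ hΦ', show 1 + (l - 1) = l by ring] at h1
        have hl0 : (l : ℂ) ≠ 0 := by exact_mod_cast h.ne'
        rw [add_comm, Real.Gamma_add_one h.ne', ofReal_mul, mul_comm (l : ℂ), ← div_div, ← h1]
        field_simp
  obtain ⟨n, hn⟩ := exists_nat_ge l
  exact main n l hl hn

/-! ## The boundary of a half-strip as a single path -/

/-- A parametrization by arc length of the positively oriented boundary of `halfStrip L Φ`. -/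
def hankelPath (L Φ t : ℝ) : ℂ :=
  ((L + max (|t| - Φ) 0 : ℝ) : ℂ) + ((max (-Φ) (min t Φ) : ℝ) : ℂ) * I

/-- The velocity of `hankelPath L Φ`. -/
def hankelVelocity (Φ t : ℝ) : ℂ := if t ≤ -Φ then -1 else if t ≤ Φ then I else 1

/-- The weight of the Borel integral along `hankelPath L Φ`. -/
def hankelKernel (L Φ t : ℝ) : ℂ := hankelVelocity Φ t * exp (exp (hankelPath L Φ t))

theorem hankelPath_re (L Φ t : ℝ) : (hankelPath L Φ t).re = L + max (|t| - Φ) 0 := by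
  simp [hankelPath]

theorem hankelPath_im (L Φ t : ℝ) : (hankelPath L Φ t).im = max (-Φ) (min t Φ) := by
  simp [hankelPath]

theorem hankelPath_mem (L t : ℝ) {Φ : ℝ} (hΦ : 0 ≤ Φ) : hankelPath L Φ t ∈ halfStrip L Φ := by
  refine ⟨by simp [hankelPath_re], ?_⟩
  rw [hankelPath_im, abs_le]
  exact ⟨le_max_left _ _, max_le (by linarith) (min_le_right _ _)⟩

theorem continuous_hankelPath (L Φ : ℝ) : Continuous (hankelPath L Φ) := by
  unfold hankelPath; fun_prop

theorem measurable_hankelVelocity (Φ : ℝ) : Measurable (hankelVelocity Φ) :=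
  Measurable.ite measurableSet_Iic measurable_const
    (Measurable.ite measurableSet_Iic measurable_const measurable_const)

theorem norm_hankelVelocity (Φ t : ℝ) : ‖hankelVelocity Φ t‖ = 1 := by
  unfold hankelVelocity; split_ifs <;> simp

theorem measurable_hankelKernel (L Φ : ℝ) : Measurable (hankelKernel L Φ) :=
  (measurable_hankelVelocity Φ).mul
    (Complex.continuous_exp.comp (Complex.continuous_exp.comp
      (continuous_hankelPath L Φ))).measurable

theorem norm_hankelKernel (L Φ t : ℝ) :
    ‖hankelKernel L Φ t‖ = ‖exp (exp (hankelPath L Φ t))‖ := by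
  rw [hankelKernel, norm_mul, norm_hankelVelocity, one_mul]

/-- One exponential majorant in arc length for all three pieces: the segment costs `exp (exp L)`,
and on the rays `1 + y ≤ exp y` weakens the double exponential decay to rate `a`. The rate is left
free so that it can be chosen independently of `L`. -/
theorem norm_hankelKernel_le {L Φ a : ℝ} (hΦ : 0 ≤ Φ) (hΦ' : Φ ≤ Real.pi) (ha : 0 < a)
    (ha' : a ≤ -Real.cos Φ * Real.exp L) (t : ℝ) :
    ‖hankelKernel L Φ t‖ ≤ Real.exp (Real.exp L + a * Φ) * Real.exp (-a * |t|) := by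
  rw [norm_hankelKernel, ← Real.exp_add]
  rcases le_or_gt |t| Φ with h | h
  · refine (norm_exp_exp_le _).trans (Real.exp_le_exp.mpr ?_)
    rw [hankelPath_re, max_eq_right (by linarith), add_zero]
    nlinarith
  · have him : |(hankelPath L Φ t).im| = Φ := by
      rw [hankelPath_im]
      rcases lt_abs.mp h with h1 | h1
      · rw [min_eq_right h1.le, max_eq_right (by linarith), abs_of_nonneg hΦ]
      · rw [max_eq_left ((min_le_left _ _).trans (by linarith)), abs_neg, abs_of_nonneg hΦ]
    refine (norm_exp_exp_le_of_angle hΦ him.ge (him.le.trans hΦ')).trans (Real.exp_le_exp.mpr ?_)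
    rw [hankelPath_re, max_eq_left (by linarith), Real.exp_add]
    have h1 := Real.add_one_le_exp (|t| - Φ)
    have h2 : a * (|t| - Φ) ≤ -Real.cos Φ * Real.exp L * Real.exp (|t| - Φ) := by
      refine mul_le_mul ha' (by linarith) (by linarith) (ha.le.trans ha')
    have := Real.exp_pos L
    nlinarith

theorem integral_exp_neg_mul_abs {a : ℝ} (ha : 0 < a) :
    ∫ t : ℝ, Real.exp (-a * |t|) = 2 / a := by
  rw [integral_comp_abs (f := fun t => Real.exp (-a * t)), integral_exp_mul_Ioi (by linarith)]
  simp
  field_simp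

theorem integrable_exp_neg_mul_abs {a : ℝ} (ha : 0 < a) :
    Integrable fun t : ℝ => Real.exp (-a * |t|) := by
  by_contra h
  have h1 := integral_exp_neg_mul_abs ha
  -- The integral of a non-integrable function is `0` by convention, which contradicts the value `2
  -- / a`.
  rw [integral_undef h] at h1
  have : (0 : ℝ) < 2 / a := by positivity
  linarith

theorem hankelKernel_rate_pos {Φ : ℝ} (L : ℝ) (hΦ : Real.pi / 2 < Φ) (hΦ' : Φ ≤ Real.pi) :
    0 < -Real.cos Φ * Real.exp L :=
  mul_pos (by linarith [cos_neg_of_angle hΦ hΦ']) (Real.exp_pos L)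

theorem integrable_hankelKernel {Φ : ℝ} (L : ℝ) (hΦ : Real.pi / 2 < Φ) (hΦ' : Φ ≤ Real.pi) :
    Integrable (hankelKernel L Φ) := by
  have hr := hankelKernel_rate_pos L hΦ hΦ'
  refine Integrable.mono' ((integrable_exp_neg_mul_abs hr).const_mul _)
    (measurable_hankelKernel L Φ).aestronglyMeasurable (Eventually.of_forall fun t =>
      norm_hankelKernel_le (by linarith [Real.pi_pos]) hΦ' hr le_rfl t)

/-- For `L ≥ 0` the rate `-cos Φ` works for all `L`, so the dependence on the radius `R = exp L` is
exactly a factor `exp R`. The choice of `R` in the main estimate balances this cost. -/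
theorem integral_norm_hankelKernel_le {Φ L : ℝ} (hL : 0 ≤ L) (hΦ : Real.pi / 2 < Φ)
    (hΦ' : Φ ≤ Real.pi) :
    ∫ t, ‖hankelKernel L Φ t‖ ≤
      Real.exp (-Real.cos Φ * Φ) * (2 / -Real.cos Φ) * Real.exp (Real.exp L) := by
  have hc : 0 < -Real.cos Φ := by linarith [cos_neg_of_angle hΦ hΦ']
  have hle : -Real.cos Φ ≤ -Real.cos Φ * Real.exp L :=
    le_mul_of_one_le_right hc.le (Real.one_le_exp hL)
  calc _ ≤ ∫ t : ℝ, Real.exp (Real.exp L + -Real.cos Φ * Φ) * Real.exp (-(-Real.cos Φ) * |t|) :=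
        integral_mono (integrable_hankelKernel L hΦ hΦ').norm
          ((integrable_exp_neg_mul_abs hc).const_mul _)
          (norm_hankelKernel_le (by linarith [Real.pi_pos]) hΦ' hc hle)
    _ = _ := by
      rw [integral_const_mul, integral_exp_neg_mul_abs hc, Real.exp_add]
      ring

theorem ContinuousOn.comp_hankelPath {E : Type*} [NormedAddCommGroup E] {ψ : ℂ → E} {L Φ : ℝ}
    (hΦ : 0 ≤ Φ) (hc : ContinuousOn ψ (halfStrip L Φ)) :
    Continuous fun t => ψ (hankelPath L Φ t) := by
  rw [← continuousOn_univ]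
  exact hc.comp (continuous_hankelPath L Φ).continuousOn fun t _ => hankelPath_mem L t hΦ

section PathIntegral

variable {E : Type*} [NormedAddCommGroup E] [NormedSpace ℂ E] {ψ : ℂ → E} {L Φ C : ℝ}

/-- The integral of `exp (exp w) • ψ w` along `hankelPath L Φ`. -/
def hankelPathIntegral (L Φ : ℝ) (ψ : ℂ → E) : E :=
  ∫ t, hankelKernel L Φ t • ψ (hankelPath L Φ t)

theorem integrable_hankelKernel_smul (hΦ : Real.pi / 2 < Φ) (hΦ' : Φ ≤ Real.pi)
    (hc : ContinuousOn ψ (halfStrip L Φ)) (hb : ∀ w ∈ halfStrip L Φ, ‖ψ w‖ ≤ C) :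
    Integrable fun t => hankelKernel L Φ t • ψ (hankelPath L Φ t) := by
  have h0 : 0 ≤ Φ := by linarith [Real.pi_pos]
  exact (integrable_hankelKernel L hΦ hΦ').smul_bdd C
    (hc.comp_hankelPath h0).aestronglyMeasurable
    (Eventually.of_forall fun t => hb _ (hankelPath_mem L t h0))

theorem norm_hankelPathIntegral_le (hL : 0 ≤ L) (hΦ : Real.pi / 2 < Φ) (hΦ' : Φ ≤ Real.pi)
    (hb : ∀ w ∈ halfStrip L Φ, ‖ψ w‖ ≤ C) :
    ‖hankelPathIntegral L Φ ψ‖ ≤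
      Real.exp (-Real.cos Φ * Φ) * (2 / -Real.cos Φ) * Real.exp (Real.exp L) * C := by
  have h0 : 0 ≤ Φ := by linarith [Real.pi_pos]
  have hC : 0 ≤ C := (norm_nonneg _).trans (hb _ (hankelPath_mem L 0 h0))
  calc _ ≤ ∫ t, ‖hankelKernel L Φ t‖ * C := by
        refine norm_integral_le_of_norm_le ((integrable_hankelKernel L hΦ hΦ').norm.mul_const C)
          (Eventually.of_forall fun t => ?_)
        rw [norm_smul]
        gcongr
        exact hb _ (hankelPath_mem L t h0)
    _ ≤ _ := by
      rw [integral_mul_const]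
      gcongr
      exact integral_norm_hankelKernel_le hL hΦ hΦ'

/-- A single integral over `ℝ` against an integrable kernel makes dominated convergence and
differentiation under the integral available; the three-piece form is the one suited to Cauchy's
theorem. -/
theorem hankelPathIntegral_eq_stripIntegral (hΦ : Real.pi / 2 < Φ) (hΦ' : Φ ≤ Real.pi)
    (hc : ContinuousOn ψ (halfStrip L Φ)) (hb : ∀ w ∈ halfStrip L Φ, ‖ψ w‖ ≤ C) :
    hankelPathIntegral L Φ ψ = stripIntegral L Φ fun w => exp (exp w) • ψ w := by
  have h0 : 0 < Φ := by linarith [Real.pi_pos]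
  have hi := integrable_hankelKernel_smul hΦ hΦ' hc hb
  have shift : ∀ G : ℝ → E, ∫ t in Ioi Φ, G (L + (t - Φ)) = ∫ x in Ioi L, G x := by
    intro G
    have := (measurePreserving_add_right volume (L - Φ)).setIntegral_preimage_emb
      (measurableEmbedding_addRight _) G (Ioi L)
    rw [← this]
    have hpre : (fun x => x + (L - Φ)) ⁻¹' Ioi L = Ioi Φ := by ext x; simp
    rw [hpre]
    exact integral_congr_ae (Eventually.of_forall fun x => by simp only; congr 1; ring)
  have p1 : ∫ t in Iic (-Φ), hankelKernel L Φ t • ψ (hankelPath L Φ t) =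
      -∫ x : ℝ in Ioi L, exp (exp (x + (-Φ : ℝ) * I)) • ψ (x + (-Φ : ℝ) * I) := by
    have hneg := integral_comp_neg_Iic (-Φ) fun t : ℝ =>
      exp (exp ((L + (t - Φ) : ℝ) + (-Φ : ℝ) * I)) • ψ ((L + (t - Φ) : ℝ) + (-Φ : ℝ) * I)
    rw [neg_neg, shift fun x : ℝ => exp (exp (x + (-Φ : ℝ) * I)) • ψ (x + (-Φ : ℝ) * I)] at hneg
    rw [← hneg, ← integral_neg]
    refine setIntegral_congr_fun (measurableSet_Iic (a := -Φ)) fun t ht => ?_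
    have ht : t ≤ -Φ := ht
    have hp : hankelPath L Φ t = ((L + (-t - Φ) : ℝ) : ℂ) + (-Φ : ℝ) * I := by
      rw [hankelPath, abs_of_nonpos (by linarith), max_eq_left (by linarith),
        max_eq_left ((min_le_left _ _).trans ht)]
    rw [hankelKernel, hankelVelocity, if_pos ht, hp, neg_one_mul, neg_smul]
  have p2 : ∫ t in Ioc (-Φ) Φ, hankelKernel L Φ t • ψ (hankelPath L Φ t) =
      I • ∫ y : ℝ in (-Φ)..Φ, exp (exp (L + y * I)) • ψ (L + y * I) := by
    rw [intervalIntegral.integral_of_le (by linarith), ← integral_smul]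
    refine setIntegral_congr_fun measurableSet_Ioc fun t ht => ?_
    have hp : hankelPath L Φ t = L + t * I := by
      rw [hankelPath, max_eq_right (by linarith [abs_le.mpr ⟨ht.1.le, ht.2⟩]), min_eq_left ht.2,
        max_eq_right ht.1.le, add_zero]
    rw [hankelKernel, hankelVelocity, if_neg (by linarith [ht.1]), if_pos ht.2, hp, mul_smul]
  have p3 : ∫ t in Ioi Φ, hankelKernel L Φ t • ψ (hankelPath L Φ t) =
      ∫ x : ℝ in Ioi L, exp (exp (x + Φ * I)) • ψ (x + Φ * I) := by
    rw [← shift]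
    refine setIntegral_congr_fun measurableSet_Ioi fun t ht => ?_
    have ht' : Φ < t := ht
    have hp : hankelPath L Φ t = ((L + (t - Φ) : ℝ) : ℂ) + Φ * I := by
      rw [hankelPath, abs_of_pos (by linarith), max_eq_left (by linarith), min_eq_right ht'.le,
        max_eq_right (by linarith)]
    rw [hankelKernel, hankelVelocity, if_neg (by linarith), if_neg (by linarith), hp, one_mul]
  unfold hankelPathIntegral
  rw [← intervalIntegral.integral_Iic_add_Ioi hi.integrableOn (b := -Φ) hi.integrableOn,
    ← Ioc_union_Ioi_eq_Ioi (by linarith : -Φ ≤ Φ),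
    setIntegral_union (Ioc_disjoint_Ioi le_rfl) measurableSet_Ioi hi.integrableOn hi.integrableOn,
    p1, p2, p3, stripIntegral, add_assoc]

theorem hankelPathIntegral_exp {l : ℝ} (hl : 0 ≤ l) (L : ℝ)
    (hΦ : Real.pi / 2 < Φ) (hΦ' : Φ ≤ Real.pi) :
    hankelPathIntegral L Φ (fun w => exp (-(l * w))) = 2 * Real.pi * I / Real.Gamma (1 + l) := by
  rw [hankelPathIntegral_eq_stripIntegral (C := Real.exp (-(l * L))) hΦ hΦ' (by fun_prop)]
  · exact stripIntegral_hankelFunction (by linarith) L hΦ hΦ'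
  · intro w hw
    rw [norm_exp]
    have := hw.1
    simp
    gcongr

theorem hasSum_hankelPathIntegral {ι : Type*} [Countable ι] {ψ : ι → ℂ → E} {ψ₀ : ℂ → E} {b : ι → ℝ}
    (hΦ : Real.pi / 2 < Φ) (hΦ' : Φ ≤ Real.pi) (hb : Summable b)
    (hc : ∀ i, ContinuousOn (ψ i) (halfStrip L Φ)) (hψ : ∀ i, ∀ w ∈ halfStrip L Φ, ‖ψ i w‖ ≤ b i)
    (hsum : ∀ w ∈ halfStrip L Φ, HasSum (fun i => ψ i w) (ψ₀ w)) :
    HasSum (fun i => hankelPathIntegral L Φ (ψ i)) (hankelPathIntegral L Φ ψ₀) := by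
  have h0 : 0 ≤ Φ := by linarith [Real.pi_pos]
  refine hasSum_integral_of_dominated_convergence (fun i t => ‖hankelKernel L Φ t‖ * b i)
    (fun i => (measurable_hankelKernel L Φ).aestronglyMeasurable.smul
      ((hc i).comp_hankelPath h0).aestronglyMeasurable)
    (fun i => Eventually.of_forall fun t => ?_)
    (Eventually.of_forall fun t => hb.mul_left _) ?_
    (Eventually.of_forall fun t => (hsum _ (hankelPath_mem L t h0)).const_smul _)
  · rw [norm_smul]
    gcongr
    exact hψ i _ (hankelPath_mem L t h0)
  · simp_rw [tsum_mul_left]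
    exact (integrable_hankelKernel L hΦ hΦ').norm.mul_const _

end PathIntegral

/-! ## Holomorphic maps on normed spaces and integrals of their translates -/

section Holomorphic

variable {V E : Type*} [NormedAddCommGroup V] [NormedSpace ℂ V] [NormedAddCommGroup E]
  [NormedSpace ℂ E] {φ : V → E}

/-- Cauchy's estimate by way of the Schwarz lemma; the `2` appears because the image is placed in a
ball centred at `φ c`. -/
theorem norm_fderiv_le_of_norm_le_ball {c : V} {R C : ℝ} (hR : 0 < R)
    (hd : DifferentiableOn ℂ φ (Metric.ball c R)) (hb : ∀ x ∈ Metric.ball c R, ‖φ x‖ ≤ C) :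
    ‖fderiv ℂ φ c‖ ≤ 2 * C / R := by
  refine Complex.norm_fderiv_le_div_of_mapsTo_ball hd (fun x hx => ?_) hR
  rw [Metric.mem_closedBall, dist_eq_norm]
  have h1 := hb x hx
  have h2 := hb c (Metric.mem_ball_self hR)
  linarith [norm_sub_le (φ x) (φ c)]

theorem norm_sub_le_of_norm_le_ball {c : V} {r C : ℝ} (hr : 0 < r)
    (hd : DifferentiableOn ℂ φ (Metric.ball c (r + r)))
    (hb : ∀ x ∈ Metric.ball c (r + r), ‖φ x‖ ≤ C) {x y : V} (hx : x ∈ Metric.ball c r)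
    (hy : y ∈ Metric.ball c r) : ‖φ y - φ x‖ ≤ 2 * C / r * ‖y - x‖ := by
  have hsub : ∀ z ∈ Metric.ball c r, Metric.ball z r ⊆ Metric.ball c (r + r) := by
    intro z hz w hw
    rw [Metric.mem_ball] at *
    linarith [dist_triangle w z c]
  let _ : NormedSpace ℝ V := NormedSpace.restrictScalars ℝ ℂ V
  refine (convex_ball c r).norm_image_sub_le_of_norm_fderiv_le (𝕜 := ℂ) (fun z hz => ?_)
    (fun z hz => ?_) hx hy
  · refine (hd z (hsub z hz (Metric.mem_ball_self hr))).differentiableAt ?_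
    exact Metric.isOpen_ball.mem_nhds (hsub z hz (Metric.mem_ball_self hr))
  · exact norm_fderiv_le_of_norm_le_ball hr (hd.mono (hsub z hz)) fun w hw => hb w (hsub z hz hw)

/-- The map `z ↦ φ (z + (y - x)) - φ z` is `O(‖y - x‖)` near `x` because a bounded holomorphic map
is Lipschitz. Cauchy's estimate for this map bounds the difference of the derivatives at `y` and
`x`. -/
theorem DifferentiableOn.continuousAt_fderiv {U : Set V} {x : V} (hd : DifferentiableOn ℂ φ U)
    (hU : U ∈ 𝓝 x) : ContinuousAt (fderiv ℂ φ) x := by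
  have hx : ContinuousAt φ x := (hd.differentiableAt hU).continuousAt
  have hbd : ∀ᶠ y in 𝓝 x, ‖φ y‖ ≤ ‖φ x‖ + 1 := by
    filter_upwards [hx.norm.eventually (gt_mem_nhds (lt_add_one _))] with y hy using hy.le
  obtain ⟨R, hR, hRU⟩ := Metric.mem_nhds_iff.mp (inter_mem hU hbd)
  set C := ‖φ x‖ + 1
  -- The Lipschitz bound on the ball of radius `2 * r` needs control on twice that radius, that is
  -- on the ball of radius `R`.
  set r := R / 4 with hr
  have hr0 : 0 < r := by positivity
  have hsub : Metric.ball x (2 * r + 2 * r) ⊆ Metric.ball x R :=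
    Metric.ball_subset_ball (by rw [hr]; linarith)
  have hd' : DifferentiableOn ℂ φ (Metric.ball x R) := hd.mono fun y hy => (hRU hy).1
  have hlip : ∀ y ∈ Metric.ball x r, ‖fderiv ℂ φ y - fderiv ℂ φ x‖ ≤
      2 * (2 * C / (2 * r) * ‖y - x‖) / r := by
    intro y hy
    have hyx : ‖y - x‖ < r := by rwa [← dist_eq_norm]
    have hmem : ∀ z ∈ Metric.ball x r, z + (y - x) ∈ Metric.ball x (2 * r) ∧
        z ∈ Metric.ball x (2 * r) := by
      intro z hz
      refine ⟨?_, Metric.ball_subset_ball (by linarith) hz⟩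
      rw [Metric.mem_ball, dist_eq_norm] at hz ⊢
      calc ‖z + (y - x) - x‖ = ‖(z - x) + (y - x)‖ := by congr 1; abel
        _ < 2 * r := by linarith [norm_add_le (z - x) (y - x)]
    have hdiff : ∀ z ∈ Metric.ball x (2 * r), DifferentiableAt ℂ φ z := by
      intro z hz
      have : z ∈ Metric.ball x R := Metric.ball_subset_ball (by rw [hr]; linarith) hz
      exact hd'.differentiableAt (Metric.isOpen_ball.mem_nhds this)
    have htr : ∀ z ∈ Metric.ball x r, HasFDerivAt (fun z => φ (z + (y - x)) - φ z)
        (fderiv ℂ φ (z + (y - x)) - fderiv ℂ φ z) z := by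
      intro z hz
      have h1 := (hdiff _ (hmem z hz).1).hasFDerivAt
      have h2 := (hdiff _ (hmem z hz).2).hasFDerivAt
      exact ((hasFDerivAt_comp_add_right (y - x)).mpr h1).sub h2
    have hder := (htr x (Metric.mem_ball_self hr0)).fderiv
    rw [add_sub_cancel] at hder
    rw [← hder]
    refine norm_fderiv_le_of_norm_le_ball hr0
      (fun z hz => (htr z hz).differentiableAt.differentiableWithinAt) fun z hz => ?_
    have := norm_sub_le_of_norm_le_ball (c := x) (r := 2 * r) (by positivity) (hd'.mono hsub)
      (fun w hw => (hRU (hsub hw)).2) (hmem z hz).2 (hmem z hz).1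
    simpa using this
  rw [ContinuousAt, tendsto_iff_norm_sub_tendsto_zero]
  refine squeeze_zero' (Eventually.of_forall fun _ => norm_nonneg _)
    (g := fun y => 2 * (2 * C / (2 * r) * ‖y - x‖) / r) ?_ ?_
  · filter_upwards [Metric.ball_mem_nhds x hr0] with y hy using hlip y hy
  · have : Continuous fun y : V => 2 * (2 * C / (2 * r) * ‖y - x‖) / r := by fun_prop
    simpa using this.tendsto x

/-- A common bound on balls of one radius around all translates gives, by Cauchy's estimate, a
Lipschitz constant independent of `t`. The integrability of `κ` then dominates, and the continuity
of the derivative supplies measurability. -/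
theorem differentiableAt_integral_translate [CompleteSpace E] {c : V} {δ C : ℝ} {κ : ℝ → ℂ}
    {η : ℝ → V} (hδ : 0 < δ) (hκ : Integrable κ) (hη : Continuous η)
    (hd : ∀ t, DifferentiableOn ℂ φ (Metric.ball (c + η t) (δ + δ)))
    (hb : ∀ t, ∀ x ∈ Metric.ball (c + η t) (δ + δ), ‖φ x‖ ≤ C) :
    DifferentiableAt ℂ (fun z => ∫ t, κ t • φ (z + η t)) c := by
  have hball : ∀ z ∈ Metric.ball c δ, ∀ t, z + η t ∈ Metric.ball (c + η t) δ := by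
    intro z hz t
    simpa using hz
  have hsub : ∀ t, Metric.ball (c + η t) δ ⊆ Metric.ball (c + η t) (δ + δ) := fun t =>
    Metric.ball_subset_ball (by linarith)
  have hnhds : ∀ z ∈ Metric.ball c δ, ∀ t, Metric.ball (c + η t) (δ + δ) ∈ 𝓝 (z + η t) :=
    fun z hz t => Metric.isOpen_ball.mem_nhds (hsub t (hball z hz t))
  have hcont : ∀ z ∈ Metric.ball c δ, Continuous fun t => φ (z + η t) := by
    intro z hz
    refine continuous_iff_continuousAt.mpr fun t => ?_
    refine ContinuousAt.comp (f := fun t => z + η t) (g := φ) ?_ (by fun_prop)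
    exact ((hd t).differentiableAt (hnhds z hz t)).continuousAt
  have hc : c ∈ Metric.ball c δ := Metric.mem_ball_self hδ
  have hcd : Continuous fun t => fderiv ℂ φ (c + η t) := by
    refine continuous_iff_continuousAt.mpr fun t => ?_
    refine ContinuousAt.comp (f := fun t => c + η t) (g := fderiv ℂ φ) ?_ (by fun_prop)
    exact (hd t).continuousAt_fderiv (hnhds c hc t)
  have hC : 0 ≤ C := (norm_nonneg _).trans (hb 0 _ (hsub 0 (hball c hc 0)))
  refine (hasFDerivAt_integral_of_dominated_loc_of_lip (𝕜 := ℂ) (μ := volume)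
    (F := fun z t => κ t • φ (z + η t)) (F' := fun t => κ t • fderiv ℂ φ (c + η t))
    (bound := fun t => ‖κ t‖ * (2 * C / δ)) (s := Metric.ball c δ) (Metric.ball_mem_nhds c hδ) ?_ ?_
    (hκ.aestronglyMeasurable.smul hcd.aestronglyMeasurable) ?_ (hκ.norm.mul_const _)
    ?_).2.differentiableAt
  · filter_upwards [Metric.ball_mem_nhds c hδ] with z hz
    exact hκ.aestronglyMeasurable.smul (hcont z hz).aestronglyMeasurable
  · exact hκ.smul_bdd C (hcont c hc).aestronglyMeasurable
      (Eventually.of_forall fun t => hb t _ (hsub t (hball c hc t)))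
  · refine Eventually.of_forall fun t => LipschitzOnWith.of_dist_le_mul fun x hx y hy => ?_
    rw [dist_eq_norm, dist_eq_norm, ← smul_sub, norm_smul, Real.coe_nnabs,
      abs_of_nonneg (by positivity), mul_assoc]
    gcongr
    simpa using norm_sub_le_of_norm_le_ball hδ (hd t) (hb t) (hball y hy t) (hball x hx t)
  · refine Eventually.of_forall fun t => ?_
    have h1 := ((hd t).differentiableAt (hnhds c hc t)).hasFDerivAt
    exact ((hasFDerivAt_comp_add_right (η t)).mpr h1).const_smul (κ t)

end Holomorphic

/-! ## Lower bounds for the Gamma function -/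

/-- Euler's integral is restricted to `t > L`, where `t ^ x ≥ L ^ x`. A fixed large `L` shows that
`Γ` beats every geometric growth; `L = x` gives a bound of Stirling type. -/
theorem rpow_mul_exp_neg_le_Gamma {x L : ℝ} (hx : 0 ≤ x) (hL : 0 ≤ L) :
    L ^ x * Real.exp (-L) ≤ Real.Gamma (1 + x) := by
  have hconv := Real.GammaIntegral_convergent (s := 1 + x) (by linarith)
  rw [Real.Gamma_eq_integral (by linarith)]
  have hexp : IntegrableOn (fun t => Real.exp (-t)) (Ioi L) := by
    simpa using integrableOn_exp_mul_Ioi (a := -1) (by norm_num) L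
  calc L ^ x * Real.exp (-L) = ∫ t in Ioi L, L ^ x * Real.exp (-t) := by
        rw [integral_const_mul, integral_exp_neg_Ioi]
    _ ≤ ∫ t in Ioi L, Real.exp (-t) * t ^ (1 + x - 1) := by
        refine setIntegral_mono_on (hexp.const_mul _) (hconv.mono_set (Ioi_subset_Ioi hL))
          measurableSet_Ioi fun t ht => ?_
        rw [mul_comm, add_sub_cancel_left]
        have : L ≤ t := le_of_lt ht
        gcongr
    _ ≤ ∫ t in Ioi 0, Real.exp (-t) * t ^ (1 + x - 1) := by
        refine setIntegral_mono_set hconv ?_ (Ioi_subset_Ioi hL).eventuallyLE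
        refine (ae_restrict_iff' measurableSet_Ioi).mpr (Eventually.of_forall fun t ht => ?_)
        have : (0 : ℝ) ≤ t := le_of_lt ht
        simp only [Pi.zero_apply]
        positivity

theorem exists_factorial_rpow_le_Gamma {σ : ℝ} (hσ : 0 ≤ σ) :
    ∃ B : ℝ, 0 < B ∧ ∀ N : ℕ, (N.factorial : ℝ) ^ σ ≤ B ^ N * Real.Gamma (1 + N * σ) := by
  rcases hσ.eq_or_lt with rfl | hσ
  · exact ⟨1, one_pos, fun N => by simp⟩
  -- With `L = x = N σ` one has `Γ (1 + N σ) ≥ (N σ / e) ^ (N σ)`, while `N! ≤ N ^ N`; the quotient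
  -- of the two bounds is this constant to the power `N`.
  refine ⟨(Real.exp 1 / σ) ^ σ, by positivity, fun N => ?_⟩
  have h1 := rpow_mul_exp_neg_le_Gamma (x := N * σ) (L := N * σ) (by positivity) (by positivity)
  have h2 : (N.factorial : ℝ) ^ σ ≤ (N : ℝ) ^ (N * σ) := by
    rw [Real.rpow_mul (by positivity), Real.rpow_natCast]
    gcongr
    exact_mod_cast Nat.factorial_le_pow N
  refine h2.trans (le_trans (le_of_eq ?_) (mul_le_mul_of_nonneg_left h1 (by positivity)))
  rw [← Real.rpow_natCast, ← Real.rpow_mul (by positivity), mul_comm σ,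
    Real.div_rpow (by positivity) hσ.le, Real.mul_rpow (by positivity) hσ.le,
    ← Real.exp_mul, one_mul, Real.exp_neg]
  field_simp

/-! ## Power series in two variables -/

theorem Summable.exists_norm_le {ι E : Type*} [NormedAddCommGroup E] {f : ι → E} (hf : Summable f) :
    ∃ K : ℝ, 0 ≤ K ∧ ∀ i, ‖f i‖ ≤ K := by
  obtain ⟨K, hK⟩ := hf.tendsto_cofinite_zero.norm.bddAbove_range_of_cofinite
  exact ⟨max K 0, le_max_right _ _, fun i => (hK ⟨i, rfl⟩).trans (le_max_left _ _)⟩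

section Series

variable {E : Type*} [NormedAddCommGroup E] [NormedSpace ℂ E]

/-- Cauchy's estimate on a smaller ball turns the summable bounds on the terms into summable bounds
on their derivatives. -/
theorem differentiableAt_tsum_of_norm_le [CompleteSpace E] {V ι : Type*} [NormedAddCommGroup V]
    [NormedSpace ℂ V] {f : ι → V → E} {u : ι → ℝ} {U : Set V} {x : V} (hu : Summable u)
    (hU : U ∈ 𝓝 x) (hd : ∀ i, DifferentiableOn ℂ (f i) U) (hb : ∀ i, ∀ y ∈ U, ‖f i y‖ ≤ u i) :
    DifferentiableAt ℂ (fun y => ∑' i, f i y) x := by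
  obtain ⟨R, hR, hRU⟩ := Metric.mem_nhds_iff.mp hU
  set r := R / 2 with hrdef
  have hr : 0 < r := by positivity
  have hsub : ∀ z ∈ Metric.ball x r, Metric.ball z r ⊆ U := by
    intro z hz w hw
    refine hRU ?_
    rw [Metric.mem_ball] at *
    linarith [dist_triangle w z x]
  let _ : NormedSpace ℝ V := NormedSpace.restrictScalars ℝ ℂ V
  refine (hasFDerivAt_tsum_of_isPreconnected (𝕜 := ℂ) (u := fun i => 2 * u i / r)
    (f' := fun i y => fderiv ℂ (f i) y) (s := Metric.ball x r) (x₀ := x)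
    ((hu.mul_left 2).div_const r) Metric.isOpen_ball (convex_ball x r).isPreconnected
    (fun i y hy => ?_) (fun i y hy => ?_) (Metric.mem_ball_self hr)
    (hu.of_norm_bounded fun i => hb i x (mem_of_mem_nhds hU))
    (Metric.mem_ball_self hr)).differentiableAt
  · have : U ∈ 𝓝 y := mem_of_superset (Metric.ball_mem_nhds y hr) (hsub y hy)
    exact ((hd i).differentiableAt this).hasFDerivAt
  · exact norm_fderiv_le_of_norm_le_ball hr ((hd i).mono (hsub y hy))
      fun w hw => hb i w (hsub y hy hw)

theorem summable_half_pow_prod :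
    Summable fun mj : ℕ × ℕ => (1 / 2 : ℝ) ^ mj.1 * (1 / 2 : ℝ) ^ mj.2 :=
  Summable.mul_of_nonneg summable_geometric_two summable_geometric_two
    (fun _ => by positivity) (fun _ => by positivity)

variable {p q : ℕ} {k s : ℝ} {c : ℕ → ℕ → E}

/-- The number `λ` for which `x₁ ^ n * x₂ ^ m` is divided by `Γ (1 + λ)`. -/
def borelWeight (p q : ℕ) (k s : ℝ) (n m : ℕ) : ℝ := n * (s / (p * k)) + m * ((1 - s) / (q * k))

theorem formalMonomialBorel_eq (hp : 0 < p) (hq : 0 < q) (hk : 0 < k) (n m : ℕ) :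
    formalMonomialBorel p q k s c n m =
      ((Real.Gamma (1 + borelWeight p q k s n m) : ℂ))⁻¹ • c n m := by
  have hp' : (0 : ℝ) < p := by exact_mod_cast hp
  have hq' : (0 : ℝ) < q := by exact_mod_cast hq
  unfold formalMonomialBorel borelWeight
  congr 4
  field_simp
  ring

theorem borelWeight_nonneg (hk : 0 < k) (hs : 0 < s) (hs' : s < 1) (n m : ℕ) :
    0 ≤ borelWeight p q k s n m := by
  have : 0 < 1 - s := by linarith
  unfold borelWeight
  positivity

theorem norm_inv_Gamma_le {x L : ℝ} (hx : 0 ≤ x) (hL : 0 < L) :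
    ‖((Real.Gamma (1 + x) : ℂ))⁻¹‖ ≤ Real.exp L * (L ^ x)⁻¹ := by
  have h := rpow_mul_exp_neg_le_Gamma hx hL.le
  have hpos : 0 < L ^ x * Real.exp (-L) := by positivity
  rw [norm_inv, norm_real, Real.norm_of_nonneg (hpos.le.trans h)]
  refine (inv_anti₀ hpos h).trans (le_of_eq ?_)
  rw [mul_inv, Real.exp_neg, inv_inv, mul_comm]

theorem norm_formalMonomialBorel_le (hp : 0 < p) (hq : 0 < q) (hk : 0 < k) (hs : 0 < s)
    (hs' : s < 1) (n m : ℕ) :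
    ‖formalMonomialBorel p q k s c n m‖ ≤ Real.exp 1 * ‖c n m‖ := by
  rw [formalMonomialBorel_eq hp hq hk, norm_smul]
  gcongr
  simpa using norm_inv_Gamma_le (borelWeight_nonneg (p := p) (q := q) hk hs hs' n m) one_pos

theorem exists_bounded_hasSum_of_norm_le [CompleteSpace E] {a b : ℕ → E} {r K : ℝ} (hr : 0 < r)
    (hb : ∀ i, ‖r ^ i • b i‖ ≤ K) (hab : ∀ i, ‖a i‖ ≤ Real.exp 1 * ‖b i‖) :
    ∃ h : ℂ → E, DifferentiableOn ℂ h (Metric.ball 0 (r / 2)) ∧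
      (∃ K : ℝ, ∀ z ∈ Metric.ball (0 : ℂ) (r / 2), ‖h z‖ ≤ K) ∧
      ∀ z ∈ Metric.ball (0 : ℂ) (r / 2), HasSum (fun i => z ^ i • a i) (h z) := by
  have hterm : ∀ i, ∀ z ∈ Metric.ball (0 : ℂ) (r / 2), ‖z ^ i • a i‖ ≤
      Real.exp 1 * K * (1 / 2) ^ i := by
    intro i z hz
    have hz' : ‖z‖ ≤ r / 2 := by simpa using (Metric.mem_ball.mp hz).le
    have h1 := hb i
    rw [norm_smul, norm_pow, Real.norm_of_nonneg hr.le] at h1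
    calc ‖z ^ i • a i‖ ≤ (r / 2) ^ i * (Real.exp 1 * ‖b i‖) := by
          rw [norm_smul, norm_pow]
          gcongr
          exact hab i
      _ = Real.exp 1 * (r ^ i * ‖b i‖) * (1 / 2) ^ i := by rw [div_pow, div_pow, one_pow]; ring
      _ ≤ _ := by gcongr
  have hsum : Summable fun i : ℕ => Real.exp 1 * K * (1 / 2 : ℝ) ^ i :=
    summable_geometric_two.mul_left _
  refine ⟨fun z => ∑' i, z ^ i • a i, ?_, ⟨∑' i : ℕ, Real.exp 1 * K * (1 / 2 : ℝ) ^ i, ?_⟩, ?_⟩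
  · exact differentiableOn_tsum_of_summable_norm hsum (fun i => by fun_prop) Metric.isOpen_ball
      hterm
  · exact fun z hz => tsum_of_norm_bounded hsum.hasSum fun i => hterm i z hz
  · exact fun z hz => (hsum.of_norm_bounded fun i => hterm i z hz).hasSum

theorem MemC.formalMonomialBorel [CompleteSpace E] (hp : 0 < p) (hq : 0 < q) (hk : 0 < k)
    (hs : 0 < s) (hs' : s < 1) (hc : MemC c) : MemC (formalMonomialBorel p q k s c) := by
  obtain ⟨r, hr, h1, h2⟩ := hc
  have hmem : ((r / 2 : ℝ) : ℂ) ∈ Metric.ball (0 : ℂ) r := by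
    simp [abs_of_pos hr]; linarith
  refine ⟨r / 2 / 2, by positivity, fun n => ?_, fun m => ?_⟩
  · obtain ⟨h, -, -, hs3⟩ := h1 n
    obtain ⟨K, -, hK⟩ := (hs3 _ hmem).summable.exists_norm_le
    refine exists_bounded_hasSum_of_norm_le (b := fun m => c n m) (K := K) (by positivity)
      (fun m => ?_) fun m => norm_formalMonomialBorel_le hp hq hk hs hs' n m
    simpa [norm_smul] using hK m
  · obtain ⟨h, -, -, hs3⟩ := h2 m
    obtain ⟨K, -, hK⟩ := (hs3 _ hmem).summable.exists_norm_le
    refine exists_bounded_hasSum_of_norm_le (b := fun n => c n m) (K := K) (by positivity)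
      (fun n => ?_) fun n => norm_formalMonomialBorel_le hp hq hk hs hs' n m
    simpa [norm_smul] using hK n

theorem monomialCoeff_formalMonomialBorel (hp : 0 < p) (hq : 0 < q) (hk : 0 < k) (n m j : ℕ) :
    monomialCoeff p q (formalMonomialBorel p q k s c) n m j =
      ((Real.Gamma (1 + borelWeight p q k s (n * p + m) (n * q + j)) : ℂ))⁻¹ •
        monomialCoeff p q c n m j := by
  unfold monomialCoeff
  split_ifs
  · rw [formalMonomialBorel_eq hp hq hk]
  · simp

theorem MonomialPartsOn.exists_norm_monomialCoeff_le {r' r₁ r₂ : ℝ} (hc : MonomialPartsOn p q c r')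
    (hr₁ : 0 < r₁) (hr₂ : 0 < r₂) (h₁ : r₁ ^ p < r') (h₂ : r₂ ^ q < r') (n : ℕ) :
    ∃ K : ℝ, 0 ≤ K ∧ ∀ m j, r₁ ^ m * r₂ ^ j * ‖monomialCoeff p q c n m j‖ ≤ K := by
  have hmem : ((r₁ : ℂ), (r₂ : ℂ)) ∈ monomialPolydisc p q r' := by
    simpa [monomialPolydisc, abs_of_pos hr₁, abs_of_pos hr₂] using ⟨h₁, h₂⟩
  obtain ⟨K, hK0, hK⟩ := ((hc n).1 _ hmem).exists_norm_le
  refine ⟨K, hK0, fun m j => ?_⟩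
  simpa [monomialTerm, norm_smul, abs_of_pos hr₁, abs_of_pos hr₂] using hK (m, j)

/-- This makes the `g_n` entire: for any radius `T`, choosing `L` with `T / r₁ ≤ L ^ α` and `T / r₂
≤ L ^ β` lets the division by `Γ` pay for enlarging the radii `r₁`, `r₂` to `T`. The part of the
weight coming from `n` only helps, since `L ≥ 1`. -/
theorem exists_pow_mul_norm_monomialCoeff_formalMonomialBorel_le (hp : 0 < p) (hq : 0 < q)
    (hk : 0 < k) (hs : 0 < s) (hs' : s < 1) {r₁ r₂ K : ℝ} {n : ℕ} (hr₁ : 0 < r₁) (hr₂ : 0 < r₂)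
    (hK : ∀ m j, r₁ ^ m * r₂ ^ j * ‖monomialCoeff p q c n m j‖ ≤ K) {T : ℝ} (hT : 0 < T) :
    ∃ K' : ℝ, ∀ m j, T ^ m * T ^ j *
      ‖monomialCoeff p q (formalMonomialBorel p q k s c) n m j‖ ≤ K' := by
  have hp' : (0 : ℝ) < p := by exact_mod_cast hp
  have hq' : (0 : ℝ) < q := by exact_mod_cast hq
  have h1s : 0 < 1 - s := by linarith
  set α := s / (p * k) with hα
  set β := (1 - s) / (q * k) with hβ
  have hα0 : 0 < α := by positivity
  have hβ0 : 0 < β := by positivity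
  obtain ⟨L, hL1, hLα, hLβ⟩ : ∃ L : ℝ, 1 ≤ L ∧ T / r₁ ≤ L ^ α ∧ T / r₂ ≤ L ^ β := by
    have e1 := (tendsto_rpow_atTop hα0).eventually_ge_atTop (T / r₁)
    have e2 := (tendsto_rpow_atTop hβ0).eventually_ge_atTop (T / r₂)
    exact ((eventually_ge_atTop 1).and (e1.and e2)).exists
  have hL0 : 0 < L := by linarith
  refine ⟨Real.exp L * K, fun m j => ?_⟩
  rw [monomialCoeff_formalMonomialBorel hp hq hk, norm_smul]
  have hw : (L ^ α) ^ m * (L ^ β) ^ j ≤ L ^ borelWeight p q k s (n * p + m) (n * q + j) := by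
    rw [← Real.rpow_natCast, ← Real.rpow_natCast, ← Real.rpow_mul hL0.le, ← Real.rpow_mul hL0.le,
      ← Real.rpow_add hL0]
    refine Real.rpow_le_rpow_of_exponent_le hL1 ?_
    unfold borelWeight
    rw [← hα, ← hβ]
    push_cast
    have : 0 ≤ (n : ℝ) * p * α + n * q * β := by positivity
    linarith
  have hTL : T ^ m * T ^ j ≤ (r₁ ^ m * r₂ ^ j) * ((L ^ α) ^ m * (L ^ β) ^ j) := by
    rw [mul_mul_mul_comm, ← mul_pow, ← mul_pow]
    rw [div_le_iff₀' hr₁] at hLα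
    rw [div_le_iff₀' hr₂] at hLβ
    gcongr
  have hG := norm_inv_Gamma_le (borelWeight_nonneg (p := p) (q := q) hk hs hs' (n * p + m)
    (n * q + j)) hL0
  calc _ ≤ ((r₁ ^ m * r₂ ^ j) * L ^ borelWeight p q k s (n * p + m) (n * q + j)) *
        (Real.exp L * (L ^ borelWeight p q k s (n * p + m) (n * q + j))⁻¹ *
          ‖monomialCoeff p q c n m j‖) := by
        refine mul_le_mul (hTL.trans (by gcongr)) (by gcongr) (by positivity) (by positivity)
    _ = Real.exp L * (r₁ ^ m * r₂ ^ j * ‖monomialCoeff p q c n m j‖) := by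
        have : L ^ borelWeight p q k s (n * p + m) (n * q + j) ≠ 0 := by positivity
        field_simp
    _ ≤ _ := by gcongr; exact hK m j

theorem norm_monomialTerm_le {T K : ℝ} {n : ℕ} (hT : 0 < T)
    (hK : ∀ m j, T ^ m * T ^ j * ‖monomialCoeff p q c n m j‖ ≤ K) {x₁ x₂ : ℂ} (h₁ : ‖x₁‖ ≤ T / 2)
    (h₂ : ‖x₂‖ ≤ T / 2) (mj : ℕ × ℕ) :
    ‖monomialTerm p q c n x₁ x₂ mj‖ ≤ K * ((1 / 2) ^ mj.1 * (1 / 2) ^ mj.2) := by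
  rw [monomialTerm, norm_smul, norm_mul, norm_pow, norm_pow]
  calc _ ≤ (T / 2) ^ mj.1 * (T / 2) ^ mj.2 * ‖monomialCoeff p q c n mj.1 mj.2‖ := by gcongr
    _ = (T ^ mj.1 * T ^ mj.2 * ‖monomialCoeff p q c n mj.1 mj.2‖) *
        ((1 / 2) ^ mj.1 * (1 / 2) ^ mj.2) := by simp only [div_pow, one_pow]; ring
    _ ≤ _ := by gcongr; exact hK _ _

theorem summable_and_differentiable_monomialPart [CompleteSpace E] {n : ℕ}
    (hK : ∀ T : ℝ, 0 < T → ∃ K : ℝ, ∀ m j, T ^ m * T ^ j * ‖monomialCoeff p q c n m j‖ ≤ K) :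
    (∀ x₁ x₂ : ℂ, Summable (monomialTerm p q c n x₁ x₂)) ∧
      Differentiable ℂ (fun x : ℂ × ℂ => monomialPart p q c n x.1 x.2) := by
  have key : ∀ x : ℂ × ℂ, ∃ u : ℕ × ℕ → ℝ, Summable u ∧ ∀ y ∈ Metric.ball (0 : ℂ × ℂ) (‖x‖ + 1),
      ∀ mj, ‖monomialTerm p q c n y.1 y.2 mj‖ ≤ u mj := by
    intro x
    have hT : 0 < 2 * (‖x‖ + 1) := by positivity
    obtain ⟨K, hK⟩ := hK _ hT
    refine ⟨_, summable_half_pow_prod.mul_left K, fun y hy mj => ?_⟩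
    rw [mem_ball_zero_iff] at hy
    have h1 := norm_fst_le y
    have h2 := norm_snd_le y
    exact norm_monomialTerm_le hT hK (by linarith) (by linarith) mj
  have hmem : ∀ x : ℂ × ℂ, x ∈ Metric.ball (0 : ℂ × ℂ) (‖x‖ + 1) := fun x => by simp
  refine ⟨fun x₁ x₂ => ?_, fun x => ?_⟩
  · obtain ⟨u, hu, hb⟩ := key (x₁, x₂)
    exact hu.of_norm_bounded (hb _ (hmem _))
  · obtain ⟨u, hu, hb⟩ := key x
    refine differentiableAt_tsum_of_norm_le hu (Metric.isOpen_ball.mem_nhds (hmem x))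
      (fun mj => ?_) (fun mj y hy => hb y hy mj)
    unfold monomialTerm
    fun_prop

theorem exists_norm_monomialPart_le {n : ℕ} (hp : 0 < p) (hq : 0 < q) {r : ℝ}
    (hK : ∀ T : ℝ, 0 < T → ∃ K : ℝ, ∀ m j, T ^ m * T ^ j * ‖monomialCoeff p q c n m j‖ ≤ K) :
    ∃ K : ℝ, ∀ x ∈ monomialPolydisc p q r, ‖monomialPart p q c n x.1 x.2‖ ≤ K := by
  -- `|z| ^ l < r` forces `|z| ≤ max r 1`; the factor `2` makes the series geometric of ratio `1/2`
  -- there.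
  obtain ⟨K, hK⟩ := hK (2 * (max r 1)) (by positivity)
  refine ⟨∑' mj : ℕ × ℕ, K * ((1 / 2 : ℝ) ^ mj.1 * (1 / 2) ^ mj.2), fun x hx => ?_⟩
  have hle : ∀ (z : ℂ) (l : ℕ), 0 < l → ‖z‖ ^ l < r → ‖z‖ ≤ max r 1 := by
    intro z l hl hz
    by_contra! h
    have h1 : 1 ≤ ‖z‖ := (le_max_right _ _).trans h.le
    have h2 := le_self_pow₀ h1 hl.ne'
    linarith [le_max_left r 1]
  refine tsum_of_norm_bounded (summable_half_pow_prod.mul_left K).hasSum fun mj => ?_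
  exact norm_monomialTerm_le (by positivity) hK (by simpa using hle _ _ hp hx.1)
    (by simpa using hle _ _ hq hx.2) mj

end Series

/-! ## Logarithmic coordinates on monomial sectors -/

section Tube

variable {E : Type*} [NormedAddCommGroup E] [NormedSpace ℂ E] {p q : ℕ} {k s τ : ℝ}

/-- The map `f` in the coordinates `x₁ = exp z₁`, `x₂ = exp z₂`; the argument of the monomial is
`Im (p z₁ + q z₂) + τ`, where `τ` is a multiple of `2 π`. -/
def tubeMap (p q : ℕ) (τ : ℝ) (f : ℂ → ℂ → ℝ → E) (z : ℂ × ℂ) : E :=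
  f (exp z.1) (exp z.2) ((p * z.1 + q * z.2).im + τ)

theorem exp_pow_mul_exp_pow (p q : ℕ) (z : ℂ × ℂ) :
    exp z.1 ^ p * exp z.2 ^ q = exp (p * z.1 + q * z.2) := by
  rw [← exp_nat_mul, ← exp_nat_mul, exp_add]

theorem exp_eq_norm_mul_exp_im (v : ℂ) : exp v = (‖exp v‖ : ℂ) * exp (v.im * I) := by
  conv_lhs => rw [← re_add_im v, exp_add]
  rw [norm_exp, ofReal_exp]

theorem mem_monomialSector_exp (hτ : exp (τ * I) = 1) {z : ℂ × ℂ} {a b : ℝ} {r : EReal} :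
    (exp z.1, exp z.2, (p * z.1 + q * z.2).im + τ) ∈ monomialSector p q a b r ↔
      ((‖exp z.1‖ ^ p : ℝ) : EReal) < r ∧ ((‖exp z.2‖ ^ q : ℝ) : EReal) < r ∧
        a < (p * z.1 + q * z.2).im + τ ∧ (p * z.1 + q * z.2).im + τ < b := by
  have h : exp z.1 ^ p * exp z.2 ^ q = (‖exp z.1 ^ p * exp z.2 ^ q‖ : ℂ) *
      exp ((((p * z.1 + q * z.2).im + τ : ℝ) : ℂ) * I) := by
    rw [exp_pow_mul_exp_pow, ofReal_add, add_mul, exp_add _ (τ * I), hτ, mul_one]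
    exact exp_eq_norm_mul_exp_im _
  simp only [monomialSector, mem_ofPred_eq]
  constructor
  · rintro ⟨-, -, h1, h2, -, h3, h4⟩
    exact ⟨h1, h2, h3, h4⟩
  · rintro ⟨h1, h2, h3, h4⟩
    exact ⟨exp_ne_zero _, exp_ne_zero _, h1, h2, h, h3, h4⟩

/-- With principal logarithms, `τ` is the difference between the carried argument `θ` and the one
they give; `exp (τ * I) = 1` holds because both are arguments of the same monomial. Sectors of any
opening are thereby treated alike. -/
theorem exists_exp_eq_of_mem_monomialSector {a b θ : ℝ} {r : EReal} {x₁ x₂ : ℂ}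
    (h : (x₁, x₂, θ) ∈ monomialSector p q a b r) :
    ∃ (z : ℂ × ℂ) (τ : ℝ), exp (τ * I) = 1 ∧ exp z.1 = x₁ ∧ exp z.2 = x₂ ∧
      (p * z.1 + q * z.2).im + τ = θ := by
  obtain ⟨h1, h2, -, -, h, -, -⟩ := h
  simp only at h1 h2 h
  refine ⟨(log x₁, log x₂), θ - (p * log x₁ + q * log x₂).im, ?_, exp_log h1, exp_log h2, by simp⟩
  have e := exp_pow_mul_exp_pow p q (log x₁, log x₂)
  simp only [exp_log h1, exp_log h2] at e
  have e2 := exp_eq_norm_mul_exp_im (p * log x₁ + q * log x₂)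
  rw [← e] at e2
  have hne : (‖x₁ ^ p * x₂ ^ q‖ : ℂ) ≠ 0 := by
    have : x₁ ^ p * x₂ ^ q ≠ 0 := mul_ne_zero (pow_ne_zero _ h1) (pow_ne_zero _ h2)
    exact_mod_cast norm_ne_zero_iff.mpr this
  have e3 := mul_left_cancel₀ hne (h.symm.trans e2)
  rw [ofReal_sub, sub_mul, exp_sub, e3, div_self (exp_ne_zero _)]

theorem arg_exp_of_abs_lt {v : ℂ} (h : |v.im| < Real.pi) : arg (exp v) = v.im := by
  rw [← log_im, log_exp (abs_lt.mp h).1 (abs_lt.mp h).2.le]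

theorem eventually_continuedArg_exp (z : ℂ × ℂ) (θ : ℝ) :
    ∀ᶠ y : ℂ × ℂ in 𝓝 z, continuedArg p q (exp z.1) (exp z.2) θ (exp y.1) (exp y.2) =
      θ + ((p * y.1 + q * y.2).im - (p * z.1 + q * z.2).im) := by
  have hc : Continuous fun y : ℂ × ℂ => |((p * y.1 + q * y.2) - (p * z.1 + q * z.2)).im| := by
    fun_prop
  have := (hc.tendsto z).eventually (gt_mem_nhds (by simpa using Real.pi_pos))
  filter_upwards [this] with y hy
  rw [continuedArg, exp_pow_mul_exp_pow, exp_pow_mul_exp_pow, ← exp_sub, arg_exp_of_abs_lt hy,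
    sub_im]

theorem MonomialHolomorphicOn.differentiableAt_tubeMap {f : ℂ → ℂ → ℝ → E} {S : Set (ℂ × ℂ × ℝ)}
    (hf : MonomialHolomorphicOn p q f S) {z : ℂ × ℂ}
    (hz : (exp z.1, exp z.2, (p * z.1 + q * z.2).im + τ) ∈ S) :
    DifferentiableAt ℂ (tubeMap p q τ f) z := by
  have h1 := hf _ _ _ hz
  have h2 : DifferentiableAt ℂ (fun y : ℂ × ℂ => (exp y.1, exp y.2)) z := by fun_prop
  refine (DifferentiableAt.comp z (f := fun y : ℂ × ℂ => (exp y.1, exp y.2)) h1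
    h2).congr_of_eventuallyEq ?_
  filter_upwards [eventually_continuedArg_exp (p := p) (q := q) z ((p * z.1 + q * z.2).im + τ)]
    with y hy
  simp only [Function.comp, tubeMap, hy]
  congr 1
  ring

theorem differentiableAt_continuedArg_of_tubeMap {f : ℂ → ℂ → ℝ → E} {z : ℂ × ℂ}
    (hf : DifferentiableAt ℂ (tubeMap p q τ f) z) :
    DifferentiableAt ℂ (fun y : ℂ × ℂ => f y.1 y.2
      (continuedArg p q (exp z.1) (exp z.2) ((p * z.1 + q * z.2).im + τ) y.1 y.2))
      (exp z.1, exp z.2) := by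
  -- A local inverse of `(exp, exp)` through `z`; dividing by `exp z.1` and `exp z.2` brings the
  -- logarithm near `1`, away from its cut.
  set Λ : ℂ × ℂ → ℂ × ℂ := fun y => (z.1 + log (y.1 / exp z.1), z.2 + log (y.2 / exp z.2)) with hΛ
  have hΛz : Λ (exp z.1, exp z.2) = z := by simp [hΛ]
  have hslit : ∀ w : ℂ, exp w / exp w ∈ slitPlane := fun w => by
    rw [div_self (exp_ne_zero _)]; exact one_mem_slitPlane
  have hΛd : DifferentiableAt ℂ Λ (exp z.1, exp z.2) := by
    refine DifferentiableAt.prodMk ?_ ?_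
    · exact (DifferentiableAt.clog (f := fun y : ℂ × ℂ => y.1 / exp z.1)
        (by simp only [div_eq_mul_inv]; fun_prop) (hslit _)).const_add _
    · exact (DifferentiableAt.clog (f := fun y : ℂ × ℂ => y.2 / exp z.2)
        (by simp only [div_eq_mul_inv]; fun_prop) (hslit _)).const_add _
  have hcomp := DifferentiableAt.comp (exp z.1, exp z.2) (f := Λ) (g := tubeMap p q τ f)
    (by rwa [hΛz]) hΛd
  refine hcomp.congr_of_eventuallyEq ?_
  have hcont : Tendsto Λ (𝓝 (exp z.1, exp z.2)) (𝓝 z) := by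
    simpa [hΛz] using hΛd.continuousAt.tendsto
  have hn1 : ∀ᶠ y : ℂ × ℂ in 𝓝 (exp z.1, exp z.2), y.1 ≠ 0 :=
    continuous_fst.continuousAt.eventually_ne (exp_ne_zero _)
  have hn2 : ∀ᶠ y : ℂ × ℂ in 𝓝 (exp z.1, exp z.2), y.2 ≠ 0 :=
    continuous_snd.continuousAt.eventually_ne (exp_ne_zero _)
  filter_upwards [hcont.eventually (eventually_continuedArg_exp (p := p) (q := q) z
    ((p * z.1 + q * z.2).im + τ)), hn1, hn2] with y hy hy1 hy2
  have e1 : exp (Λ y).1 = y.1 := by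
    simp only [hΛ, exp_add, exp_log (div_ne_zero hy1 (exp_ne_zero _))]
    field_simp
  have e2 : exp (Λ y).2 = y.2 := by
    simp only [hΛ, exp_add, exp_log (div_ne_zero hy2 (exp_ne_zero _))]
    field_simp
  rw [e1, e2] at hy
  rw [hy, Function.comp, tubeMap, e1, e2]
  congr 1
  ring

/-! ## The Borel integrand in logarithmic coordinates -/

/-- The point at which the Borel integrand at `ζ` is evaluated for `u = exp w`. -/
def tubeShift (p q : ℕ) (k s : ℝ) (ζ : ℂ × ℂ) (w : ℂ) : ℂ × ℂ :=
  (ζ.1 - w * (s / (p * k) : ℝ), ζ.2 - w * ((1 - s) / (q * k) : ℝ))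

theorem differentiable_tubeShift (ζ : ℂ × ℂ) : Differentiable ℂ (tubeShift p q k s ζ) := by
  unfold tubeShift; fun_prop

theorem tubeShift_fst_re (ζ : ℂ × ℂ) (w : ℂ) :
    (tubeShift p q k s ζ w).1.re = ζ.1.re - w.re * (s / (p * k)) := by
  simp only [tubeShift, sub_re, re_mul_ofReal]

theorem tubeShift_snd_re (ζ : ℂ × ℂ) (w : ℂ) :
    (tubeShift p q k s ζ w).2.re = ζ.2.re - w.re * ((1 - s) / (q * k)) := by
  simp only [tubeShift, sub_re, re_mul_ofReal]

theorem tubeShift_fst_im (ζ : ℂ × ℂ) (w : ℂ) :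
    (tubeShift p q k s ζ w).1.im = ζ.1.im - w.im * (s / (p * k)) := by
  simp only [tubeShift, sub_im, im_mul_ofReal]

theorem tubeShift_snd_im (ζ : ℂ × ℂ) (w : ℂ) :
    (tubeShift p q k s ζ w).2.im = ζ.2.im - w.im * ((1 - s) / (q * k)) := by
  simp only [tubeShift, sub_im, im_mul_ofReal]

/-- The weights `s` and `1 - s` add up to `1`, so the monomial itself is multiplied by `u ^ (-1/k)`.
-/
theorem tubeShift_im (hp : 0 < p) (hq : 0 < q) (hk : 0 < k) (ζ : ℂ × ℂ) (w : ℂ) :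
    (p * (tubeShift p q k s ζ w).1 + q * (tubeShift p q k s ζ w).2).im =
      (p * ζ.1 + q * ζ.2).im - w.im / k := by
  have hp' : (0 : ℝ) < p := by exact_mod_cast hp
  have hq' : (0 : ℝ) < q := by exact_mod_cast hq
  simp [tubeShift_fst_im, tubeShift_snd_im]
  field_simp
  ring

theorem tubeShift_re (hp : 0 < p) (hq : 0 < q) (hk : 0 < k) (ζ : ℂ × ℂ) (w : ℂ) :
    (p * (tubeShift p q k s ζ w).1 + q * (tubeShift p q k s ζ w).2).re =
      (p * ζ.1 + q * ζ.2).re - w.re / k := by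
  have hp' : (0 : ℝ) < p := by exact_mod_cast hp
  have hq' : (0 : ℝ) < q := by exact_mod_cast hq
  simp [tubeShift_fst_re, tubeShift_snd_re]
  field_simp
  ring

theorem norm_exp_tubeShift_fst_pow (hp : 0 < p) (hk : 0 < k) (ζ : ℂ × ℂ) (w : ℂ) :
    ‖exp (tubeShift p q k s ζ w).1‖ ^ p = ‖exp ζ.1‖ ^ p * Real.exp (-(w.re * (s / k))) := by
  have hp' : (0 : ℝ) < p := by exact_mod_cast hp
  rw [norm_exp, norm_exp, ← Real.exp_nat_mul, ← Real.exp_nat_mul, ← Real.exp_add,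
    tubeShift_fst_re]
  congr 1
  field_simp
  ring

theorem norm_exp_tubeShift_snd_pow (hq : 0 < q) (hk : 0 < k) (ζ : ℂ × ℂ) (w : ℂ) :
    ‖exp (tubeShift p q k s ζ w).2‖ ^ q = ‖exp ζ.2‖ ^ q * Real.exp (-(w.re * ((1 - s) / k))) := by
  have hq' : (0 : ℝ) < q := by exact_mod_cast hq
  rw [norm_exp, norm_exp, ← Real.exp_nat_mul, ← Real.exp_nat_mul, ← Real.exp_add,
    tubeShift_snd_re]
  congr 1
  field_simp
  ring

theorem monomialPower_exp (p q : ℕ) (k : ℝ) (z : ℂ × ℂ) (θ : ℝ) :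
    monomialPower p q k (exp z.1) (exp z.2) θ =
      exp ((k * (p * z.1 + q * z.2).re : ℝ) + (k * θ : ℝ) * I) := by
  rw [monomialPower, norm_exp, norm_exp, ← Real.exp_mul, ← Real.exp_mul, ← Real.exp_add, ofReal_exp,
    ← exp_add]
  congr 3
  simp
  ring

/-- The Jacobian `exp w` cancels the `u⁻¹` produced by the monomial power, whose remaining value no
longer depends on `w`. The condition `|w.im| < π` makes `w` the principal logarithm of `u`. -/
theorem exp_smul_borelIntegrand (hp : 0 < p) (hq : 0 < q) (hk : 0 < k) (f : ℂ → ℂ → ℝ → E)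
    (ζ : ℂ × ℂ) {w : ℂ} (hw : |w.im| < Real.pi) :
    exp w • borelIntegrand p q k s (fun x₁ x₂ θ => monomialPower p q k x₁ x₂ θ • f x₁ x₂ θ)
      (exp ζ.1) (exp ζ.2) ((p * ζ.1 + q * ζ.2).im + τ) (exp w) =
    monomialPower p q k (exp ζ.1) (exp ζ.2) ((p * ζ.1 + q * ζ.2).im + τ) •
      (exp (exp w) • tubeMap p q τ f (tubeShift p q k s ζ w)) := by
  have hp' : (0 : ℝ) < p := by exact_mod_cast hp
  have hq' : (0 : ℝ) < q := by exact_mod_cast hq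
  have hpow : ∀ (v : ℂ) (l : ℝ), exp v * exp w ^ ((-l : ℝ) : ℂ) = exp (v - w * l) := by
    intro v l
    rw [cpow_def_of_ne_zero (exp_ne_zero _), log_exp (abs_lt.mp hw).1 (abs_lt.mp hw).2.le,
      ← exp_add]
    push_cast
    ring_nf
  have hmp : exp w * monomialPower p q k (exp (tubeShift p q k s ζ w).1)
      (exp (tubeShift p q k s ζ w).2) ((p * ζ.1 + q * ζ.2).im + τ - w.im / k) =
      monomialPower p q k (exp ζ.1) (exp ζ.2) ((p * ζ.1 + q * ζ.2).im + τ) := by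
    rw [monomialPower_exp, monomialPower_exp, ← exp_add, tubeShift_re hp hq hk]
    congr 1
    apply Complex.ext
    · simp only [add_re, ofReal_re, re_ofReal_mul, I_re, mul_zero]
      field_simp
      ring
    · simp only [add_im, ofReal_im, im_ofReal_mul, I_im, mul_one]
      field_simp
      ring
  have hθ : (p * (tubeShift p q k s ζ w).1 + q * (tubeShift p q k s ζ w).2).im + τ =
      (p * ζ.1 + q * ζ.2).im + τ - w.im / k := by
    rw [tubeShift_im hp hq hk]; ring
  rw [borelIntegrand, arg_exp_of_abs_lt hw, hpow, hpow, tubeMap, hθ, ← hmp]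
  simp only [tubeShift, smul_smul]
  congr 1
  ring

end Tube

/-! ## Hankel integrals in logarithmic coordinates -/

section HankelLog

variable {E : Type*} [NormedAddCommGroup E] [NormedSpace ℂ E]

theorem stripIntegral_congr {L Φ : ℝ} {H H' : ℂ → E} (hΦ : 0 ≤ Φ)
    (h : ∀ w ∈ halfStrip L Φ, H w = H' w) : stripIntegral L Φ H = stripIntegral L Φ H' := by
  have ray : ∀ y : ℝ, |y| = Φ → ∫ x : ℝ in Ioi L, H (x + y * I) = ∫ x : ℝ in Ioi L, H' (x + y * I) :=
    fun y hy => setIntegral_congr_fun measurableSet_Ioi fun x hx =>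
      h _ ⟨by simpa using le_of_lt hx, by simp [hy]⟩
  have seg : ∫ y : ℝ in (-Φ)..Φ, H (L + y * I) = ∫ y : ℝ in (-Φ)..Φ, H' (L + y * I) := by
    refine intervalIntegral.integral_congr fun y hy => h _ ⟨by simp, ?_⟩
    rw [uIcc_of_le (by linarith)] at hy
    simpa using abs_le.mpr hy
  rw [stripIntegral, stripIntegral, seg, ray Φ (abs_of_nonneg hΦ),
    ray (-Φ) (by rw [abs_neg, abs_of_nonneg hΦ])]

theorem stripIntegral_const_smul (L Φ : ℝ) (c : ℂ) (H : ℂ → E) :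
    stripIntegral L Φ (fun w => c • H w) = c • stripIntegral L Φ H := by
  simp only [stripIntegral, integral_smul, intervalIntegral.integral_smul, smul_add, smul_neg]
  rw [smul_comm c I]

theorem ofReal_exp_mul_exp (x y : ℝ) : ((Real.exp x : ℝ) : ℂ) * exp (y * I) = exp (x + y * I) := by
  rw [exp_add, ofReal_exp]

theorem hankelIntegral_exp (L Φ : ℝ) (F : ℂ → E) :
    hankelIntegral (Real.exp L) Φ F = stripIntegral L Φ fun w => exp w • F (exp w) := by
  have ray : ∀ y : ℝ, ∫ t : ℝ in Ioi (Real.exp L), exp (y * I) • F (t * exp (y * I)) =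
      ∫ x : ℝ in Ioi L, exp (x + y * I) • F (exp (x + y * I)) := by
    intro y
    rw [← integral_comp_exp_Ioi]
    refine setIntegral_congr_fun measurableSet_Ioi fun x _ => ?_
    rw [← ofReal_exp_mul_exp, mul_smul, coe_smul]
  have seg : ∫ y : ℝ in (-Φ)..Φ, (I * (Real.exp L : ℝ) * exp (y * I)) •
      F ((Real.exp L : ℝ) * exp (y * I)) =
      I • ∫ y : ℝ in (-Φ)..Φ, exp (L + y * I) • F (exp (L + y * I)) := by
    rw [← intervalIntegral.integral_smul]
    refine intervalIntegral.integral_congr fun y _ => ?_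
    rw [mul_assoc, ofReal_exp_mul_exp, mul_smul]
  have r1 := ray Φ
  have r2 := ray (-Φ)
  rw [ofReal_neg] at r2
  rw [hankelIntegral, stripIntegral, seg, r1, r2, ofReal_neg]

theorem hankelIntegrable_exp {L Φ : ℝ} {F : ℂ → E}
    (h1 : ∀ y : ℝ, |y| = Φ →
      IntegrableOn (fun x : ℝ => exp (x + y * I) • F (exp (x + y * I))) (Ioi L))
    (h2 : IntervalIntegrable (fun y : ℝ => exp (L + y * I) • F (exp (L + y * I))) volume (-Φ) Φ)
    (hΦ : 0 ≤ Φ) : HankelIntegrable (Real.exp L) Φ F := by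
  have ray : ∀ y : ℝ, |y| = Φ →
      IntegrableOn (fun t : ℝ => F (t * exp (y * I))) (Ioi (Real.exp L)) := by
    intro y hy
    rw [← integrableOn_comp_exp_Ioi]
    refine ((h1 y hy).smul (exp (-(y * I)))).congr (Eventually.of_forall fun x => ?_)
    simp only [Pi.smul_apply]
    rw [← ofReal_exp_mul_exp, smul_smul, mul_left_comm, ← exp_add, neg_add_cancel, exp_zero, mul_one,
      coe_smul]
  refine ⟨?_, ?_, ray Φ (abs_of_nonneg hΦ)⟩
  · have := ray (-Φ) (by rw [abs_neg, abs_of_nonneg hΦ])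
    rwa [ofReal_neg] at this
  · have hc : Continuous fun y : ℝ => exp (-((L : ℂ) + y * I)) := by fun_prop
    refine (h2.continuousOn_smul hc.continuousOn).congr fun y _ => ?_
    rw [smul_smul, ← exp_add, neg_add_cancel, exp_zero, one_smul, ofReal_exp_mul_exp]

variable {p q : ℕ} {k s τ L Φ C : ℝ} {f : ℂ → ℂ → ℝ → E} {ζ : ℂ × ℂ}

theorem hankelIntegrable_borelIntegrand (hp : 0 < p) (hq : 0 < q) (hk : 0 < k)
    (hΦ : Real.pi / 2 < Φ) (hΦ' : Φ < Real.pi)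
    (hc : ContinuousOn (fun w => tubeMap p q τ f (tubeShift p q k s ζ w)) (halfStrip L Φ))
    (hb : ∀ w ∈ halfStrip L Φ, ‖tubeMap p q τ f (tubeShift p q k s ζ w)‖ ≤ C) :
    HankelIntegrable (Real.exp L) Φ
      (borelIntegrand p q k s (fun x₁ x₂ θ => monomialPower p q k x₁ x₂ θ • f x₁ x₂ θ)
        (exp ζ.1) (exp ζ.2) ((p * ζ.1 + q * ζ.2).im + τ)) := by
  have h0 : 0 < Φ := by linarith [Real.pi_pos]
  have hH : ContinuousOn (fun w => exp (exp w) • tubeMap p q τ f (tubeShift p q k s ζ w))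
      (halfStrip L Φ) := ContinuousOn.smul (by fun_prop) hc
  refine hankelIntegrable_exp (fun y hy => ?_) ?_ h0.le
  · obtain ⟨C₁, hC₁, hexp⟩ := exists_norm_exp_exp_le hΦ hΦ'.le one_pos
    have hmem : ∀ x : ℝ, L < x → (x : ℂ) + y * I ∈ halfStrip L Φ := fun x hx =>
      ⟨by simpa using hx.le, by simp [hy]⟩
    have hint : IntegrableOn (fun x : ℝ => exp (exp (x + y * I)) •
        tubeMap p q τ f (tubeShift p q k s ζ (x + y * I))) (Ioi L) := by
      refine integrableOn_ray (C := C₁ * C) (a := 1)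
        (H := fun w => exp (exp w) • tubeMap p q τ f (tubeShift p q k s ζ w)) ?_ one_pos
        fun x hx => ?_
      · exact hH.comp (f := fun x : ℝ => (x : ℂ) + y * I) (by fun_prop) fun x hx => hmem x hx
      · rw [norm_smul]
        have e1 := hexp (x + y * I) (by simp [hy]) (by simp [hy, hΦ'.le])
        have e2 := hb _ (hmem x hx)
        simp only [add_re, ofReal_re, mul_re, I_re, mul_zero, ofReal_im, I_im, mul_one, sub_self,
          add_zero] at e1
        calc _ ≤ (C₁ * Real.exp (-1 * x)) * C := by gcongr
          _ = _ := by ring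
    refine IntegrableOn.congr_fun (hint.smul
      (monomialPower p q k (exp ζ.1) (exp ζ.2) ((p * ζ.1 + q * ζ.2).im + τ))) (fun x _ => ?_)
      measurableSet_Ioi
    exact (exp_smul_borelIntegrand hp hq hk f ζ (by simp [hy, hΦ'])).symm
  · have hmem : ∀ y ∈ uIcc (-Φ) Φ, (L : ℂ) + y * I ∈ halfStrip L Φ := fun y hy => by
      rw [uIcc_of_le (by linarith)] at hy
      exact ⟨by simp, by simpa using abs_le.mpr hy⟩
    have hcc := hH.comp (f := fun y : ℝ => (L : ℂ) + y * I) (by fun_prop) hmem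
    refine ContinuousOn.intervalIntegrable ((hcc.const_smul
      (monomialPower p q k (exp ζ.1) (exp ζ.2) ((p * ζ.1 + q * ζ.2).im + τ))).congr fun y hy => ?_)
    exact exp_smul_borelIntegrand hp hq hk f ζ ((hmem y hy).2.trans_lt hΦ')

theorem monomialPower_exp_ne_zero (p q : ℕ) (k : ℝ) (z : ℂ × ℂ) (θ : ℝ) :
    monomialPower p q k (exp z.1) (exp z.2) θ ≠ 0 := by
  rw [monomialPower_exp]; exact exp_ne_zero _

theorem borelAlong_eq_stripIntegral (hp : 0 < p) (hq : 0 < q) (hk : 0 < k) (hΦ : 0 ≤ Φ)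
    (hΦ' : Φ < Real.pi) :
    borelAlong p q k s (Real.exp L) Φ
      (fun x₁ x₂ θ => monomialPower p q k x₁ x₂ θ • f x₁ x₂ θ) (exp ζ.1) (exp ζ.2)
        ((p * ζ.1 + q * ζ.2).im + τ) =
      (2 * Real.pi * I : ℂ)⁻¹ • stripIntegral L Φ fun w =>
        exp (exp w) • tubeMap p q τ f (tubeShift p q k s ζ w) := by
  rw [borelAlong, hankelIntegral_exp, stripIntegral_congr hΦ fun w hw =>
    exp_smul_borelIntegrand hp hq hk f ζ (hw.2.trans_lt hΦ'), stripIntegral_const_smul, smul_smul]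
  congr 1
  have := monomialPower_exp_ne_zero p q k ζ ((p * ζ.1 + q * ζ.2).im + τ)
  field_simp

/-! ## The points at which the Borel integrand is evaluated -/

theorem norm_tubeShift_pow_lt (hp : 0 < p) (hq : 0 < q) (hk : 0 < k) (hs : 0 < s) (hs' : s < 1)
    {r : ℝ} (hr : 0 < r) (hB : hankelBound p q k s r (exp ζ.1) (exp ζ.2) < Real.exp L) {w : ℂ}
    (hw : L ≤ w.re) :
    ‖exp (tubeShift p q k s ζ w).1‖ ^ p < r ∧ ‖exp (tubeShift p q k s ζ w).2‖ ^ q < r := by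
  have key : ∀ x l : ℝ, 0 ≤ x → 0 < l → (x / r) ^ (k / l) < Real.exp L →
      x * Real.exp (-(w.re * (l / k))) < r := by
    intro x l hx hl h
    have h1 : x / r < Real.exp (w.re * (l / k)) := by
      have h2 : ((x / r) ^ (k / l)) ^ (l / k) < (Real.exp w.re) ^ (l / k) :=
        Real.rpow_lt_rpow (by positivity) (h.trans_le (Real.exp_le_exp.mpr hw)) (by positivity)
      rw [← Real.rpow_mul (by positivity), ← Real.exp_mul] at h2
      rwa [div_mul_div_cancel₀ hl.ne', div_self hk.ne', Real.rpow_one] at h2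
    rw [div_lt_iff₀ hr] at h1
    rw [Real.exp_neg, ← div_eq_mul_inv, div_lt_iff₀ (Real.exp_pos _)]
    linarith
  rw [norm_exp_tubeShift_fst_pow hp hk, norm_exp_tubeShift_snd_pow hq hk]
  exact ⟨key _ _ (by positivity) hs ((le_max_left _ _).trans_lt hB),
    key _ _ (by positivity) (by linarith) ((le_max_right _ _).trans_lt hB)⟩

theorem tubeShift_mem_monomialSector (hp : 0 < p) (hq : 0 < q) (hk : 0 < k) (hs : 0 < s)
    (hs' : s < 1) {r a b : ℝ} (hr : 0 < r) (hτ : exp (τ * I) = 1)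
    (hB : hankelBound p q k s r (exp ζ.1) (exp ζ.2) < Real.exp L)
    (ha : a < (p * ζ.1 + q * ζ.2).im + τ - Φ / k) (hb : (p * ζ.1 + q * ζ.2).im + τ + Φ / k < b)
    {w : ℂ} (hw : w ∈ halfStrip L Φ) :
    (exp (tubeShift p q k s ζ w).1, exp (tubeShift p q k s ζ w).2,
      (p * (tubeShift p q k s ζ w).1 + q * (tubeShift p q k s ζ w).2).im + τ) ∈
        monomialSector p q a b (r : EReal) := by
  obtain ⟨h1, h2⟩ := norm_tubeShift_pow_lt hp hq hk hs hs' hr hB hw.1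
  obtain ⟨h3, h4⟩ := abs_le.mp hw.2
  have h5 : w.im / k ≤ Φ / k := by gcongr
  have h6 : -Φ / k ≤ w.im / k := by gcongr
  rw [neg_div] at h6
  refine (mem_monomialSector_exp hτ).mpr ⟨by exact_mod_cast h1, by exact_mod_cast h2, ?_, ?_⟩ <;>
  · rw [tubeShift_im hp hq hk]
    linarith

/-- Far out in the half-strip the evaluation points are small and the expansion with `N = 0` bounds
`f`; the rest of the half-strip is compact. The compact part is needed because the expansion is
controlled only up to a radius `r'` that may be smaller than `R₀`. -/
theorem exists_norm_tubeMap_tubeShift_le (hp : 0 < p) (hq : 0 < q) (hk : 0 < k) (hs : 0 < s)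
    (hs' : s < 1) {s₁ R₀ a b : ℝ} {c : ℕ → ℕ → E} (hR₀ : 0 < R₀) (hτ : exp (τ * I) = 1)
    (hf : HasMonomialGevreyExpansion p q s₁ a b (R₀ : EReal) f c) (hΦ : 0 ≤ Φ)
    (hB : hankelBound p q k s R₀ (exp ζ.1) (exp ζ.2) < Real.exp L)
    (ha : a < (p * ζ.1 + q * ζ.2).im + τ - Φ / k)
    (hb : (p * ζ.1 + q * ζ.2).im + τ + Φ / k < b) :
    (∀ w ∈ halfStrip L Φ, DifferentiableAt ℂ
      (fun w => tubeMap p q τ f (tubeShift p q k s ζ w)) w) ∧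
    ∃ C : ℝ, ∀ w ∈ halfStrip L Φ, ‖tubeMap p q τ f (tubeShift p q k s ζ w)‖ ≤ C := by
  obtain ⟨hhol, -, r', hr', hr'R, -, hexp⟩ := hf
  set θ := (p * ζ.1 + q * ζ.2).im + τ with hθ
  have hd : ∀ w ∈ halfStrip L Φ, DifferentiableAt ℂ
      (fun w => tubeMap p q τ f (tubeShift p q k s ζ w)) w := fun w hw =>
    (hhol.differentiableAt_tubeMap (τ := τ) (tubeShift_mem_monomialSector hp hq hk hs hs' hR₀ hτ hB
      ha hb hw)).comp w (differentiable_tubeShift ζ w)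
  refine ⟨hd, ?_⟩
  have hΦk : 0 ≤ Φ / k := by positivity
  obtain ⟨C, A, -, -, hC⟩ := hexp ((a + (θ - Φ / k)) / 2) ((b + (θ + Φ / k)) / 2) (r' / 2)
    (by linarith) (by linarith) (by linarith) (by positivity) (by linarith)
  obtain ⟨L₁, hL₁⟩ : ∃ L₁, hankelBound p q k s (r' / 2) (exp ζ.1) (exp ζ.2) < Real.exp L₁ :=
    (Real.tendsto_exp_atTop.eventually_gt_atTop _).exists
  have hK : IsCompact (Icc L L₁ ×ℂ Icc (-Φ) Φ) := isCompact_Icc.reProdIm isCompact_Icc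
  obtain ⟨C', hC'⟩ := hK.exists_bound_of_continuousOn
    (f := fun w => tubeMap p q τ f (tubeShift p q k s ζ w)) fun w hw =>
      (hd w ⟨hw.1.1, abs_le.mpr hw.2⟩).continuousAt.continuousWithinAt
  refine ⟨max C C', fun w hw => ?_⟩
  rcases le_total w.re L₁ with h | h
  · exact (hC' w ⟨⟨hw.1, h⟩, abs_le.mp hw.2⟩).trans (le_max_right _ _)
  · have hmem := tubeShift_mem_monomialSector (L := L₁) (Φ := Φ) hp hq hk hs hs' (half_pos hr') hτ
      hL₁ (a := (a + (θ - Φ / k)) / 2) (b := (b + (θ + Φ / k)) / 2) (by linarith) (by linarith)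
      (w := w) ⟨h, hw.2⟩
    have := hC 0 _ _ _ hmem
    simp only [monomialRemainder, Finset.range_zero, Finset.sum_empty, sub_zero, pow_zero, mul_one,
      Nat.factorial_zero, Nat.cast_one, Real.one_rpow] at this
    exact this.trans (le_max_left _ _)

theorem stripIntegral_tubeMap_eq (hp : 0 < p) (hq : 0 < q) (hk : 0 < k) (hs : 0 < s)
    (hs' : s < 1) {s₁ R₀ a b : ℝ} {c : ℕ → ℕ → E} (hR₀ : 0 < R₀) (hτ : exp (τ * I) = 1)
    (hf : HasMonomialGevreyExpansion p q s₁ a b (R₀ : EReal) f c) {L₁ L₂ Φ₁ Φ₂ : ℝ}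
    (h₁ : Real.pi / 2 < Φ₁) (h₁' : Φ₁ < Real.pi) (h₂ : Real.pi / 2 < Φ₂) (h₂' : Φ₂ < Real.pi)
    (hB₁ : hankelBound p q k s R₀ (exp ζ.1) (exp ζ.2) < Real.exp L₁)
    (hB₂ : hankelBound p q k s R₀ (exp ζ.1) (exp ζ.2) < Real.exp L₂)
    (ha₁ : a < (p * ζ.1 + q * ζ.2).im + τ - Φ₁ / k)
    (ha₂ : a < (p * ζ.1 + q * ζ.2).im + τ - Φ₂ / k)
    (hb₁ : (p * ζ.1 + q * ζ.2).im + τ + Φ₁ / k < b)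
    (hb₂ : (p * ζ.1 + q * ζ.2).im + τ + Φ₂ / k < b) :
    stripIntegral L₁ Φ₁ (fun w => exp (exp w) • tubeMap p q τ f (tubeShift p q k s ζ w)) =
      stripIntegral L₂ Φ₂ (fun w => exp (exp w) • tubeMap p q τ f (tubeShift p q k s ζ w)) := by
  have hpi := Real.pi_pos
  obtain ⟨hd, C, hC⟩ := exists_norm_tubeMap_tubeShift_le (L := min L₁ L₂) (Φ := max Φ₁ Φ₂) hp hq hk
    hs hs' hR₀ hτ hf (le_max_of_le_left (by linarith))
    (by rcases min_choice L₁ L₂ with h | h <;> rwa [h])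
    (by rcases max_choice Φ₁ Φ₂ with h | h <;> rwa [h])
    (by rcases max_choice Φ₁ Φ₂ with h | h <;> rwa [h])
  obtain ⟨C₁, hC₁, hexp⟩ := exists_norm_exp_exp_le (lt_min h₁ h₂)
    ((min_le_left _ _).trans h₁'.le) one_pos
  refine stripIntegral_eq_stripIntegral (C := C₁ * C) (by linarith) (by linarith) one_pos
    (fun w hw => DifferentiableAt.smul (by fun_prop) (hd w hw)) fun w hw hw' => ?_
  rw [norm_smul]
  calc _ ≤ (C₁ * Real.exp (-1 * w.re)) * C :=
        mul_le_mul (hexp w hw' (hw.2.trans (max_lt h₁' h₂').le)) (hC w hw) (norm_nonneg _)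
          (by positivity)
    _ = _ := by ring

end HankelLog

/-! ### The Borel transform as an integral over a path of free radius and angle -/

section Borel

variable {E : Type*} [NormedAddCommGroup E] [NormedSpace ℂ E] {p q : ℕ}
  {k s s₁ d ε ε' R₀ τ L Φ r r' : ℝ} {f : ℂ → ℂ → ℝ → E} {c : ℕ → ℕ → E} {ζ : ℂ × ℂ}

theorem hankelBound_nonneg (hr : 0 ≤ r) (x₁ x₂ : ℂ) : 0 ≤ hankelBound p q k s r x₁ x₂ :=
  le_max_of_le_left (by positivity)

theorem hankelBound_anti (hk : 0 < k) (hs : 0 < s) (hs' : s < 1) (hr : 0 < r) (h : r ≤ r')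
    (x₁ x₂ : ℂ) : hankelBound p q k s r' x₁ x₂ ≤ hankelBound p q k s r x₁ x₂ := by
  have : 0 < 1 - s := by linarith
  have hr' : 0 < r' := hr.trans_le h
  unfold hankelBound
  gcongr

theorem hankelAngle_div (hk : 0 < k) (ε ε' : ℝ) :
    hankelAngle k ε ε' / k = Real.pi / k / 2 + (ε - ε') := by
  unfold hankelAngle; field_simp

theorem pi_div_two_lt_hankelAngle (hk : 0 < k) (h : ε' < ε) :
    Real.pi / 2 < hankelAngle k ε ε' := by
  have : 0 < k * (ε - ε') := mul_pos hk (by linarith)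
  unfold hankelAngle; linarith

theorem hankelAngle_lt_pi (hk : 0 < k) (h0 : 0 ≤ ε') (hε' : 2 * ε < Real.pi / k) :
    hankelAngle k ε ε' < Real.pi := by
  rw [lt_div_iff₀ hk] at hε'
  unfold hankelAngle
  nlinarith

/-- `monomialBorel` fixes one path depending on the point. Path independence frees both `L` and the
angle: the first conjunct is the well-definedness of `g`, the second the form used for remainders
and holomorphy. -/
theorem monomialBorel_eq_hankelPathIntegral (hp : 0 < p) (hq : 0 < q) (hk : 0 < k) (hs : 0 < s)
    (hs' : s < 1) (hε' : 2 * ε < Real.pi / k) (hR₀ : 0 < R₀)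
    (hf : HasMonomialGevreyExpansion p q s₁ (d - (Real.pi / k + 2 * ε) / 2)
      (d + (Real.pi / k + 2 * ε) / 2) (R₀ : EReal) f c)
    (hτ : exp (τ * I) = 1) (hθ : |(p * ζ.1 + q * ζ.2).im + τ - d| < ε') (hlt : ε' < ε)
    (hB : hankelBound p q k s R₀ (exp ζ.1) (exp ζ.2) < Real.exp L) :
    (HankelIntegrable (Real.exp L) (hankelAngle k ε ε')
      (borelIntegrand p q k s (fun x₁ x₂ θ => monomialPower p q k x₁ x₂ θ • f x₁ x₂ θ)
        (exp ζ.1) (exp ζ.2) ((p * ζ.1 + q * ζ.2).im + τ)) ∧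
    borelAlong p q k s (Real.exp L) (hankelAngle k ε ε')
      (fun x₁ x₂ θ => monomialPower p q k x₁ x₂ θ • f x₁ x₂ θ) (exp ζ.1) (exp ζ.2)
        ((p * ζ.1 + q * ζ.2).im + τ) =
      monomialBorel p q k s d ε R₀ (fun x₁ x₂ θ => monomialPower p q k x₁ x₂ θ • f x₁ x₂ θ)
        (exp ζ.1) (exp ζ.2) ((p * ζ.1 + q * ζ.2).im + τ)) ∧
    monomialBorel p q k s d ε R₀ (fun x₁ x₂ θ => monomialPower p q k x₁ x₂ θ • f x₁ x₂ θ)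
        (exp ζ.1) (exp ζ.2) ((p * ζ.1 + q * ζ.2).im + τ) =
      (2 * Real.pi * I : ℂ)⁻¹ • hankelPathIntegral L (hankelAngle k ε ε')
        (fun w => tubeMap p q τ f (tubeShift p q k s ζ w)) := by
  set θ := (p * ζ.1 + q * ζ.2).im + τ with hθdef
  have hpi := Real.pi_pos
  have habs := abs_lt.mp hθ
  have h0 : 0 < ε' := (abs_nonneg _).trans_lt hθ
  set ε'' := (ε + |θ - d|) / 2 with hε''
  have hε''1 : |θ - d| < ε'' := by linarith
  have hε''2 : ε'' < ε := by linarith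
  have habs' := abs_lt.mp hε''1
  have h0'' : 0 < ε'' := (abs_nonneg _).trans_lt hε''1
  have e1 := hankelAngle_div hk ε ε'
  have e2 := hankelAngle_div hk ε ε''
  have p1 := pi_div_two_lt_hankelAngle hk hlt
  have p2 := pi_div_two_lt_hankelAngle hk hε''2
  have q1 := hankelAngle_lt_pi hk h0.le hε'
  have q2 := hankelAngle_lt_pi hk h0''.le hε'
  obtain ⟨hd, C, hC⟩ := exists_norm_tubeMap_tubeShift_le (Φ := hankelAngle k ε ε') hp hq hk hs hs'
    hR₀ hτ hf (by linarith) hB (by rw [e1]; linarith) (by rw [e1]; linarith)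
  have hcont : ContinuousOn (fun w => tubeMap p q τ f (tubeShift p q k s ζ w))
      (halfStrip L (hankelAngle k ε ε')) := fun w hw => (hd w hw).continuousAt.continuousWithinAt
  have hbd0 := hankelBound_nonneg (p := p) (q := q) (k := k) (s := s) hR₀.le (exp ζ.1) (exp ζ.2)
  have hL' : Real.exp (Real.log (hankelBound p q k s R₀ (exp ζ.1) (exp ζ.2) + 1)) =
      hankelBound p q k s R₀ (exp ζ.1) (exp ζ.2) + 1 := Real.exp_log (by linarith)
  have halong : borelAlong p q k s (Real.exp L) (hankelAngle k ε ε')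
      (fun x₁ x₂ θ => monomialPower p q k x₁ x₂ θ • f x₁ x₂ θ) (exp ζ.1) (exp ζ.2) θ =
      monomialBorel p q k s d ε R₀ (fun x₁ x₂ θ => monomialPower p q k x₁ x₂ θ • f x₁ x₂ θ)
        (exp ζ.1) (exp ζ.2) θ := by
    rw [monomialBorel, ← hL', borelAlong_eq_stripIntegral hp hq hk (by linarith) q1,
      borelAlong_eq_stripIntegral hp hq hk (by linarith) q2]
    congr 1
    refine stripIntegral_tubeMap_eq hp hq hk hs hs' hR₀ hτ hf p1 q1 p2 q2 hB (by rw [hL']; linarith)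
      ?_ ?_ ?_ ?_
    · rw [e1]; linarith
    · rw [e2]; linarith
    · rw [e1]; linarith
    · rw [e2]; linarith
  refine ⟨⟨hankelIntegrable_borelIntegrand hp hq hk p1 q1 hcont hC, halong⟩, ?_⟩
  rw [← halong, borelAlong_eq_stripIntegral hp hq hk (by linarith) q1,
    hankelPathIntegral_eq_stripIntegral p1 q1.le hcont hC]

/-! ## The Borel transform of the coefficients of the expansion -/

theorem pow_mul_monomialTerm_tubeShift (n : ℕ) (w : ℂ) (mj : ℕ × ℕ) :
    ((exp (tubeShift p q k s ζ w).1 ^ p * exp (tubeShift p q k s ζ w).2 ^ q) ^ n) •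
      monomialTerm p q c n (exp (tubeShift p q k s ζ w).1) (exp (tubeShift p q k s ζ w).2) mj =
    exp (-(borelWeight p q k s (n * p + mj.1) (n * q + mj.2) * w)) •
      (((exp ζ.1 ^ p * exp ζ.2 ^ q) ^ n) • monomialTerm p q c n (exp ζ.1) (exp ζ.2) mj) := by
  simp only [monomialTerm, smul_smul]
  congr 1
  simp only [← exp_nat_mul, ← exp_add]
  congr 1
  simp only [tubeShift, borelWeight]
  push_cast
  ring

theorem norm_exp_pow_mul_tubeShift (hp : 0 < p) (hq : 0 < q) (hk : 0 < k) (w : ℂ) :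
    ‖exp (tubeShift p q k s ζ w).1 ^ p * exp (tubeShift p q k s ζ w).2 ^ q‖ =
      ‖exp ζ.1 ^ p * exp ζ.2 ^ q‖ * Real.exp (-(w.re / k)) := by
  rw [exp_pow_mul_exp_pow, exp_pow_mul_exp_pow, norm_exp, norm_exp, tubeShift_re hp hq hk,
    ← Real.exp_add, sub_eq_add_neg]

theorem tubeShift_mem_monomialPolydisc (hp : 0 < p) (hq : 0 < q) (hk : 0 < k) (hs : 0 < s)
    (hs' : s < 1) (hr : 0 < r) (hrr : r ≤ r')
    (hB : hankelBound p q k s r (exp ζ.1) (exp ζ.2) < Real.exp L) {w : ℂ} (hw : L ≤ w.re) :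
    (exp (tubeShift p q k s ζ w).1, exp (tubeShift p q k s ζ w).2) ∈ monomialPolydisc p q r' := by
  obtain ⟨h1, h2⟩ := norm_tubeShift_pow_lt hp hq hk hs hs' hr hB hw
  exact ⟨h1.trans_le hrr, h2.trans_le hrr⟩

theorem continuousOn_monomialPart_tubeShift (hp : 0 < p) (hq : 0 < q) (hk : 0 < k) (hs : 0 < s)
    (hs' : s < 1) (hc : MonomialPartsOn p q c r') (hr : 0 < r) (hrr : r ≤ r')
    (hB : hankelBound p q k s r (exp ζ.1) (exp ζ.2) < Real.exp L) (n : ℕ) :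
    ContinuousOn (fun w : ℂ => ((exp (tubeShift p q k s ζ w).1 ^ p *
      exp (tubeShift p q k s ζ w).2 ^ q) ^ n) • monomialPart p q c n
        (exp (tubeShift p q k s ζ w).1) (exp (tubeShift p q k s ζ w).2)) (halfStrip L Φ) := by
  have hsh : Continuous (tubeShift p q k s ζ) := (differentiable_tubeShift ζ).continuous
  refine ContinuousOn.smul (by fun_prop) ?_
  exact (hc n).2.1.continuousOn.comp (f := fun w : ℂ => (exp (tubeShift p q k s ζ w).1,
    exp (tubeShift p q k s ζ w).2)) (by fun_prop)
    fun w hw => tubeShift_mem_monomialPolydisc hp hq hk hs hs' hr hrr hB hw.1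

theorem exists_norm_monomialPart_tubeShift_le (hp : 0 < p) (hq : 0 < q) (hk : 0 < k) (hs : 0 < s)
    (hs' : s < 1) (hc : MonomialPartsOn p q c r') (hr : 0 < r) (hrr : r ≤ r')
    (hB : hankelBound p q k s r (exp ζ.1) (exp ζ.2) < Real.exp L) (n : ℕ) :
    ∃ C : ℝ, ∀ w ∈ halfStrip L Φ, ‖((exp (tubeShift p q k s ζ w).1 ^ p *
      exp (tubeShift p q k s ζ w).2 ^ q) ^ n) • monomialPart p q c n
        (exp (tubeShift p q k s ζ w).1) (exp (tubeShift p q k s ζ w).2)‖ ≤ C := by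
  obtain ⟨K, hK⟩ := (hc n).2.2
  refine ⟨(r' * r') ^ n * K, fun w hw => ?_⟩
  have hmem := tubeShift_mem_monomialPolydisc hp hq hk hs hs' hr hrr hB hw.1
  rw [norm_smul, norm_pow, norm_mul, norm_pow, norm_pow]
  have hr'0 : 0 ≤ r' := hr.le.trans hrr
  exact mul_le_mul (pow_le_pow_left₀ (by positivity) (mul_le_mul hmem.1.le hmem.2.le
    (by positivity) hr'0) n) (hK _ hmem) (norm_nonneg _) (by positivity)

theorem hankelPathIntegral_exp_smul {l : ℝ} (hl : 0 ≤ l) (L : ℝ) (hΦ : Real.pi / 2 < Φ)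
    (hΦ' : Φ ≤ Real.pi) [CompleteSpace E] (v : E) :
    hankelPathIntegral L Φ (fun w => exp (-(l * w)) • v) =
      (2 * Real.pi * I : ℂ) • ((Real.Gamma (1 + l) : ℂ)⁻¹ • v) := by
  rw [smul_smul, ← div_eq_mul_inv, ← hankelPathIntegral_exp hl L hΦ hΦ', hankelPathIntegral,
    hankelPathIntegral, ← integral_smul_const]
  simp only [smul_assoc]

/-- Along the path each monomial is multiplied by `exp (-λ w)`, so Hankel's formula yields the
factor `1 / Γ (1 + λ)` of the formal transform. The sum and the integral are interchanged by
dominated convergence. -/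
theorem hankelPathIntegral_monomialPart [CompleteSpace E] (hp : 0 < p) (hq : 0 < q) (hk : 0 < k)
    (hs : 0 < s) (hs' : s < 1) (hΦ : Real.pi / 2 < Φ) (hΦ' : Φ ≤ Real.pi)
    (hc : MonomialPartsOn p q c r') (hr : 0 < r) (hrr : r < r')
    (hB : hankelBound p q k s r (exp ζ.1) (exp ζ.2) < Real.exp L) (n : ℕ)
    (hsum : Summable (monomialTerm p q (formalMonomialBorel p q k s c) n (exp ζ.1) (exp ζ.2))) :
    ((exp ζ.1 ^ p * exp ζ.2 ^ q) ^ n) •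
      monomialPart p q (formalMonomialBorel p q k s c) n (exp ζ.1) (exp ζ.2) =
    (2 * Real.pi * I : ℂ)⁻¹ • hankelPathIntegral L Φ (fun w => ((exp (tubeShift p q k s ζ w).1 ^ p *
      exp (tubeShift p q k s ζ w).2 ^ q) ^ n) • monomialPart p q c n
        (exp (tubeShift p q k s ζ w).1) (exp (tubeShift p q k s ζ w).2)) := by
  -- The path stays in the polydisc of radius `r`, and the coefficients are bounded at the
  -- intermediate radius `(r + r') / 2 < r'`; the ratios of the corresponding roots are less than
  -- `1` and give a geometric majorant.
  have hm0 : 0 < (r + r') / 2 := by linarith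
  have hroot : ∀ (l : ℕ) (x : ℝ), 0 < l → 0 < x → (x ^ (1 / l : ℝ)) ^ l = x := by
    intro l x hl hx
    rw [one_div]
    exact Real.rpow_inv_natCast_pow hx.le hl.ne'
  set η₁ := r ^ (1 / p : ℝ) with hη₁
  set η₂ := r ^ (1 / q : ℝ) with hη₂
  set r₁ := ((r + r') / 2) ^ (1 / p : ℝ) with hr₁
  set r₂ := ((r + r') / 2) ^ (1 / q : ℝ) with hr₂
  have hr₁0 : 0 < r₁ := by positivity
  have hr₂0 : 0 < r₂ := by positivity
  have hη₁0 : 0 < η₁ := by positivity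
  have hη₂0 : 0 < η₂ := by positivity
  have hlt₁ : η₁ < r₁ := Real.rpow_lt_rpow hr.le (by linarith) (by positivity)
  have hlt₂ : η₂ < r₂ := Real.rpow_lt_rpow hr.le (by linarith) (by positivity)
  obtain ⟨K, hK0, hK⟩ := hc.exists_norm_monomialCoeff_le hr₁0 hr₂0
    (by rw [hroot p _ hp hm0]; linarith) (by rw [hroot q _ hq hm0]; linarith) n
  have hgeo : Summable fun mj : ℕ × ℕ => (r * r) ^ n * (K * ((η₁ / r₁) ^ mj.1 * (η₂ / r₂) ^ mj.2)) := by
    refine ((Summable.mul_of_nonneg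
      (summable_geometric_of_lt_one (by positivity) ((div_lt_one hr₁0).mpr hlt₁))
      (summable_geometric_of_lt_one (by positivity) ((div_lt_one hr₂0).mpr hlt₂))
      (fun _ => by positivity) (fun _ => by positivity)).mul_left K).mul_left _
  have key := hasSum_hankelPathIntegral (L := L) (Φ := Φ)
    (ψ := fun mj w => ((exp (tubeShift p q k s ζ w).1 ^ p *
      exp (tubeShift p q k s ζ w).2 ^ q) ^ n) • monomialTerm p q c n
        (exp (tubeShift p q k s ζ w).1) (exp (tubeShift p q k s ζ w).2) mj)
    (ψ₀ := fun w => ((exp (tubeShift p q k s ζ w).1 ^ p *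
      exp (tubeShift p q k s ζ w).2 ^ q) ^ n) • monomialPart p q c n
        (exp (tubeShift p q k s ζ w).1) (exp (tubeShift p q k s ζ w).2)) hΦ hΦ' hgeo ?_ ?_ ?_
  · simp only [pow_mul_monomialTerm_tubeShift] at key
    have hterm : ∀ mj : ℕ × ℕ, hankelPathIntegral L Φ (fun w =>
        exp (-(borelWeight p q k s (n * p + mj.1) (n * q + mj.2) * w)) •
        (((exp ζ.1 ^ p * exp ζ.2 ^ q) ^ n) • monomialTerm p q c n (exp ζ.1) (exp ζ.2) mj)) =
        (2 * Real.pi * I : ℂ) • (((exp ζ.1 ^ p * exp ζ.2 ^ q) ^ n) •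
          monomialTerm p q (formalMonomialBorel p q k s c) n (exp ζ.1) (exp ζ.2) mj) := by
      intro mj
      rw [hankelPathIntegral_exp_smul (borelWeight_nonneg hk hs hs' _ _) L hΦ hΦ']
      congr 1
      rw [smul_comm]
      congr 1
      rw [monomialTerm, monomialTerm, monomialCoeff_formalMonomialBorel hp hq hk, smul_comm]
    simp only [hterm] at key
    have h2 := (hsum.hasSum.const_smul ((exp ζ.1 ^ p * exp ζ.2 ^ q) ^ n)).const_smul
      (2 * Real.pi * I : ℂ)
    rw [← h2.unique key, smul_smul, inv_mul_cancel₀ (by simp [Real.pi_ne_zero]), one_smul]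
    rfl
  · intro mj
    simp only [pow_mul_monomialTerm_tubeShift]
    exact ContinuousOn.smul (by fun_prop) continuousOn_const
  · intro mj w hw
    obtain ⟨h1, h2⟩ := norm_tubeShift_pow_lt hp hq hk hs hs' hr hB hw.1
    have g1 : ‖exp (tubeShift p q k s ζ w).1‖ ≤ η₁ := by
      refine le_of_pow_le_pow_left₀ hp.ne' hη₁0.le ?_
      rw [hroot p r hp hr]; exact h1.le
    have g2 : ‖exp (tubeShift p q k s ζ w).2‖ ≤ η₂ := by
      refine le_of_pow_le_pow_left₀ hq.ne' hη₂0.le ?_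
      rw [hroot q r hq hr]; exact h2.le
    rw [norm_smul, norm_pow, norm_mul, norm_pow, norm_pow, monomialTerm, norm_smul, norm_mul,
      norm_pow, norm_pow]
    refine mul_le_mul (pow_le_pow_left₀ (by positivity) (mul_le_mul h1.le h2.le
      (by positivity) hr.le) n) ?_ (by positivity) (by positivity)
    calc _ ≤ η₁ ^ mj.1 * η₂ ^ mj.2 * ‖monomialCoeff p q c n mj.1 mj.2‖ := by gcongr
      _ = (r₁ ^ mj.1 * r₂ ^ mj.2 * ‖monomialCoeff p q c n mj.1 mj.2‖) *
          ((η₁ / r₁) ^ mj.1 * (η₂ / r₂) ^ mj.2) := by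
            rw [div_pow, div_pow]; field_simp
      _ ≤ _ := by gcongr; exact hK _ _
  · intro w hw
    have hmem := tubeShift_mem_monomialPolydisc hp hq hk hs hs' hr hrr.le hB hw.1
    exact ((hc n).1 _ hmem).hasSum.const_smul _

end Borel

/-! ### Remainder estimates and holomorphy of the Borel transform -/

section BorelExpansion

variable {E : Type*} [NormedAddCommGroup E] [NormedSpace ℂ E] [CompleteSpace E] {p q : ℕ}
  {k s s₁ s₂ d ε ε' R₀ τ L r r' : ℝ} {f : ℂ → ℂ → ℝ → E} {c : ℕ → ℕ → E} {ζ : ℂ × ℂ}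

theorem monomialRemainder_monomialBorel (hp : 0 < p) (hq : 0 < q) (hk : 0 < k) (hs : 0 < s)
    (hs' : s < 1) (hε' : 2 * ε < Real.pi / k) (hR₀ : 0 < R₀)
    (hf : HasMonomialGevreyExpansion p q s₁ (d - (Real.pi / k + 2 * ε) / 2)
      (d + (Real.pi / k + 2 * ε) / 2) (R₀ : EReal) f c)
    (hc : MonomialPartsOn p q c r') (hr : 0 < r) (hrr : r < r') (hr'R : r' ≤ R₀)
    (hsum : ∀ n, Summable
      (monomialTerm p q (formalMonomialBorel p q k s c) n (exp ζ.1) (exp ζ.2)))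
    (hτ : exp (τ * I) = 1) (hθ : |(p * ζ.1 + q * ζ.2).im + τ - d| < ε') (hlt : ε' < ε)
    (hB : hankelBound p q k s r (exp ζ.1) (exp ζ.2) < Real.exp L) (N : ℕ) :
    monomialRemainder p q
        (monomialBorel p q k s d ε R₀ (fun x₁ x₂ θ => monomialPower p q k x₁ x₂ θ • f x₁ x₂ θ))
        (formalMonomialBorel p q k s c) N (exp ζ.1) (exp ζ.2) ((p * ζ.1 + q * ζ.2).im + τ) =
      (2 * Real.pi * I : ℂ)⁻¹ • hankelPathIntegral L (hankelAngle k ε ε') (fun w =>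
        monomialRemainder p q f c N (exp (tubeShift p q k s ζ w).1)
          (exp (tubeShift p q k s ζ w).2)
          ((p * (tubeShift p q k s ζ w).1 + q * (tubeShift p q k s ζ w).2).im + τ)) := by
  have hpi := Real.pi_pos
  have habs := abs_lt.mp hθ
  have h0 : 0 < ε' := (abs_nonneg _).trans_lt hθ
  have e1 := hankelAngle_div hk ε ε'
  have p1 := pi_div_two_lt_hankelAngle hk hlt
  have q1 := hankelAngle_lt_pi hk h0.le hε'
  have hB' : hankelBound p q k s R₀ (exp ζ.1) (exp ζ.2) < Real.exp L :=
    (hankelBound_anti hk hs hs' hr (hrr.le.trans hr'R) _ _).trans_lt hB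
  obtain ⟨hd, C, hC⟩ := exists_norm_tubeMap_tubeShift_le (Φ := hankelAngle k ε ε') hp hq hk hs hs'
    hR₀ hτ hf (by linarith) hB' (by rw [e1]; linarith) (by rw [e1]; linarith)
  have hint := integrable_hankelKernel_smul p1 q1.le
    (fun w hw => (hd w hw).continuousAt.continuousWithinAt) hC
  have hint' : ∀ n : ℕ, Integrable fun t => hankelKernel L (hankelAngle k ε ε') t •
      (((exp (tubeShift p q k s ζ (hankelPath L (hankelAngle k ε ε') t)).1 ^ p *
        exp (tubeShift p q k s ζ (hankelPath L (hankelAngle k ε ε') t)).2 ^ q) ^ n) •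
        monomialPart p q c n (exp (tubeShift p q k s ζ (hankelPath L (hankelAngle k ε ε') t)).1)
          (exp (tubeShift p q k s ζ (hankelPath L (hankelAngle k ε ε') t)).2)) := by
    intro n
    obtain ⟨C', hC'⟩ := exists_norm_monomialPart_tubeShift_le (Φ := hankelAngle k ε ε') hp hq hk hs
      hs' hc hr hrr.le hB n
    exact integrable_hankelKernel_smul p1 q1.le
      (continuousOn_monomialPart_tubeShift hp hq hk hs hs' hc hr hrr.le hB n) hC'
  rw [monomialRemainder, (monomialBorel_eq_hankelPathIntegral hp hq hk hs hs' hε' hR₀ hf hτ hθ hlt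
    hB').2, Finset.sum_congr rfl fun n _ => hankelPathIntegral_monomialPart hp hq hk hs hs' p1 q1.le
      hc hr hrr hB n (hsum n), ← Finset.smul_sum, ← smul_sub]
  congr 1
  simp only [hankelPathIntegral]
  rw [← integral_finsetSum _ fun n _ => hint' n, ← integral_sub hint
    (integrable_finsetSum _ fun n _ => hint' n)]
  refine integral_congr_ae (Eventually.of_forall fun t => ?_)
  simp only [monomialRemainder, tubeMap, smul_sub, Finset.smul_sum]

/-- Here the Gevrey order drops by `1/k`: for `R = exp L ≥ N / k` one has `N! ≤ N ^ N ≤ (k R) ^ N`,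
so `R ^ (-N/k)` compensates `N! ^ (1/k)` up to a geometric factor. -/
theorem factorial_rpow_mul_exp_le (hk : 0 < k) (hs₂ : s₂ = max (s₁ - 1 / k) 0) {N : ℕ}
    (hL : N / k ≤ Real.exp L) :
    (N.factorial : ℝ) ^ s₁ * Real.exp (-(L / k)) ^ N ≤
      (k ^ (1 / k)) ^ N * (N.factorial : ℝ) ^ s₂ := by
  have h1 : (1 : ℝ) ≤ N.factorial := by exact_mod_cast Nat.one_le_iff_ne_zero.mpr N.factorial_ne_zero
  have h2 : (N.factorial : ℝ) ^ (1 / k) ≤ (k ^ (1 / k)) ^ N * Real.exp (L / k) ^ N := by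
    have hN : (N.factorial : ℝ) ≤ (k * Real.exp L) ^ N := by
      have : (N.factorial : ℝ) ≤ (N : ℝ) ^ N := by exact_mod_cast Nat.factorial_le_pow N
      refine this.trans (pow_le_pow_left₀ (by positivity) ?_ N)
      rw [div_le_iff₀ hk] at hL
      linarith
    calc (N.factorial : ℝ) ^ (1 / k) ≤ ((k * Real.exp L) ^ N) ^ (1 / k) := by gcongr
      _ = (k ^ (1 / k)) ^ N * Real.exp (L / k) ^ N := by
        rw [← Real.rpow_natCast, ← Real.rpow_mul (by positivity), mul_comm (N : ℝ),
          Real.rpow_mul (by positivity), Real.rpow_natCast, Real.mul_rpow hk.le (by positivity),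
          mul_pow, ← Real.exp_mul, mul_one_div]
  have h3 : (N.factorial : ℝ) ^ s₁ ≤ (N.factorial : ℝ) ^ s₂ * (N.factorial : ℝ) ^ (1 / k) := by
    rw [← Real.rpow_add (by linarith)]
    refine Real.rpow_le_rpow_of_exponent_le h1 ?_
    have := le_max_left (s₁ - 1 / k) 0
    rw [← hs₂] at this
    linarith
  calc _ ≤ (N.factorial : ℝ) ^ s₂ * ((k ^ (1 / k)) ^ N * Real.exp (L / k) ^ N) *
        Real.exp (-(L / k)) ^ N := by
        gcongr
        exact h3.trans (by gcongr)
    _ = _ := by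
      rw [mul_assoc, mul_assoc, ← mul_pow, ← Real.exp_add, add_neg_cancel, Real.exp_zero, one_pow]
      ring

theorem div_rpow_eq {l : ℕ} {α x ρ : ℝ} (hx : 0 ≤ x) (hρ : 0 ≤ ρ) :
    (x ^ l / ρ) ^ (k / α) = (ρ ^ (k / α))⁻¹ * x ^ (l * k / α) := by
  rw [Real.div_rpow (by positivity) hρ, ← Real.rpow_natCast, ← Real.rpow_mul hx, mul_div_assoc]
  ring

theorem exists_norm_monomialRemainder_monomialBorel_le (hp : 0 < p) (hq : 0 < q) (hk : 0 < k)
    (hs : 0 < s) (hs' : s < 1) (hs₂ : s₂ = max (s₁ - 1 / k) 0) (hε' : 2 * ε < Real.pi / k)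
    (hR₀ : 0 < R₀)
    (hf : HasMonomialGevreyExpansion p q s₁ (d - (Real.pi / k + 2 * ε) / 2)
      (d + (Real.pi / k + 2 * ε) / 2) (R₀ : EReal) f c)
    (hsum : ∀ n, ∀ ξ₁ ξ₂ : ℂ, Summable
      (monomialTerm p q (formalMonomialBorel p q k s c) n ξ₁ ξ₂))
    {a b : ℝ} (ha : d - ε < a) (hab : a < b) (hb : b < d + ε) :
    ∃ B D M : ℝ, 0 < B ∧ 0 < D ∧ 0 < M ∧ ∀ N : ℕ, ∀ ξ₁ ξ₂ : ℂ, ∀ θ : ℝ,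
      (ξ₁, ξ₂, θ) ∈ monomialSector p q a b ⊤ →
        ‖monomialRemainder p q (monomialBorel p q k s d ε R₀
          (fun x₁ x₂ θ => monomialPower p q k x₁ x₂ θ • f x₁ x₂ θ))
          (formalMonomialBorel p q k s c) N ξ₁ ξ₂ θ‖ ≤
            D * B ^ N * (N.factorial : ℝ) ^ s₂ * ‖ξ₁ ^ p * ξ₂ ^ q‖ ^ N *
              Real.exp (M * (‖ξ₁‖ ^ (p * k / s) + ‖ξ₂‖ ^ (q * k / (1 - s)))) := by
  obtain ⟨r', hr', hr'R, hc, hexp⟩ := hf.2.2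
  have hr'R : r' ≤ R₀ := by exact_mod_cast hr'R
  have hpi := Real.pi_pos
  have h1s : 0 < 1 - s := by linarith
  set ε₁ := max |a - d| |b - d| with hε₁
  have hε₁lt : ε₁ < ε := max_lt (abs_lt.mpr ⟨by linarith, by linarith⟩)
    (abs_lt.mpr ⟨by linarith, by linarith⟩)
  have hε₁0 : 0 ≤ ε₁ := (abs_nonneg _).trans (le_max_left _ _)
  -- All arguments stay within `ε₁` of `d`. The angle of the path corresponds to `ε₂ > ε₁`, which
  -- leaves a gap, and the subsector `a'`, `b'` below uses half of it.
  set ε₂ := (ε₁ + ε) / 2 with hε₂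
  set Φ := hankelAngle k ε ε₂ with hΦ
  have e1 : Φ / k = Real.pi / k / 2 + (ε - ε₂) := hankelAngle_div hk ε ε₂
  have p1 : Real.pi / 2 < Φ := pi_div_two_lt_hankelAngle hk (by linarith)
  have q1 : Φ < Real.pi := hankelAngle_lt_pi hk (by linarith) hε'
  have hπk : 0 < Real.pi / k := by positivity
  set a' := d - (ε₁ + ε₂) / 2 - Φ / k with ha'
  set b' := d + (ε₁ + ε₂) / 2 + Φ / k with hb'
  have hρ : 0 < r' / 2 := by positivity
  obtain ⟨C, A, hC0, hA0, hC⟩ := hexp a' b' (r' / 2) (by rw [ha', e1]; linarith)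
    (by rw [ha', hb', e1]; linarith) (by rw [hb', e1]; linarith) hρ (by linarith)
  have hcos := cos_neg_of_angle p1 q1.le
  set K := Real.exp (-Real.cos Φ * Φ) * (2 / -Real.cos Φ) with hK
  have hK0 : 0 < K := mul_pos (Real.exp_pos _) (div_pos two_pos (by linarith))
  set ρ := r' / 2 with hρdef
  set μ₁ := (ρ ^ (k / s))⁻¹ with hμ₁
  set μ₂ := (ρ ^ (k / (1 - s)))⁻¹ with hμ₂
  have hμ₁0 : 0 < μ₁ := by positivity
  have hμ₂0 : 0 < μ₂ := by positivity
  -- In the geometric rate, `A` comes from the expansion of `f`, `k ^ (1/k)` from the comparison of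
  -- factorials and `exp (1/k)` from the summand `N / k` of `R`.
  refine ⟨A * k ^ (1 / k) * Real.exp (1 / k), (2 * Real.pi)⁻¹ * K * Real.exp 1 * C, μ₁ + μ₂,
    by positivity, by positivity, by positivity, fun N ξ₁ ξ₂ θ hξ => ?_⟩
  obtain ⟨ζ, τ, hτ, rfl, rfl, rfl⟩ := exists_exp_eq_of_mem_monomialSector hξ
  obtain ⟨-, -, -, -, -, hθa, hθb⟩ := hξ
  simp only at hθa hθb
  set θ := (p * ζ.1 + q * ζ.2).im + τ with hθ
  have hθε : |θ - d| ≤ ε₁ := by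
    have h1 := le_max_left |a - d| |b - d|
    have h2 := le_max_right |a - d| |b - d|
    exact abs_le.mpr ⟨by linarith [neg_abs_le (a - d)], by linarith [le_abs_self (b - d)]⟩
  have hθ' := abs_le.mp hθε
  set X := ‖exp ζ.1‖ ^ (p * k / s) with hX
  set Y := ‖exp ζ.2‖ ^ (q * k / (1 - s)) with hY
  have hX0 : 0 ≤ X := by positivity
  have hY0 : 0 ≤ Y := by positivity
  have hNk : 0 ≤ (N : ℝ) / k := by positivity
  set R := 1 + N / k + μ₁ * X + μ₂ * Y with hR
  have hμX : 0 ≤ μ₁ * X := by positivity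
  have hμY : 0 ≤ μ₂ * Y := by positivity
  have hR1 : 1 ≤ R := by rw [hR]; linarith
  have hRexp : Real.exp (Real.log R) = R := Real.exp_log (by linarith)
  have hB : hankelBound p q k s ρ (exp ζ.1) (exp ζ.2) < Real.exp (Real.log R) := by
    rw [hRexp, hankelBound, div_rpow_eq (norm_nonneg _) hρ.le, div_rpow_eq (norm_nonneg _) hρ.le]
    exact max_lt (by rw [hR]; linarith) (by rw [hR]; linarith)
  rw [monomialRemainder_monomialBorel hp hq hk hs hs' hε' hR₀ hf hc hρ (by linarith) hr'R
    (fun n => hsum n _ _) hτ (show |θ - d| < ε₂ by linarith) (by linarith) hB N, norm_smul]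
  set W := ‖exp ζ.1 ^ p * exp ζ.2 ^ q‖ with hW
  have hbound : ∀ w ∈ halfStrip (Real.log R) Φ,
      ‖monomialRemainder p q f c N (exp (tubeShift p q k s ζ w).1) (exp (tubeShift p q k s ζ w).2)
          ((p * (tubeShift p q k s ζ w).1 + q * (tubeShift p q k s ζ w).2).im + τ)‖ ≤
        C * A ^ N * (N.factorial : ℝ) ^ s₁ * (W * Real.exp (-(Real.log R / k))) ^ N := by
    intro w hw
    refine (hC N _ _ _ (tubeShift_mem_monomialSector hp hq hk hs hs' hρ hτ hB ?_ ?_ hw)).trans ?_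
    · rw [ha']; linarith
    · rw [hb']; linarith
    · rw [norm_exp_pow_mul_tubeShift hp hq hk]
      have := hw.1
      gcongr
  have hmain := norm_hankelPathIntegral_le (Real.log_nonneg hR1) p1 q1.le hbound
  have hfac := factorial_rpow_mul_exp_le (L := Real.log R) (N := N) hk hs₂
    (by rw [hRexp, hR]; linarith)
  have hexpR : Real.exp R ≤ Real.exp 1 * Real.exp (1 / k) ^ N *
      Real.exp ((μ₁ + μ₂) * (X + Y)) := by
    rw [← Real.exp_nat_mul, ← Real.exp_add, ← Real.exp_add]
    refine Real.exp_le_exp.mpr ?_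
    have e2 : (N : ℝ) * (1 / k) = N / k := mul_one_div _ _
    have e3 : (μ₁ + μ₂) * (X + Y) = μ₁ * X + μ₂ * Y + (μ₁ * Y + μ₂ * X) := by ring
    have e4 : 0 ≤ μ₁ * Y + μ₂ * X := by positivity
    rw [hR, e2, e3]
    linarith
  have hnorm : ‖(2 * Real.pi * I : ℂ)⁻¹‖ = (2 * Real.pi)⁻¹ := by
    simp [abs_of_pos hpi]
  rw [hnorm]
  rw [hRexp] at hmain
  calc _ ≤ (2 * Real.pi)⁻¹ * (K * Real.exp R * (C * A ^ N * (N.factorial : ℝ) ^ s₁ *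
        (W * Real.exp (-(Real.log R / k))) ^ N)) := by gcongr
    _ = (2 * Real.pi)⁻¹ * K * C * A ^ N * W ^ N * ((N.factorial : ℝ) ^ s₁ *
        Real.exp (-(Real.log R / k)) ^ N) * Real.exp R := by rw [mul_pow]; ring
    _ ≤ (2 * Real.pi)⁻¹ * K * C * A ^ N * W ^ N * ((k ^ (1 / k)) ^ N * (N.factorial : ℝ) ^ s₂) *
        (Real.exp 1 * Real.exp (1 / k) ^ N * Real.exp ((μ₁ + μ₂) * (X + Y))) := by gcongr
    _ = _ := by rw [mul_pow, mul_pow]; ring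

/-- The path in the definition moves with the point, even through `|θ - d|`. By path independence it
can be frozen near a given point, and then the point enters only as a translation. -/
theorem monomialHolomorphicOn_monomialBorel (hp : 0 < p) (hq : 0 < q) (hk : 0 < k) (hs : 0 < s)
    (hs' : s < 1) (hε' : 2 * ε < Real.pi / k) (hR₀ : 0 < R₀)
    (hf : HasMonomialGevreyExpansion p q s₁ (d - (Real.pi / k + 2 * ε) / 2)
      (d + (Real.pi / k + 2 * ε) / 2) (R₀ : EReal) f c) :
    MonomialHolomorphicOn p q (monomialBorel p q k s d ε R₀
      (fun x₁ x₂ θ => monomialPower p q k x₁ x₂ θ • f x₁ x₂ θ))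
      (monomialSector p q (d - ε) (d + ε) ⊤) := by
  intro ξ₁ ξ₂ θ hξ
  obtain ⟨ζ, τ, hτ, rfl, rfl, rfl⟩ := exists_exp_eq_of_mem_monomialSector hξ
  obtain ⟨-, -, -, -, -, hθa, hθb⟩ := hξ
  simp only at hθa hθb
  refine differentiableAt_continuedArg_of_tubeMap ?_
  obtain ⟨r', hr', hr'R, hc, hexp⟩ := hf.2.2
  have hr'R : r' ≤ R₀ := by exact_mod_cast hr'R
  have hpi := Real.pi_pos
  have h1s : 0 < 1 - s := by linarith
  have hθε : |(p * ζ.1 + q * ζ.2).im + τ - d| < ε := abs_lt.mpr ⟨by linarith, by linarith⟩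
  -- `ε₁` bounds the arguments of the nearby points and `ε₂ > ε₁` determines the path; the gap keeps
  -- all shifted points in a proper subsector, where `f` is bounded.
  obtain ⟨ε₁, hε₁, hε₁'⟩ := exists_between hθε
  obtain ⟨ε₂, hε₂, hε₂'⟩ := exists_between hε₁'
  have h0 : 0 ≤ ε₁ := (abs_nonneg _).trans hε₁.le
  set Φ := hankelAngle k ε ε₂ with hΦ
  have e1 : Φ / k = Real.pi / k / 2 + (ε - ε₂) := hankelAngle_div hk ε ε₂
  have p1 : Real.pi / 2 < Φ := pi_div_two_lt_hankelAngle hk hε₂'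
  have q1 : Φ < Real.pi := hankelAngle_lt_pi hk (by linarith) hε'
  have hπk : 0 < Real.pi / k := by positivity
  have hρ : 0 < r' / 2 := by positivity
  set a' := d - ε₁ - Φ / k with ha'
  set b' := d + ε₁ + Φ / k with hb'
  obtain ⟨C, A, -, -, hC⟩ := hexp a' b' (r' / 2) (by rw [ha', e1]; linarith)
    (by rw [ha', hb', e1]; linarith) (by rw [hb', e1]; linarith) hρ (by linarith)
  obtain ⟨L, hL⟩ : ∃ L, hankelBound p q k s (r' / 2) (exp ζ.1) (exp ζ.2) < Real.exp L :=
    (Real.tendsto_exp_atTop.eventually_gt_atTop _).exists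
  have hU : ∀ᶠ z : ℂ × ℂ in 𝓝 ζ, |(p * z.1 + q * z.2).im + τ - d| < ε₁ ∧
      hankelBound p q k s (r' / 2) (exp z.1) (exp z.2) < Real.exp L := by
    have c1 : Continuous fun z : ℂ × ℂ => |(p * z.1 + q * z.2).im + τ - d| := by fun_prop
    have c2 : Continuous fun z : ℂ × ℂ => hankelBound p q k s (r' / 2) (exp z.1) (exp z.2) := by
      unfold hankelBound
      refine Continuous.max ?_ ?_
      · exact Continuous.rpow_const (by fun_prop) fun _ => Or.inr (by positivity)
      · exact Continuous.rpow_const (by fun_prop) fun _ => Or.inr (by positivity)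
    exact ((c1.tendsto ζ).eventually (gt_mem_nhds hε₁)).and
      ((c2.tendsto ζ).eventually (gt_mem_nhds hL))
  have hint : DifferentiableAt ℂ (fun z => (2 * Real.pi * I : ℂ)⁻¹ • ∫ t, hankelKernel L Φ t •
      tubeMap p q τ f (z + tubeShift p q k s 0 (hankelPath L Φ t))) ζ := by
    obtain ⟨δ, hδ, hball⟩ := Metric.eventually_nhds_iff_ball.mp hU
    have hmem : ∀ t, ∀ z ∈ Metric.ball (ζ + tubeShift p q k s 0 (hankelPath L Φ t)) (δ / 2 + δ / 2),
        (exp z.1, exp z.2, (p * z.1 + q * z.2).im + τ) ∈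
          monomialSector p q a' b' ((r' / 2 : ℝ) : EReal) := by
      intro t z hz
      -- A point near the shifted `ζ` is the shift of a point near `ζ`, by the same vector for each
      -- `t`; hence `δ` does not depend on `t`.
      have hz' : z - tubeShift p q k s 0 (hankelPath L Φ t) ∈ Metric.ball ζ δ := by
        rw [Metric.mem_ball, dist_eq_norm, add_halves] at hz
        rw [Metric.mem_ball, dist_eq_norm]
        convert! hz using 2
        abel
      obtain ⟨g1, g2⟩ := hball _ hz'
      have hzeq : tubeShift p q k s (z - tubeShift p q k s 0 (hankelPath L Φ t))
          (hankelPath L Φ t) = z := by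
        ext <;> simp [tubeShift]
      have habs := abs_lt.mp g1
      have := tubeShift_mem_monomialSector (a := a') (b := b') hp hq hk hs hs' hρ hτ g2
        (by rw [ha']; linarith) (by rw [hb']; linarith)
        (hankelPath_mem L t (by linarith : 0 ≤ Φ))
      rwa [hzeq] at this
    refine (differentiableAt_integral_translate (C := C) (half_pos hδ)
      (integrable_hankelKernel L p1 q1.le)
      ((differentiable_tubeShift 0).continuous.comp (continuous_hankelPath L Φ))
      (fun t z hz => ?_) (fun t z hz => ?_)).const_smul _
    · refine (hf.1.differentiableAt_tubeMap (τ := τ) ?_).differentiableWithinAt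
      obtain ⟨m1, m2, m3, m4, m5, m6, m7⟩ := hmem t z hz
      have hle : ((r' / 2 : ℝ) : EReal) ≤ (R₀ : EReal) := by exact_mod_cast (by linarith)
      refine ⟨m1, m2, m3.trans_le hle, m4.trans_le hle, m5, lt_trans ?_ m6, lt_trans m7 ?_⟩
      · rw [ha', e1]; linarith
      · rw [hb', e1]; linarith
    · have h := hC 0 _ _ _ (hmem t z hz)
      simp only [monomialRemainder, Finset.range_zero, Finset.sum_empty, sub_zero, pow_zero, mul_one,
        Nat.factorial_zero, Nat.cast_one, Real.one_rpow] at h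
      exact h
  refine hint.congr_of_eventuallyEq ?_
  filter_upwards [hU] with z hz
  have hB' : hankelBound p q k s R₀ (exp z.1) (exp z.2) < Real.exp L :=
    (hankelBound_anti hk hs hs' hρ (by linarith) _ _).trans_lt hz.2
  rw [tubeMap, (monomialBorel_eq_hankelPathIntegral hp hq hk hs hs' hε' hR₀ hf hτ
    (hz.1.trans hε₂) hε₂' hB').2, hankelPathIntegral]
  congr 1
  refine integral_congr_ae (Eventually.of_forall fun t => ?_)
  have : tubeShift p q k s z (hankelPath L Φ t) =
      z + tubeShift p q k s 0 (hankelPath L Φ t) := by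
    ext <;> simp [tubeShift, sub_eq_add_neg]
  simp only [← hΦ, this]

end BorelExpansion

end

end

/-! ### The main theorem -/

theorem proposition3p1 {E : Type*} [NormedAddCommGroup E] [NormedSpace ℂ E] [CompleteSpace E]
    (p q : ℕ) (hp : 0 < p) (hq : 0 < q) (k s s₁ s₂ d ε R₀ : ℝ)
    (hk : 0 < k) (hs : 0 < s) (hs' : s < 1) (hs₁ : 0 ≤ s₁) (hs₂ : s₂ = max (s₁ - 1 / k) 0)
    (hε : 0 < 2 * ε) (hε' : 2 * ε < Real.pi / k) (hR₀ : 0 < R₀)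
    (f : ℂ → ℂ → ℝ → E) (c : ℕ → ℕ → E)
    (hf : HasMonomialGevreyExpansion p q s₁ (d - (Real.pi / k + 2 * ε) / 2)
      (d + (Real.pi / k + 2 * ε) / 2) (R₀ : EReal) f c)
    (F : ℂ → ℂ → ℝ → E)
    (hF : F = fun x₁ x₂ θ => monomialPower p q k x₁ x₂ θ • f x₁ x₂ θ)
    (g : ℂ → ℂ → ℝ → E) (hg : g = monomialBorel p q k s d ε R₀ F)
    (γ : ℕ → ℕ → E) (hγ : γ = formalMonomialBorel p q k s c) :
    -- `g` is well defined: every admissible Hankel path gives the value `g`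
    (∀ ε' : ℝ, 0 < ε' → ε' < ε → ∀ ξ₁ ξ₂ : ℂ, ∀ θ : ℝ,
      (ξ₁, ξ₂, θ) ∈ monomialSector p q (d - ε') (d + ε') ⊤ →
      ∀ R : ℝ, hankelBound p q k s R₀ ξ₁ ξ₂ < R →
        HankelIntegrable R (hankelAngle k ε ε') (borelIntegrand p q k s F ξ₁ ξ₂ θ) ∧
        borelAlong p q k s R (hankelAngle k ε ε') F ξ₁ ξ₂ θ = g ξ₁ ξ₂ θ) ∧
    -- the asymptotic expansion of `g`
    HasMonomialGevreyExpansion p q s₂ (d - ε) (d + ε) ⊤ g γ ∧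
    -- the maps `g_n` are entire
    (∀ n : ℕ, (∀ ξ₁ ξ₂ : ℂ, Summable (monomialTerm p q γ n ξ₁ ξ₂)) ∧
      Differentiable ℂ (fun ξ : ℂ × ℂ => monomialPart p q γ n ξ.1 ξ.2)) ∧
    -- the bounds on unbounded subsectors
    (∀ a b : ℝ, d - ε < a → a < b → b < d + ε →
      ∃ B D M : ℝ, 0 < B ∧ 0 < D ∧ 0 < M ∧ ∀ N : ℕ, ∀ ξ₁ ξ₂ : ℂ, ∀ θ : ℝ,
        (ξ₁, ξ₂, θ) ∈ monomialSector p q a b ⊤ →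
          ‖monomialRemainder p q g γ N ξ₁ ξ₂ θ‖ ≤
            D * B ^ N * Real.Gamma (1 + N * s₂) * ‖ξ₁ ^ p * ξ₂ ^ q‖ ^ N *
              Real.exp (M * (‖ξ₁‖ ^ (p * k / s) + ‖ξ₂‖ ^ (q * k / (1 - s))))) ∧
    HasExponentialGrowth p q (p * k / s) (q * k / (1 - s)) (d - ε) (d + ε) g := by
  subst hF hg hγ
  have hK : ∀ (n : ℕ) (T : ℝ), 0 < T → ∃ K : ℝ, ∀ m j, T ^ m * T ^ j *
      ‖monomialCoeff p q (formalMonomialBorel p q k s c) n m j‖ ≤ K := by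
    intro n T hT
    obtain ⟨r', hr', -, hc, -⟩ := hf.2.2
    -- For `x < 1` the powers `x ^ p` and `x ^ q` are at most `x`, hence below `r'`.
    obtain ⟨x, hx0, hx1⟩ := exists_between (lt_min hr' one_pos)
    obtain ⟨hxr, hx1⟩ := lt_min_iff.mp hx1
    obtain ⟨K, -, hK⟩ := hc.exists_norm_monomialCoeff_le hx0 hx0
      ((pow_le_of_le_one hx0.le hx1.le hp.ne').trans_lt hxr)
      ((pow_le_of_le_one hx0.le hx1.le hq.ne').trans_lt hxr) n
    exact exists_pow_mul_norm_monomialCoeff_formalMonomialBorel_le hp hq hk hs hs' hx0 hx0 hK hT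
  have hentire := fun n => summable_and_differentiable_monomialPart (hK n)
  have hcore := fun (a b : ℝ) (ha : d - ε < a) (hab : a < b) (hb : b < d + ε) =>
    exists_norm_monomialRemainder_monomialBorel_le hp hq hk hs hs' hs₂ hε' hR₀ hf
      (fun n => (hentire n).1) ha hab hb
  have hs₂0 : 0 ≤ s₂ := hs₂ ▸ le_max_right _ _
  -- The radius `1` is arbitrary: the `g_n` are entire, and bounded on every polydisc.
  refine ⟨?_, ⟨monomialHolomorphicOn_monomialBorel hp hq hk hs hs' hε' hR₀ hf,
    hf.2.1.formalMonomialBorel hp hq hk hs hs', 1, one_pos, le_top, fun n => ?_, ?_⟩, hentire, ?_, ?_⟩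
  · intro ε' _ hlt ξ₁ ξ₂ θ hξ R hR
    obtain ⟨ζ, τ, hτ, rfl, rfl, rfl⟩ := exists_exp_eq_of_mem_monomialSector hξ
    obtain ⟨-, -, -, -, -, hθa, hθb⟩ := hξ
    have hR0 : 0 < R := (hankelBound_nonneg hR₀.le _ _).trans_lt hR
    have hlog := Real.exp_log hR0
    have h := (monomialBorel_eq_hankelPathIntegral (L := Real.log R) hp hq hk hs hs' hε' hR₀ hf hτ
      (abs_lt.mpr ⟨by linarith, by linarith⟩) hlt (by rwa [hlog])).1
    rwa [hlog] at h
  · exact ⟨fun x _ => (hentire n).1 _ _, (hentire n).2.differentiableOn,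
      exists_norm_monomialPart_le hp hq (hK n)⟩
  · intro a b ρ ha hab hb hρ _
    obtain ⟨B, D, M, hB, hD, hM, h⟩ := hcore a b ha hab hb
    have h1s : 0 < 1 - s := by linarith
    -- On a sector of radius `ρ` the exponential growth factor is at most this constant.
    refine ⟨D * Real.exp (M * (ρ ^ (k / s) + ρ ^ (k / (1 - s)))), B, by positivity, hB,
      fun N ξ₁ ξ₂ θ hξ => ?_⟩
    obtain ⟨m1, m2, m3, m4, m5, m6, m7⟩ := hξ
    refine (h N ξ₁ ξ₂ θ ⟨m1, m2, EReal.coe_lt_top _, EReal.coe_lt_top _, m5, m6, m7⟩).trans ?_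
    have hrp : ∀ (z : ℂ) (l : ℕ) (α : ℝ), 0 < α → ‖z‖ ^ l < ρ →
        ‖z‖ ^ (l * k / α) ≤ ρ ^ (k / α) := by
      intro z l α hα hz
      rw [mul_div_assoc, Real.rpow_mul (norm_nonneg _), Real.rpow_natCast]
      gcongr
    have e1 := hrp ξ₁ p s hs (by exact_mod_cast m3)
    have e2 := hrp ξ₂ q (1 - s) h1s (by exact_mod_cast m4)
    calc _ ≤ D * B ^ N * (N.factorial : ℝ) ^ s₂ * ‖ξ₁ ^ p * ξ₂ ^ q‖ ^ N *
          Real.exp (M * (ρ ^ (k / s) + ρ ^ (k / (1 - s)))) := by gcongr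
      _ = _ := by ring
  · intro a b ha hab hb
    obtain ⟨B, D, M, hB, hD, hM, h⟩ := hcore a b ha hab hb
    obtain ⟨B', hB', hfac⟩ := exists_factorial_rpow_le_Gamma hs₂0
    refine ⟨B * B', D, M, by positivity, hD, hM, fun N ξ₁ ξ₂ θ hξ => (h N ξ₁ ξ₂ θ hξ).trans ?_⟩
    calc _ ≤ D * B ^ N * (B' ^ N * Real.Gamma (1 + N * s₂)) * ‖ξ₁ ^ p * ξ₂ ^ q‖ ^ N *
          Real.exp (M * (‖ξ₁‖ ^ (p * k / s) + ‖ξ₂‖ ^ (q * k / (1 - s)))) := by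
          gcongr
          exact hfac N
      _ = _ := by rw [mul_pow]; ring
  · intro a b ha hab hb
    obtain ⟨B, D, M, hB, hD, hM, h⟩ := hcore a b ha hab hb
    refine ⟨D, M, hD, hM, fun ξ₁ ξ₂ θ hξ => ?_⟩
    simpa [monomialRemainder] using h 0 ξ₁ ξ₂ θ hξ
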